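/- Let $G$ be an undirected simple $d$-regular graph. In the $r$-Routing game on $G$, Router maintains a family $\mathcal P$ of pairwise edge-disjoint paths in $G$, which is initially empty. In each turn Adversary makes one request, which has to be fulfilled before the next one is seen: either Adversary names vertices $a$ and $b$, each of which is an endpoint of fewer than $d/200$ paths in $\mathcal P$, while $|\mathcal P|<r$, and Router has to add to $\mathcal P$ a path from $a$ to $b$ that is edge-disjoint from all paths in $\mathcal P$; or Adversary names a path $P\in\mathcal P$, which is removed from $\mathcal P$. Router wins if she can satisfy every (infinite) series of requests. An $(n,d,\lambda)$-graph is a $d$-regular graph with $n$ vertices in which all eigenvalues of the adjacency matrix other than the largest one (counted with multiplicity) have absolute value at most $\lambda$. **Theorem.** There are absolute constants $\varepsilon,\alpha>0$ and a deterministic algorithm such that the following holds for every $(n,d,\lambda)$-graph $G$ with $200<d<n$ and $\lambda<\varepsilon d$. When Router answers the requests by this algorithm, she wins the $r$-Routing game on $G$ for $$r=\left\lfloor \alpha\, nd\,\frac{\log(d/\lambda)}{\log n}\right\rfloor .$$ Moreover, each request is answered in $O(n^3d^3)$ time, and each path in $\mathcal P$ always has length $O\!\left(\frac{\log n}{\log(d/\lambda)}\right)$,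 where the implied constants are absolute. (Time is measured on a random access machine with words of $O(\log n)$ bits, whose input is $n$, $d$, the adjacency matrix of $G$ and the current request, and which keeps its memory from one request to the next.) -/

import Mathlib

/-! ### `(n, d, lambda)`-graphs -/

/-- `G` is an `(n, d, lam)`-graph: it is `d`-regular on `n` vertices, and all eigenvalues of its
adjacency matrix except the largest one (the eigenvalues are listed with multiplicity, in
decreasing order) have absolute value at most `lam`. -/
def IsNDLambdaGraph (n d : ℕ) (lam : ℝ) (G : SimpleGraph (Fin n)) [DecidableRel G.Adj] : Prop :=
  G.IsRegularOfDegree d ∧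
    ∃ hA : (G.adjMatrix ℝ).IsHermitian,
      ∀ i : Fin (Fintype.card (Fin n)), 0 < i.val → |hA.eigenvalues₀ i| ≤ lam

/-! ### The routing game -/

/-- A path of the graph `G`, together with its two ends. -/
structure RoutedPath {V : Type*} (G : SimpleGraph V) where
  src : V
  dst : V
  path : G.Path src dst

namespace RoutedPath

variable {V : Type*} {G : SimpleGraph V}

/-- The edges on a path. -/
def edges (P : RoutedPath G) : List (Sym2 V) := P.path.1.edges

/-- The number of edges of a path. -/
def length (P : RoutedPath G) : ℕ := P.path.1.length

/-- The vertices of a path, listed from its start to its end. -/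
def vertices (P : RoutedPath G) : List V := P.path.1.support

end RoutedPath

/-- A request of Adversary: to connect `a` with `b`, or to remove a path. -/
inductive Request {V : Type*} (G : SimpleGraph V) where
  | findPath (a b : V) : Request G
  | removePath (P : RoutedPath G) : Request G

open Classical in
/-- The number of paths in the family `F` of which `v` is an endpoint. -/
noncomputable def endpointCount {V : Type*} {G : SimpleGraph V} (F : Multiset (RoutedPath G))
    (v : V) : ℕ :=
  (F.filter fun P => P.src = v ∨ P.dst = v).card

/-- The requests that Adversary may make in the `r`-Routing game on a `d`-regular graph while
the current family of paths is `F`. -/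
def Request.IsAllowed {V : Type*} {G : SimpleGraph V} (d r : ℕ) (F : Multiset (RoutedPath G)) :
    Request G → Prop
  | .findPath a b =>
      (endpointCount F a : ℝ) < (d : ℝ) / 200 ∧ (endpointCount F b : ℝ) < (d : ℝ) / 200 ∧
        F.card < r
  | .removePath P => P ∈ F

/-- A strategy of Router: from the earlier requests (the most recent one first) and a new pair
`(a, b)` it produces a path from `a` to `b`; the value `none` means that Router gives up. -/
abbrev RouterStrategy {V : Type*} (G : SimpleGraph V) :=
  List (Request G) → (a b : V) → Option (G.Path a b)

namespace RouterStrategy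

variable {V : Type*} {G : SimpleGraph V}

open Classical in
/-- The family of paths that is present after the given requests (the most recent one first),
when Router follows the strategy `S`. -/
noncomputable def family (S : RouterStrategy G) : List (Request G) → Multiset (RoutedPath G)
  | [] => 0
  | .findPath a b :: h =>
      match S h a b with
      | some p => ⟨a, b, p⟩ ::ₘ family S h
      | none => family S h
  | .removePath P :: h => (family S h).erase P

/-- The sequences of requests (the most recent one first) that obey the rules of the game when
Router follows the strategy `S`. -/
inductive Legal (S : RouterStrategy G) (d r : ℕ) : List (Request G) → Prop
  | nil : Legal S d r []
  | cons {h : List (Request G)} {q : Request G} :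
      Legal S d r h → q.IsAllowed d r (S.family h) → Legal S d r (q :: h)

/-- The strategy `S` wins the `r`-Routing game on the `d`-regular graph `G`: whatever the
requests so far, every new allowed pair is connected by a path which is edge-disjoint from all
paths in the current family. -/
def Wins (S : RouterStrategy G) (d r : ℕ) : Prop :=
  ∀ (h : List (Request G)) (a b : V), S.Legal d r h →
    (Request.findPath a b : Request G).IsAllowed d r (S.family h) →
      ∃ p : G.Path a b, S h a b = some p ∧
        ∀ Q ∈ S.family h, List.Disjoint p.1.edges Q.edges

end RouterStrategy

/-! ### A word RAM with step count -/

/-- Programs of a random access machine. The machine has registers (named by numbers; a program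
uses only finitely many), a memory, a read-only input and a write-only output; a word is a
natural number below a fixed bound. -/
inductive RamProgram where
  /-- do nothing -/
  | skip : RamProgram
  /-- `x := c` -/
  | const (x c : ℕ) : RamProgram
  /-- `x := y + z` -/
  | add (x y z : ℕ) : RamProgram
  /-- `x := y - z`, or `0` if this is negative -/
  | sub (x y z : ℕ) : RamProgram
  /-- `x := y * z` -/
  | mul (x y z : ℕ) : RamProgram
  /-- `x := y / z`, rounded down -/
  | div (x y z : ℕ) : RamProgram
  /-- `x := memory[y]` -/
  | load (x y : ℕ) : RamProgram
  /-- `memory[x] := y` -/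
  | store (x y : ℕ) : RamProgram
  /-- `x := input[y]` -/
  | read (x y : ℕ) : RamProgram
  /-- append the value of `x` to the output -/
  | write (x : ℕ) : RamProgram
  /-- first `p`, then `q` -/
  | seq (p q : RamProgram) : RamProgram
  /-- `p` if `x < y`, and `q` otherwise -/
  | ifLt (x y : ℕ) (p q : RamProgram) : RamProgram
  /-- repeat `p` as long as `x < y` -/
  | whileLt (x y : ℕ) (p : RamProgram) : RamProgram

/-- The contents of the registers and of the memory. -/
structure RamStore where
  reg : ℕ → ℕ
  mem : ℕ → ℕ

/-- The store in which everything is `0`. -/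
def RamStore.zero : RamStore := ⟨fun _ => 0, fun _ => 0⟩

/-- The store after the register `x` is set to `v`. -/
def RamStore.setReg (s : RamStore) (x v : ℕ) : RamStore := ⟨Function.update s.reg x v, s.mem⟩

/-- The store after the memory cell `i` is set to `v`. -/
def RamStore.setMem (s : RamStore) (i v : ℕ) : RamStore := ⟨s.reg, Function.update s.mem i v⟩

/-- `RamProgram.Exec W inp p s o t s' o'`: on the read-only input `inp`, the program `p` started
with the store `s` and the output `o` terminates after exactly `t` steps with the store `s'` and
the output `o'`. Each elementary instruction and each test is one step. A computed value that is
not below the word bound `W` is an overflow: the execution then does not terminate properly. -/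
inductive RamProgram.Exec (W : ℕ) (inp : List ℕ) :
    RamProgram → RamStore → List ℕ → ℕ → RamStore → List ℕ → Prop
  | skip (s : RamStore) (o : List ℕ) : Exec W inp .skip s o 1 s o
  | const (x c : ℕ) (s : RamStore) (o : List ℕ) (hW : c < W) :
      Exec W inp (.const x c) s o 1 (s.setReg x c) o
  | add (x y z : ℕ) (s : RamStore) (o : List ℕ) (hW : s.reg y + s.reg z < W) :
      Exec W inp (.add x y z) s o 1 (s.setReg x (s.reg y + s.reg z)) o
  | sub (x y z : ℕ) (s : RamStore) (o : List ℕ) :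
      Exec W inp (.sub x y z) s o 1 (s.setReg x (s.reg y - s.reg z)) o
  | mul (x y z : ℕ) (s : RamStore) (o : List ℕ) (hW : s.reg y * s.reg z < W) :
      Exec W inp (.mul x y z) s o 1 (s.setReg x (s.reg y * s.reg z)) o
  | div (x y z : ℕ) (s : RamStore) (o : List ℕ) :
      Exec W inp (.div x y z) s o 1 (s.setReg x (s.reg y / s.reg z)) o
  | load (x y : ℕ) (s : RamStore) (o : List ℕ) :
      Exec W inp (.load x y) s o 1 (s.setReg x (s.mem (s.reg y))) o
  | store (x y : ℕ) (s : RamStore) (o : List ℕ) :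
      Exec W inp (.store x y) s o 1 (s.setMem (s.reg x) (s.reg y)) o
  | read (x y : ℕ) (s : RamStore) (o : List ℕ) (hW : inp.getD (s.reg y) 0 < W) :
      Exec W inp (.read x y) s o 1 (s.setReg x (inp.getD (s.reg y) 0)) o
  | write (x : ℕ) (s : RamStore) (o : List ℕ) :
      Exec W inp (.write x) s o 1 s (o ++ [s.reg x])
  | seq {p q : RamProgram} {s₁ s₂ s₃ : RamStore} {o₁ o₂ o₃ : List ℕ} {t₁ t₂ : ℕ} :
      Exec W inp p s₁ o₁ t₁ s₂ o₂ → Exec W inp q s₂ o₂ t₂ s₃ o₃ →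
      Exec W inp (.seq p q) s₁ o₁ (t₁ + t₂) s₃ o₃
  | ifTrue {x y : ℕ} {p q : RamProgram} {s s' : RamStore} {o o' : List ℕ} {t : ℕ} :
      s.reg x < s.reg y → Exec W inp p s o t s' o' →
      Exec W inp (.ifLt x y p q) s o (t + 1) s' o'
  | ifFalse {x y : ℕ} {p q : RamProgram} {s s' : RamStore} {o o' : List ℕ} {t : ℕ} :
      ¬ s.reg x < s.reg y → Exec W inp q s o t s' o' →
      Exec W inp (.ifLt x y p q) s o (t + 1) s' o'
  | whileTrue {x y : ℕ} {p : RamProgram} {s₁ s₂ s₃ : RamStore} {o₁ o₂ o₃ : List ℕ} {t₁ t₂ : ℕ} :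
      s₁.reg x < s₁.reg y → Exec W inp p s₁ o₁ t₁ s₂ o₂ →
      Exec W inp (.whileLt x y p) s₂ o₂ t₂ s₃ o₃ →
      Exec W inp (.whileLt x y p) s₁ o₁ (t₁ + t₂ + 1) s₃ o₃
  | whileFalse {x y : ℕ} {p : RamProgram} {s : RamStore} {o : List ℕ} :
      ¬ s.reg x < s.reg y → Exec W inp (.whileLt x y p) s o 1 s o

/-! ### Strategies that are computed by a program -/

/-- The words that describe a path: the vertices on it, from its start to its end. -/
def encodePath {n : ℕ} {G : SimpleGraph (Fin n)} (P : RoutedPath G) : List ℕ :=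
  P.vertices.map Fin.val

/-- The words that describe a request: `0, a, b` for the pair `(a, b)`, and `1, k, v₁, …, v_k`
for the removal of the path with the vertices `v₁, …, v_k`. -/
def encodeRequest {n : ℕ} {G : SimpleGraph (Fin n)} : Request G → List ℕ
  | .findPath a b => [0, a.val, b.val]
  | .removePath P => 1 :: (encodePath P).length :: encodePath P

/-- The input of the machine: `n`, `d`, the rows of the adjacency matrix, and the request. -/
def encodeInput {n : ℕ} (d : ℕ) (G : SimpleGraph (Fin n)) [DecidableRel G.Adj] (q : Request G) :
    List ℕ :=
  [n, d] ++ List.ofFn (fun k : Fin (n * n) => if G.Adj k.divNat k.modNat then 1 else 0) ++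
    encodeRequest q

/-- The words that Router has to output as the answer to a request: the path that the strategy
`S` chooses, or nothing if a path is to be removed. -/
def RouterStrategy.answer {n : ℕ} {G : SimpleGraph (Fin n)} (S : RouterStrategy G)
    (h : List (Request G)) : Request G → List ℕ
  | .findPath a b =>
      match S h a b with
      | some p => encodePath ⟨a, b, p⟩
      | none => []
  | .removePath _ => []

/-- The program `prog`, run anew on each request with the registers and the memory as they were
left after the previous request (all `0` before the first one), answers each request of the
`r`-Routing game on `G` according to the strategy `S`, within `T` steps and with words below `W`.
There is no separate preprocessing. -/
def RamProgram.Plays {n : ℕ} {G : SimpleGraph (Fin n)} [DecidableRel G.Adj] (prog : RamProgram)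
    (S : RouterStrategy G) (d r W T : ℕ) : Prop :=
  ∃ M : List (Request G) → RamStore, M [] = RamStore.zero ∧
    ∀ (h : List (Request G)) (q : Request G), S.Legal d r h → q.IsAllowed d r (S.family h) →
      ∃ t : ℕ, t ≤ T ∧
        prog.Exec W (encodeInput d G q) (M h) [] t (M (q :: h)) (S.answer h q)

/-!
# Routing edge-disjoint paths in an expander, online

Let `F` be the current family of paths. If only few edges of `F` meet every vertex, then the
breadth-first balls in the graph of the unused edges grow by a factor of order `(d / lam) ^ 2` in
each step, by the expander mixing lemma (`IsNDLambdaGraph.mixingBound`,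
`MixingBound.lt_two_mul_card_stepBall`). Hence the balls of radius `⌈log n / log (d / lam)⌉` around
any two vertices contain more than half of the vertices each and meet, so that a short path can be
added. The problem is to keep the paths from using up the edges at some vertex, although Adversary
chooses the requests adaptively and may remove paths.

For this, Router *jams* the vertices at which at least `d / 20` edges are used, together with all
vertices that have more than `d / 50` jammed neighbours (`jammed`). The paths of `F` have `O(n d)`
edges, with a small constant, so by the mixing lemma there are at most `n / 200` jammed vertices
(`card_jammed_le`), and every set of so few vertices has a vertex with at most `d / 50` neighbours
in it (`MixingBound.exists_degIn_le`). When vertices become jammed, one therefore removes them one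
by one, each with at most `d / 50` neighbours among those that remain. The neighbours of a removed
vertex `v` that remain at that time, or were jammed before, form its *entry set* `I v`, of at most
`d / 25` vertices. From now on, as long as `v` is jammed, a new path may enter `v` only from `I v`,
unless it starts or ends in `v`. Every edge between jammed vertices joins one of its ends to a
member of the entry set of that end. Three facts make this work:

* A jammed vertex has few used edges (`usedDegree_le`): those of paths that were there when it was
  jammed, those of paths that end in it, and at most two for each edge to its entry set.
* Every vertex `v` can be left along `3 d / 4` edges, whether it is jammed or not
  (`RoutingInvariant.card_allowedStep`). For a jammed `v`, the edges to jammed vertices `w` are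
  allowed unless `w ∈ I v`, because otherwise `v ∈ I w`.
* A path that is found by breadth-first searches from both of its ends consists of allowed steps
  towards a meeting point. Its inner jammed vertices, whichever search found them, are adjacent on
  it to a member of their entry sets (`exists_meeting_path`).

These properties are collected in `RoutingInvariant`, which survives the addition
(`RoutingInvariant.cons`) and the removal (`RoutingInvariant.of_cons`) of a path. The jammed set
only shrinks when a path is removed, and the entry sets are kept.

The strategy is deterministic and is computed by the program `Router.main` in a small language of
bounded loops, in which running times can be read off from the nesting depth. Its translation to
the word RAM is proved correct once and for all (`LoopProg.exec_compile`). The program has nesting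
depth `3` and so answers a request in time `O(n ^ 3)`.
-/

/-! ### A bounded loop language and its translation to the word RAM -/

/-- Expressions of the loop language. Variables and array cells hold numbers at most `n`. -/
inductive LoopExpr where
  | lit (c : ℕ) : LoopExpr
  | size : LoopExpr
  | var (x : ℕ) : LoopExpr
  /-- entry of the array `a`, in the row and column given by the variables `x` and `y` -/
  | cell (a x y : ℕ) : LoopExpr
  | input (e : LoopExpr) : LoopExpr
  | add (e f : LoopExpr) : LoopExpr
  | sub (e f : LoopExpr) : LoopExpr
  | mul (e f : LoopExpr) : LoopExpr

/-- Programs of the loop language. The only loop construct runs its body for the values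
`0, …, n - 1` of a variable, so every program terminates, and its nesting depth bounds its running
time. One-dimensional arrays are stored on the diagonal of two-dimensional ones. -/
inductive LoopProg where
  | skip : LoopProg
  | set (x : ℕ) (e : LoopExpr) : LoopProg
  | put (a x y : ℕ) (e : LoopExpr) : LoopProg
  | out (e : LoopExpr) : LoopProg
  /-- `p` if `e` is positive, and `q` otherwise -/
  | ite (e : LoopExpr) (p q : LoopProg) : LoopProg
  | seq (p q : LoopProg) : LoopProg
  | loop (x : ℕ) (p : LoopProg) : LoopProg

/-- The values of the variables and of the array cells, and the output. -/
@[ext] structure LoopState where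
  v : ℕ → ℕ
  m : ℕ → ℕ → ℕ → ℕ
  o : List ℕ

namespace LoopState

/-- The state after the variable `x` is set to `c`. -/
def setV (σ : LoopState) (x c : ℕ) : LoopState := ⟨Function.update σ.v x c, σ.m, σ.o⟩

/-- The state after the cell `(i, j)` of the array `a` is set to `c`. -/
def setM (σ : LoopState) (a i j c : ℕ) : LoopState :=
  ⟨σ.v, fun a' i' j' => if a' = a ∧ i' = i ∧ j' = j then c else σ.m a' i' j', σ.o⟩

/-- The state after `c` is appended to the output. -/
def app (σ : LoopState) (c : ℕ) : LoopState := ⟨σ.v, σ.m, σ.o ++ [c]⟩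

/-- All values are at most `n`. -/
def Bounded (n : ℕ) (σ : LoopState) : Prop := (∀ x, σ.v x ≤ n) ∧ ∀ a i j, σ.m a i j ≤ n

@[simp] lemma setV_m (σ : LoopState) (x c : ℕ) : (σ.setV x c).m = σ.m := rfl
@[simp] lemma setV_o (σ : LoopState) (x c : ℕ) : (σ.setV x c).o = σ.o := rfl
@[simp] lemma setV_v (σ : LoopState) (x c y : ℕ) :
    (σ.setV x c).v y = if y = x then c else σ.v y := by
  simp [setV, Function.update_apply]
@[simp] lemma setM_v (σ : LoopState) (a i j c : ℕ) : (σ.setM a i j c).v = σ.v := rfl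
@[simp] lemma setM_o (σ : LoopState) (a i j c : ℕ) : (σ.setM a i j c).o = σ.o := rfl
lemma setM_m (σ : LoopState) (a i j c a' i' j' : ℕ) :
    (σ.setM a i j c).m a' i' j' = if a' = a ∧ i' = i ∧ j' = j then c else σ.m a' i' j' := rfl
@[simp] lemma app_v (σ : LoopState) (c : ℕ) : (σ.app c).v = σ.v := rfl
@[simp] lemma app_m (σ : LoopState) (c : ℕ) : (σ.app c).m = σ.m := rfl
@[simp] lemma app_o (σ : LoopState) (c : ℕ) : (σ.app c).o = σ.o ++ [c] := rfl

lemma Bounded.setV {n : ℕ} {σ : LoopState} (h : σ.Bounded n) (x : ℕ) {c : ℕ} (hc : c ≤ n) :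
    (σ.setV x c).Bounded n := by
  refine ⟨fun y => ?_, h.2⟩
  rw [setV_v]; split_ifs
  exacts [hc, h.1 y]

lemma Bounded.setM {n : ℕ} {σ : LoopState} (h : σ.Bounded n) (a i j : ℕ) {c : ℕ} (hc : c ≤ n) :
    (σ.setM a i j c).Bounded n := by
  refine ⟨h.1, fun a' i' j' => ?_⟩
  rw [setM_m]; split_ifs
  exacts [hc, h.2 _ _ _]

end LoopState

/-- The value of an expression, for the input `inp`. -/
def LoopExpr.eval (n : ℕ) (inp : List ℕ) (σ : LoopState) : LoopExpr → ℕ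
  | .lit c => c
  | .size => n
  | .var x => σ.v x
  | .cell a x y => σ.m a (σ.v x) (σ.v y)
  | .input e => inp.getD (e.eval n inp σ) 0
  | .add e f => e.eval n inp σ + f.eval n inp σ
  | .sub e f => e.eval n inp σ - f.eval n inp σ
  | .mul e f => e.eval n inp σ * f.eval n inp σ

/-- The state after `p` is run for the values `0, …, k - 1` of the variable `x`. -/
def LoopState.iter (f : LoopState → LoopState) (x : ℕ) : ℕ → LoopState → LoopState
  | 0, σ => σ
  | k + 1, σ => f ((LoopState.iter f x k σ).setV x k)

/-- The state after the execution of a program. Stored values are truncated at `n`. -/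
def LoopProg.run (n : ℕ) (inp : List ℕ) : LoopProg → LoopState → LoopState
  | .skip => fun σ => σ
  | .set x e => fun σ => σ.setV x (min (e.eval n inp σ) n)
  | .put a x y e => fun σ => σ.setM a (σ.v x) (σ.v y) (min (e.eval n inp σ) n)
  | .out e => fun σ => σ.app (e.eval n inp σ)
  | .ite e p q => fun σ => if 0 < e.eval n inp σ then p.run n inp σ else q.run n inp σ
  | .seq p q => fun σ => q.run n inp (p.run n inp σ)
  | .loop x p => fun σ => LoopState.iter (p.run n inp) x n σ

namespace LoopProg

/-- The variables that a program may change. -/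
def vars : LoopProg → List ℕ
  | .skip => []
  | .set x _ => [x]
  | .put _ _ _ _ => []
  | .out _ => []
  | .ite _ p q => p.vars ++ q.vars
  | .seq p q => p.vars ++ q.vars
  | .loop x p => x :: p.vars

/-- The arrays that a program may change. -/
def arrays : LoopProg → List ℕ
  | .skip => []
  | .set _ _ => []
  | .put a _ _ _ => [a]
  | .out _ => []
  | .ite _ p q => p.arrays ++ q.arrays
  | .seq p q => p.arrays ++ q.arrays
  | .loop _ p => p.arrays

/-- The program has no output instruction. -/
def Silent : LoopProg → Prop
  | .skip => True
  | .set _ _ => True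
  | .put _ _ _ _ => True
  | .out _ => False
  | .ite _ p q => p.Silent ∧ q.Silent
  | .seq p q => p.Silent ∧ q.Silent
  | .loop _ p => p.Silent

variable {n : ℕ} {inp : List ℕ}

lemma run_v {p : LoopProg} {y : ℕ} (h : y ∉ p.vars) (σ : LoopState) :
    (p.run n inp σ).v y = σ.v y := by
  induction p generalizing σ with
  | skip => rfl
  | set x e => simp [vars] at h; simp [run, h]
  | put a x z e => simp [run]
  | out e => simp [run]
  | ite e p q ihp ihq =>
    simp [vars] at h
    simp only [run]; split_ifs
    exacts [ihp h.1 σ, ihq h.2 σ]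
  | seq p q ihp ihq =>
    simp [vars] at h
    simp only [run]; rw [ihq h.2, ihp h.1]
  | loop x p ih =>
    simp [vars] at h
    simp only [run]
    have : ∀ k, (LoopState.iter (p.run n inp) x k σ).v y = σ.v y := by
      intro k
      induction k with
      | zero => rfl
      | succ k ihk => simp only [LoopState.iter]; rw [ih h.2, LoopState.setV_v, if_neg h.1, ihk]
    exact this n

lemma run_m {p : LoopProg} {a : ℕ} (h : a ∉ p.arrays) (σ : LoopState) :
    (p.run n inp σ).m a = σ.m a := by
  induction p generalizing σ with
  | skip => rfl
  | set x e => simp [run]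
  | put a' x z e =>
    simp [arrays] at h
    funext i j
    simp [run, LoopState.setM_m, h]
  | out e => simp [run]
  | ite e p q ihp ihq =>
    simp [arrays] at h
    simp only [run]; split_ifs
    exacts [ihp h.1 σ, ihq h.2 σ]
  | seq p q ihp ihq =>
    simp [arrays] at h
    simp only [run]; rw [ihq h.2, ihp h.1]
  | loop x p ih =>
    simp only [arrays] at h
    simp only [run]
    have : ∀ k, (LoopState.iter (p.run n inp) x k σ).m a = σ.m a := by
      intro k
      induction k with
      | zero => rfl
      | succ k ihk => simp only [LoopState.iter]; rw [ih h, LoopState.setV_m, ihk]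
    exact this n

lemma run_o {p : LoopProg} (h : p.Silent) (σ : LoopState) : (p.run n inp σ).o = σ.o := by
  induction p generalizing σ with
  | skip => rfl
  | set x e => simp [run]
  | put a' x z e => simp [run]
  | out e => exact h.elim
  | ite e p q ihp ihq =>
    simp only [run]; split_ifs
    exacts [ihp h.1 σ, ihq h.2 σ]
  | seq p q ihp ihq => simp only [run]; rw [ihq h.2, ihp h.1]
  | loop x p ih =>
    simp only [run]
    have : ∀ k, (LoopState.iter (p.run n inp) x k σ).o = σ.o := by
      intro k
      induction k with
      | zero => rfl
      | succ k ihk => simp only [LoopState.iter]; rw [ih h, LoopState.setV_o, ihk]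
    exact this n

lemma run_m_eq {p : LoopProg} (h : p.arrays = []) (σ : LoopState) : (p.run n inp σ).m = σ.m :=
  funext fun a => run_m (by rw [h]; exact List.not_mem_nil) σ

/-- The invariant rule for loops. -/
lemma run_loop {x : ℕ} {p : LoopProg} {σ : LoopState} (I : ℕ → LoopState → Prop) (h0 : I 0 σ)
    (hs : ∀ (i : Fin n) (τ : LoopState), I i τ → I (i + 1) (p.run n inp (τ.setV x i))) :
    I n ((loop x p).run n inp σ) := by
  have : ∀ k ≤ n, I k (LoopState.iter (p.run n inp) x k σ) := by
    intro k
    induction k with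
    | zero => intro _; exact h0
    | succ k ih => intro hk; exact hs ⟨k, hk⟩ _ (ih (by omega))
  exact this n le_rfl

lemma bounded_run {p : LoopProg} {σ : LoopState} (h : σ.Bounded n) :
    (p.run n inp σ).Bounded n := by
  induction p generalizing σ with
  | skip => exact h
  | set x e => exact h.setV _ (min_le_right _ _)
  | put a' x z e => exact h.setM _ _ _ (min_le_right _ _)
  | out e => exact h
  | ite e p q ihp ihq =>
    simp only [run]; split_ifs
    exacts [ihp h, ihq h]
  | seq p q ihp ihq => exact ihq (ihp h)
  | loop x p ih =>
    exact run_loop (fun _ τ => τ.Bounded n) h fun i τ hτ => ih (hτ.setV _ i.2.le)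

end LoopProg

/-- The RAM register that holds the `k`-th temporary value. The registers `0`, `1`, `2`, `3` hold
`0`, `1`, `n`, `n + 1`, and those from `4` on are divided among variables, loop counters and
temporary values. -/
def tempReg (k : ℕ) : ℕ := 6 + 3 * k

/-- The RAM register that holds the variable `x`. -/
def varReg (x : ℕ) : ℕ := 4 + 3 * x

/-- The RAM register that holds the counter of a loop inside `l` other loops. -/
def counterReg (l : ℕ) : ℕ := 5 + 3 * l

/-- The address of a cell of an array. -/
def cellAddress (n a i j : ℕ) : ℕ := (a * (n + 1) + i) * (n + 1) + j

open RamProgram in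
/-- RAM code that puts the address of a cell into the `k`-th temporary register. -/
def addressCode (a x y k : ℕ) : RamProgram :=
  (const (tempReg k) a).seq <| (mul (tempReg k) (tempReg k) 3).seq <|
    (add (tempReg k) (tempReg k) (varReg x)).seq <| (mul (tempReg k) (tempReg k) 3).seq <|
      add (tempReg k) (tempReg k) (varReg y)

/-- RAM code that puts the value of an expression into the `k`-th temporary register. -/
def LoopExpr.code : LoopExpr → ℕ → RamProgram
  | .lit c, k => .const (tempReg k) c
  | .size, k => .add (tempReg k) 2 0
  | .var x, k => .add (tempReg k) (varReg x) 0
  | .cell a x y, k => (addressCode a x y k).seq (.load (tempReg k) (tempReg k))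
  | .input e, k => (e.code k).seq (.read (tempReg k) (tempReg k))
  | .add e f, k =>
    (e.code k).seq <| (f.code (k + 1)).seq <| .add (tempReg k) (tempReg k) (tempReg (k + 1))
  | .sub e f, k =>
    (e.code k).seq <| (f.code (k + 1)).seq <| .sub (tempReg k) (tempReg k) (tempReg (k + 1))
  | .mul e f, k =>
    (e.code k).seq <| (f.code (k + 1)).seq <| .mul (tempReg k) (tempReg k) (tempReg (k + 1))

/-- The running time of the code of an expression. -/
def LoopExpr.cost : LoopExpr → ℕ
  | .lit _ => 1
  | .size => 1
  | .var _ => 1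
  | .cell _ _ _ => 6
  | .input e => e.cost + 1
  | .add e f => e.cost + f.cost + 1
  | .sub e f => e.cost + f.cost + 1
  | .mul e f => e.cost + f.cost + 1

/-- All intermediate values of the code of an expression are below `n ^ e.width`. -/
def LoopExpr.width : LoopExpr → ℕ
  | .lit c => c + 1
  | .size => 2
  | .var _ => 2
  | .cell a _ _ => a + 6
  | .input e => max e.width 2
  | .add e f => max e.width f.width + 1
  | .sub e f => max e.width f.width
  | .mul e f => e.width + f.width

open RamProgram in
/-- RAM code for a program inside `l` loops. Truncation uses `min e n = e - (e - n)`. -/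
def LoopProg.code : LoopProg → ℕ → RamProgram
  | .skip, _ => RamProgram.skip
  | .set x e, _ =>
    (e.code 0).seq <| (sub (tempReg 1) (tempReg 0) 2).seq <| sub (varReg x) (tempReg 0) (tempReg 1)
  | .put a x y e, _ =>
    (e.code 0).seq <| (sub (tempReg 1) (tempReg 0) 2).seq <|
      (sub (tempReg 0) (tempReg 0) (tempReg 1)).seq <|
        (addressCode a x y 1).seq <| store (tempReg 1) (tempReg 0)
  | .out e, _ => (e.code 0).seq <| write (tempReg 0)
  | .ite e p q, l => (e.code 0).seq <| ifLt 0 (tempReg 0) (p.code l) (q.code l)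
  | .seq p q, l => (p.code l).seq (q.code l)
  | .loop x p, l =>
    (const (counterReg l) 0).seq <| whileLt (counterReg l) 2 <|
      (add (varReg x) (counterReg l) 0).seq <|
        (p.code (l + 1)).seq <| add (counterReg l) (counterReg l) 1

namespace LoopProg

/-- The greatest number of nested loops. -/
def depth : LoopProg → ℕ
  | .skip => 0
  | .set _ _ => 0
  | .put _ _ _ _ => 0
  | .out _ => 0
  | .ite _ p q => max p.depth q.depth
  | .seq p q => max p.depth q.depth
  | .loop _ p => p.depth + 1

/-- The code of `p` runs for at most `p.cost * n ^ p.depth` steps. -/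
def cost : LoopProg → ℕ
  | .skip => 1
  | .set _ e => e.cost + 2
  | .put _ _ _ e => e.cost + 8
  | .out e => e.cost + 1
  | .ite e p q => e.cost + p.cost + q.cost + 1
  | .seq p q => p.cost + q.cost
  | .loop _ p => p.cost + 5

/-- All values computed by the code of `p` are below `n ^ p.width`. -/
def width : LoopProg → ℕ
  | .skip => 0
  | .set _ e => e.width
  | .put a _ _ e => max e.width (a + 6)
  | .out e => e.width
  | .ite e p q => max e.width (max p.width q.width)
  | .seq p q => max p.width q.width
  | .loop _ p => max p.width 2

end LoopProg

/-- The RAM store `s` represents the state `σ`. -/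
structure Represents (n : ℕ) (s : RamStore) (σ : LoopState) : Prop where
  v : ∀ x, s.reg (varReg x) = σ.v x
  m : ∀ a i j, i ≤ n → j ≤ n → s.mem (cellAddress n a i j) = σ.m a i j
  zero : s.reg 0 = 0
  one : s.reg 1 = 1
  two : s.reg 2 = n
  three : s.reg 3 = n + 1

lemma cellAddress_inj {n a i j a' i' j' : ℕ} (hi : i ≤ n) (hj : j ≤ n) (hi' : i' ≤ n)
    (hj' : j' ≤ n) (h : cellAddress n a i j = cellAddress n a' i' j') :
    a = a' ∧ i = i' ∧ j = j' := by
  have key : ∀ {x y x' y' : ℕ}, y ≤ n → y' ≤ n → x * (n + 1) + y = x' * (n + 1) + y' →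
      x = x' ∧ y = y' := by
    intro x y x' y' hy hy' hxy
    have h1 : (x * (n + 1) + y) / (n + 1) = x := by
      rw [mul_comm, Nat.mul_add_div (by omega), Nat.div_eq_of_lt (by omega)]; rfl
    have h2 : (x' * (n + 1) + y') / (n + 1) = x' := by
      rw [mul_comm, Nat.mul_add_div (by omega), Nat.div_eq_of_lt (by omega)]; rfl
    have h3 : x = x' := by rw [← h1, ← h2, hxy]
    subst h3
    exact ⟨rfl, by omega⟩
  obtain ⟨h1, h2⟩ := key hj hj' h
  obtain ⟨h3, h4⟩ := key hi hi' h1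
  exact ⟨h3, h4, h2⟩

section Simulation

variable {n W : ℕ} {inp : List ℕ}

lemma cellAddress_lt {a i j : ℕ} (hn : 2 ≤ n) (hi : i ≤ n) (hj : j ≤ n) :
    cellAddress n a i j < n ^ (a + 6) := by
  have h1 : a < n ^ a := Nat.lt_pow_self (by omega)
  have h2 : n + 1 ≤ n ^ 2 := by nlinarith
  have h3 : a * (n + 1) + i < n ^ (a + 2) := by
    calc a * (n + 1) + i < (a + 1) * (n + 1) := by nlinarith
      _ ≤ n ^ a * n ^ 2 := Nat.mul_le_mul h1 h2
      _ = n ^ (a + 2) := (pow_add ..).symm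
  calc cellAddress n a i j < (a * (n + 1) + i + 1) * (n + 1) := by unfold cellAddress; nlinarith
    _ ≤ n ^ (a + 2) * n ^ 2 := Nat.mul_le_mul h3 h2
    _ = n ^ (a + 4) := (pow_add ..).symm
    _ ≤ n ^ (a + 6) := Nat.pow_le_pow_right (by omega) (by omega)

lemma exec_addressCode {a x y k : ℕ} {s : RamStore} {σ : LoopState} {o : List ℕ} (hn : 2 ≤ n)
    (hW : n ^ (a + 6) ≤ W) (hs : Represents n s σ) (hσ : σ.Bounded n) :
    (addressCode a x y k).Exec W inp s o 5
      (s.setReg (tempReg k) (cellAddress n a (σ.v x) (σ.v y))) o := by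
  have hlt := (cellAddress_lt (a := a) hn (hσ.1 x) (hσ.1 y)).trans_le hW
  unfold cellAddress at hlt
  have h1 : (a * (n + 1) + σ.v x) * (n + 1) < W := by omega
  have h2 : a * (n + 1) + σ.v x < W := by nlinarith
  have h3 : a < W := by nlinarith
  have hv : ∀ z, varReg z ≠ tempReg k := fun z => by unfold varReg tempReg; omega
  have h3' : 3 ≠ tempReg k := by unfold tempReg; omega
  have e1 := RamProgram.Exec.const (W := W) (inp := inp) (tempReg k) a s o h3
  have e2 := RamProgram.Exec.mul (W := W) (inp := inp) (tempReg k) (tempReg k) 3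
    (s.setReg (tempReg k) a) o
    (by simp [RamStore.setReg, h3', hs.three]; omega)
  have e3 := RamProgram.Exec.add (W := W) (inp := inp) (tempReg k) (tempReg k) (varReg x)
    (s.setReg (tempReg k) (a * (n + 1))) o
    (by simp [RamStore.setReg, hv, hs.v]; omega)
  have e4 := RamProgram.Exec.mul (W := W) (inp := inp) (tempReg k) (tempReg k) 3
    (s.setReg (tempReg k) (a * (n + 1) + σ.v x)) o
    (by simp [RamStore.setReg, h3', hs.three]; omega)
  have e5 := RamProgram.Exec.add (W := W) (inp := inp) (tempReg k) (tempReg k) (varReg y)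
    (s.setReg (tempReg k) ((a * (n + 1) + σ.v x) * (n + 1))) o
    (by simp [RamStore.setReg, hv, hs.v]; omega)
  simp [RamStore.setReg, h3', hv, hs.three, hs.v] at e1 e2 e3 e4 e5
  have := e1.seq (e2.seq (e3.seq (e4.seq e5)))
  simpa [RamStore.setReg, cellAddress, addressCode] using this

lemma LoopExpr.eval_lt {σ : LoopState} (hn : 2 ≤ n) (hin : ∀ w ∈ inp, w ≤ n)
    (hσ : σ.Bounded n) (e : LoopExpr) : e.eval n inp σ < n ^ e.width := by
  have hn2 : n < n ^ 2 := by nlinarith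
  induction e with
  | lit c =>
    exact (Nat.lt_pow_self (by omega)).trans_le (Nat.pow_le_pow_right (by omega) (Nat.le_succ c))
  | size => exact hn2
  | var x => exact (hσ.1 x).trans_lt hn2
  | cell a x y =>
    exact (hσ.2 _ _ _).trans_lt (hn2.trans_le (Nat.pow_le_pow_right (by omega) (by simp [width])))
  | input e _ =>
    have : inp.getD (e.eval n inp σ) 0 ≤ n := by
      rw [List.getD_eq_getElem?_getD]
      rcases h : inp[e.eval n inp σ]? with _ | w
      · simp
      · exact hin w (List.mem_of_getElem? h)
    exact this.trans_lt (hn2.trans_le (Nat.pow_le_pow_right (by omega) (le_max_right _ _)))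
  | add e f ihe ihf =>
    have h1 := ihe.trans_le (Nat.pow_le_pow_right (by omega) (le_max_left e.width f.width))
    have h2 := ihf.trans_le (Nat.pow_le_pow_right (by omega) (le_max_right e.width f.width))
    simp only [eval, width, pow_succ]
    nlinarith
  | sub e f ihe ihf =>
    have h1 := ihe.trans_le (Nat.pow_le_pow_right (by omega) (le_max_left e.width f.width))
    simp only [eval, width]
    omega
  | mul e f ihe ihf =>
    simp only [eval, width, pow_add]
    exact Nat.mul_lt_mul'' ihe ihf

lemma Represents.of_agree {s s' : RamStore} {σ : LoopState} (h : Represents n s σ)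
    (hm : s'.mem = s.mem) (hr : ∀ r, (∀ j, r ≠ tempReg j) → s'.reg r = s.reg r) :
    Represents n s' σ := by
  refine ⟨fun x => ?_, ?_, ?_, ?_, ?_, ?_⟩
  · rw [hr _ fun j => by unfold varReg tempReg; omega, h.v]
  · rw [hm]; exact h.m
  · rw [hr _ fun j => by unfold tempReg; omega, h.zero]
  · rw [hr _ fun j => by unfold tempReg; omega, h.one]
  · rw [hr _ fun j => by unfold tempReg; omega, h.two]
  · rw [hr _ fun j => by unfold tempReg; omega, h.three]

/-- The code of `e` computes the value of `e` and changes temporary registers only. -/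
def LoopExpr.CodeCorrect (n W : ℕ) (inp : List ℕ) (σ : LoopState) (e : LoopExpr) : Prop :=
  ∀ (k : ℕ) (s : RamStore) (o : List ℕ), Represents n s σ → n ^ e.width ≤ W →
    ∃ s', (e.code k).Exec W inp s o e.cost s' o ∧ s'.mem = s.mem ∧
      s'.reg (tempReg k) = e.eval n inp σ ∧
      ∀ r, (∀ j ≥ k, r ≠ tempReg j) → s'.reg r = s.reg r

lemma LoopExpr.CodeCorrect.pair {σ : LoopState} {e f : LoopExpr}
    (he : e.CodeCorrect n W inp σ) (hf : f.CodeCorrect n W inp σ) {k : ℕ} {s : RamStore}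
    (o : List ℕ) (hs : Represents n s σ) (hWe : n ^ e.width ≤ W) (hWf : n ^ f.width ≤ W) :
    ∃ s₁ s₂ : RamStore, (e.code k).Exec W inp s o e.cost s₁ o ∧
      (f.code (k + 1)).Exec W inp s₁ o f.cost s₂ o ∧ s₂.mem = s.mem ∧
      s₂.reg (tempReg k) = e.eval n inp σ ∧ s₂.reg (tempReg (k + 1)) = f.eval n inp σ ∧
      ∀ r, (∀ j ≥ k, r ≠ tempReg j) → s₂.reg r = s.reg r := by
  obtain ⟨s₁, x₁, m₁, v₁, r₁⟩ := he k s o hs hWe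
  obtain ⟨s₂, x₂, m₂, v₂, r₂⟩ := hf (k + 1) s₁ o
    (hs.of_agree m₁ fun r hr => r₁ r fun j _ => hr j) hWf
  refine ⟨s₁, s₂, x₁, x₂, m₂.trans m₁, ?_, v₂, fun r hr => ?_⟩
  · rw [r₂ _ fun j hj h => by unfold tempReg at h; omega, v₁]
  · rw [r₂ r fun j hj => hr j (by omega), r₁ r hr]

lemma RamStore.setReg_self (s : RamStore) (x c : ℕ) : (s.setReg x c).reg x = c := by
  simp [RamStore.setReg]

lemma RamStore.setReg_of_ne (s : RamStore) {x r : ℕ} (c : ℕ) (h : r ≠ x) :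
    (s.setReg x c).reg r = s.reg r := by
  simp [RamStore.setReg, h]

lemma LoopExpr.codeCorrect {σ : LoopState} (hn : 2 ≤ n) (hin : ∀ w ∈ inp, w ≤ n)
    (hσ : σ.Bounded n) (e : LoopExpr) : e.CodeCorrect n W inp σ := by
  have hlt : ∀ e : LoopExpr, n ^ e.width ≤ W → e.eval n inp σ < W :=
    fun e => (e.eval_lt hn hin hσ).trans_le
  have hmono : ∀ {i j : ℕ}, i ≤ j → n ^ j ≤ W → n ^ i ≤ W :=
    fun h => (Nat.pow_le_pow_right (by omega) h).trans
  induction e with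
  | lit c =>
    intro k s o hs hW
    exact ⟨_, .const _ _ _ _ (hlt _ hW), rfl, s.setReg_self _ _,
      fun r hr => s.setReg_of_ne _ (hr k le_rfl)⟩
  | size =>
    intro k s o hs hW
    refine ⟨s.setReg (tempReg k) n, ?_, rfl, s.setReg_self _ _,
      fun r hr => s.setReg_of_ne _ (hr k le_rfl)⟩
    have := RamProgram.Exec.add (W := W) (inp := inp) (tempReg k) 2 0 s o
      (by rw [hs.two, hs.zero]; exact hlt _ hW)
    rwa [hs.two, hs.zero] at this
  | var x =>
    intro k s o hs hW
    refine ⟨s.setReg (tempReg k) (σ.v x), ?_, rfl, s.setReg_self _ _,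
      fun r hr => s.setReg_of_ne _ (hr k le_rfl)⟩
    have := RamProgram.Exec.add (W := W) (inp := inp) (tempReg k) (varReg x) 0 s o
      (by rw [hs.v, hs.zero]; exact hlt _ hW)
    rwa [hs.v, hs.zero] at this
  | cell a x y =>
    intro k s o hs hW
    refine ⟨(s.setReg (tempReg k) (cellAddress n a (σ.v x) (σ.v y))).setReg (tempReg k)
      (σ.m a (σ.v x) (σ.v y)), ?_, rfl, RamStore.setReg_self _ _ _, fun r hr => by
        rw [RamStore.setReg_of_ne _ _ (hr k le_rfl), RamStore.setReg_of_ne _ _ (hr k le_rfl)]⟩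
    have := RamProgram.Exec.load (W := W) (inp := inp) (tempReg k) (tempReg k)
      (s.setReg (tempReg k) (cellAddress n a (σ.v x) (σ.v y))) o
    rw [RamStore.setReg_self] at this
    rw [← hs.m a _ _ (hσ.1 x) (hσ.1 y)]
    exact (exec_addressCode hn hW hs hσ).seq this
  | input e ih =>
    intro k s o hs hW
    obtain ⟨s₁, x₁, m₁, v₁, r₁⟩ := ih k s o hs (hmono (le_max_left _ _) hW)
    have := RamProgram.Exec.read (W := W) (inp := inp) (tempReg k) (tempReg k) s₁ o
      (by rw [v₁]; exact hlt _ hW)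
    refine ⟨_, x₁.seq this, m₁, ?_, fun r hr => by
      rw [RamStore.setReg_of_ne _ _ (hr k le_rfl), r₁ r hr]⟩
    rw [RamStore.setReg_self, v₁]; rfl
  | add e f ihe ihf =>
    intro k s o hs hW
    obtain ⟨s₁, s₂, x₁, x₂, m₂, ve, vf, r₂⟩ := ihe.pair ihf (k := k) o hs
      (hmono (by simp only [width]; omega) hW) (hmono (by simp only [width]; omega) hW)
    have := RamProgram.Exec.add (W := W) (inp := inp) (tempReg k) (tempReg k) (tempReg (k + 1)) s₂ o
      (by rw [ve, vf]; exact hlt _ hW)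
    refine ⟨_, (x₁.seq (x₂.seq this)), m₂, ?_, fun r hr => by
      rw [RamStore.setReg_of_ne _ _ (hr k le_rfl), r₂ r hr]⟩
    rw [RamStore.setReg_self, ve, vf]; rfl
  | sub e f ihe ihf =>
    intro k s o hs hW
    obtain ⟨s₁, s₂, x₁, x₂, m₂, ve, vf, r₂⟩ := ihe.pair ihf (k := k) o hs
      (hmono (by simp only [width]; omega) hW) (hmono (by simp only [width]; omega) hW)
    have := RamProgram.Exec.sub (W := W) (inp := inp) (tempReg k) (tempReg k) (tempReg (k + 1)) s₂ o
    refine ⟨_, (x₁.seq (x₂.seq this)), m₂, ?_, fun r hr => by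
      rw [RamStore.setReg_of_ne _ _ (hr k le_rfl), r₂ r hr]⟩
    rw [RamStore.setReg_self, ve, vf]; rfl
  | mul e f ihe ihf =>
    intro k s o hs hW
    obtain ⟨s₁, s₂, x₁, x₂, m₂, ve, vf, r₂⟩ := ihe.pair ihf (k := k) o hs
      (hmono (by simp only [width]; omega) hW) (hmono (by simp only [width]; omega) hW)
    have := RamProgram.Exec.mul (W := W) (inp := inp) (tempReg k) (tempReg k) (tempReg (k + 1)) s₂ o
      (by rw [ve, vf]; exact hlt _ hW)
    refine ⟨_, (x₁.seq (x₂.seq this)), m₂, ?_, fun r hr => by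
      rw [RamStore.setReg_of_ne _ _ (hr k le_rfl), r₂ r hr]⟩
    rw [RamStore.setReg_self, ve, vf]; rfl

lemma Represents.setV {s : RamStore} {σ : LoopState} (h : Represents n s σ) (x c : ℕ) :
    Represents n (s.setReg (varReg x) c) (σ.setV x c) := by
  have hne : ∀ r < 4, r ≠ varReg x := fun r hr => by unfold varReg; omega
  refine ⟨fun y => ?_, h.m, ?_, ?_, ?_, ?_⟩
  · by_cases hy : y = x
    · subst hy; simp [RamStore.setReg_self]
    · rw [RamStore.setReg_of_ne _ _ (by unfold varReg; omega), h.v]; simp [hy]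
  all_goals rw [RamStore.setReg_of_ne _ _ (hne _ (by norm_num))]
  exacts [h.zero, h.one, h.two, h.three]

/-- The code of a program simulates it, within the given time, and does not change the counters
of the enclosing loops. -/
lemma LoopProg.exec_code (hn : 2 ≤ n) (hin : ∀ w ∈ inp, w ≤ n) (p : LoopProg) (l : ℕ)
    {σ : LoopState} (hσ : σ.Bounded n) {s : RamStore} (hs : Represents n s σ)
    (hW : n ^ p.width ≤ W) :
    ∃ t s', t ≤ p.cost * n ^ p.depth ∧ (p.code l).Exec W inp s σ.o t s' (p.run n inp σ).o ∧
      Represents n s' (p.run n inp σ) ∧ ∀ j < l, s'.reg (counterReg j) = s.reg (counterReg j) := by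
  have hmono : ∀ {i j : ℕ}, i ≤ j → n ^ j ≤ W → n ^ i ≤ W :=
    fun h => (Nat.pow_le_pow_right (by omega) h).trans
  have hpow : ∀ {i j : ℕ}, i ≤ j → n ^ i ≤ n ^ j := fun h => Nat.pow_le_pow_right (by omega) h
  have hpow1 : ∀ j : ℕ, 1 ≤ n ^ j := fun j => Nat.one_le_pow _ _ (by omega)
  have htc : ∀ i j, counterReg i ≠ tempReg j := fun i j => by unfold counterReg tempReg; omega
  have htt : ∀ {i j}, i ≠ j → tempReg i ≠ tempReg j := fun h => by unfold tempReg; omega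
  have hst : ∀ {r}, r < 4 → ∀ j, r ≠ tempReg j := fun h j => by unfold tempReg; omega
  have hsc : ∀ {r}, r < 4 → ∀ j, r ≠ counterReg j := fun h j => by unfold counterReg; omega
  have hvt : ∀ x j, varReg x ≠ tempReg j := fun i j => by unfold varReg tempReg; omega
  have hvc : ∀ x j, varReg x ≠ counterReg j := fun i j => by unfold varReg counterReg; omega
  induction p generalizing σ s l with
  | skip => exact ⟨1, s, by simp [cost, depth], .skip _ _, hs, fun _ _ => rfl⟩
  | set x e =>
    obtain ⟨s₁, x₁, m₁, v₁, r₁⟩ := LoopExpr.codeCorrect hn hin hσ e 0 s σ.o hs hW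
    have h₁ : Represents n s₁ σ := hs.of_agree m₁ fun r hr => r₁ r fun j _ => hr j
    have x₂ := RamProgram.Exec.sub (W := W) (inp := inp) (tempReg 1) (tempReg 0) 2 s₁ σ.o
    set s₂ := s₁.setReg (tempReg 1) (s₁.reg (tempReg 0) - s₁.reg 2) with hs₂
    have h₂ : Represents n s₂ σ := h₁.of_agree rfl fun r hr => RamStore.setReg_of_ne _ _ (hr 1)
    have x₃ := RamProgram.Exec.sub (W := W) (inp := inp) (varReg x) (tempReg 0) (tempReg 1) s₂ σ.o
    have e0 : s₂.reg (tempReg 0) - s₂.reg (tempReg 1) = min (e.eval n inp σ) n := by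
      rw [hs₂, RamStore.setReg_self, RamStore.setReg_of_ne _ _ (htt (by norm_num)), v₁, h₁.two]
      omega
    rw [e0] at x₃
    refine ⟨_, _, ?_, x₁.seq (x₂.seq x₃), h₂.setV _ _, fun j _ => ?_⟩
    · simp [cost, depth]
    · rw [RamStore.setReg_of_ne _ _ (hvc x j).symm, hs₂, RamStore.setReg_of_ne _ _ (htc j 1),
        r₁ _ fun i _ => htc j i]
  | put a x y e =>
    obtain ⟨s₁, x₁, m₁, v₁, r₁⟩ := LoopExpr.codeCorrect hn hin hσ e 0 s σ.o hs
      (hmono (le_max_left _ _) hW)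
    have h₁ : Represents n s₁ σ := hs.of_agree m₁ fun r hr => r₁ r fun j _ => hr j
    have x₂ := RamProgram.Exec.sub (W := W) (inp := inp) (tempReg 1) (tempReg 0) 2 s₁ σ.o
    set s₂ := s₁.setReg (tempReg 1) (s₁.reg (tempReg 0) - s₁.reg 2) with hs₂
    have h₂ : Represents n s₂ σ := h₁.of_agree rfl fun r hr => RamStore.setReg_of_ne _ _ (hr 1)
    have x₃ := RamProgram.Exec.sub (W := W) (inp := inp) (tempReg 0) (tempReg 0) (tempReg 1) s₂ σ.o
    have e0 : s₂.reg (tempReg 0) - s₂.reg (tempReg 1) = min (e.eval n inp σ) n := by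
      rw [hs₂, RamStore.setReg_self, RamStore.setReg_of_ne _ _ (htt (by norm_num)), v₁, h₁.two]
      omega
    rw [e0] at x₃
    set c := min (e.eval n inp σ) n with hc
    set s₃ := s₂.setReg (tempReg 0) c with hs₃
    have h₃ : Represents n s₃ σ := h₂.of_agree rfl fun r hr => RamStore.setReg_of_ne _ _ (hr 0)
    have x₄ := exec_addressCode (inp := inp) (x := x) (y := y) (k := 1) (o := σ.o) hn
      (hmono (le_max_right e.width (a + 6)) hW) h₃ hσ
    set s₄ := s₃.setReg (tempReg 1) (cellAddress n a (σ.v x) (σ.v y)) with hs₄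
    have h₄ : Represents n s₄ σ := h₃.of_agree rfl fun r hr => RamStore.setReg_of_ne _ _ (hr 1)
    have x₅ := RamProgram.Exec.store (W := W) (inp := inp) (tempReg 1) (tempReg 0) s₄ σ.o
    rw [hs₄, RamStore.setReg_self, RamStore.setReg_of_ne _ _ (htt (by norm_num)), ← hs₄,
      hs₃, RamStore.setReg_self] at x₅
    refine ⟨_, _, ?_, x₁.seq (x₂.seq (x₃.seq (x₄.seq x₅))), ⟨h₄.v, ?_, h₄.zero, h₄.one, h₄.two,
      h₄.three⟩, fun j _ => ?_⟩
    · simp [cost, depth]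
    · intro a' i j hi hj
      change Function.update s₄.mem _ _ _ = _
      rw [Function.update_apply]
      simp only [run, LoopState.setM_m]
      by_cases hcase : a' = a ∧ i = σ.v x ∧ j = σ.v y
      · obtain ⟨rfl, rfl, rfl⟩ := hcase
        simp [hc]
      · rw [if_neg hcase, if_neg fun h => hcase (cellAddress_inj hi hj (hσ.1 x) (hσ.1 y) h)]
        exact h₄.m _ _ _ hi hj
    · change s₄.reg _ = _
      rw [hs₄, RamStore.setReg_of_ne _ _ (htc j 1), hs₃, RamStore.setReg_of_ne _ _ (htc j 0), hs₂,
        RamStore.setReg_of_ne _ _ (htc j 1), r₁ _ fun i _ => htc j i]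
  | out e =>
    obtain ⟨s₁, x₁, m₁, v₁, r₁⟩ := LoopExpr.codeCorrect hn hin hσ e 0 s σ.o hs hW
    have h₁ : Represents n s₁ σ := hs.of_agree m₁ fun r hr => r₁ r fun j _ => hr j
    have x₂ := RamProgram.Exec.write (W := W) (inp := inp) (tempReg 0) s₁ σ.o
    rw [v₁] at x₂
    exact ⟨_, _, by simp [cost, depth], x₁.seq x₂,
      ⟨h₁.v, h₁.m, h₁.zero, h₁.one, h₁.two, h₁.three⟩, fun j _ => r₁ _ fun i _ => htc j i⟩
  | ite e p q ihp ihq =>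
    obtain ⟨s₁, x₁, m₁, v₁, r₁⟩ := LoopExpr.codeCorrect hn hin hσ e 0 s σ.o hs
      (hmono (le_max_left _ _) hW)
    have h₁ : Represents n s₁ σ := hs.of_agree m₁ fun r hr => r₁ r fun j _ => hr j
    have hd := hpow1 (max p.depth q.depth)
    by_cases hpos : 0 < e.eval n inp σ
    · obtain ⟨t, s₂, ht, x₂, h₂, c₂⟩ := ihp l hσ h₁
        (hmono (by simp only [width]; omega) hW)
      have x₃ := RamProgram.Exec.ifTrue (x := 0) (y := tempReg 0) (q := q.code l)
        (by rw [h₁.zero, v₁]; exact hpos) x₂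
      refine ⟨e.cost + (t + 1), s₂, ?_, x₁.seq ?_, ?_,
        fun j hj => by rw [c₂ j hj, r₁ _ fun i _ => htc j i]⟩
      · have := hpow (le_max_left p.depth q.depth)
        simp only [cost, depth]
        nlinarith [Nat.mul_le_mul_left p.cost this]
      · simpa only [run, if_pos hpos] using x₃
      · simpa only [run, if_pos hpos] using h₂
    · obtain ⟨t, s₂, ht, x₂, h₂, c₂⟩ := ihq l hσ h₁
        (hmono (by simp only [width]; omega) hW)
      have x₃ := RamProgram.Exec.ifFalse (x := 0) (y := tempReg 0) (p := p.code l)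
        (by rw [h₁.zero, v₁]; exact hpos) x₂
      refine ⟨e.cost + (t + 1), s₂, ?_, x₁.seq ?_, ?_,
        fun j hj => by rw [c₂ j hj, r₁ _ fun i _ => htc j i]⟩
      · have := hpow (le_max_right p.depth q.depth)
        simp only [cost, depth]
        nlinarith [Nat.mul_le_mul_left q.cost this]
      · simpa only [run, if_neg hpos] using x₃
      · simpa only [run, if_neg hpos] using h₂
  | seq p q ihp ihq =>
    obtain ⟨t₁, s₁, ht₁, x₁, h₁, c₁⟩ := ihp l hσ hs (hmono (le_max_left _ _) hW)
    obtain ⟨t₂, s₂, ht₂, x₂, h₂, c₂⟩ := ihq l (bounded_run hσ) h₁ (hmono (le_max_right _ _) hW)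
    refine ⟨_, s₂, ?_, x₁.seq x₂, h₂, fun j hj => by rw [c₂ j hj, c₁ j hj]⟩
    have h3 := hpow (le_max_left p.depth q.depth)
    have h4 := hpow (le_max_right p.depth q.depth)
    simp only [cost, depth]
    nlinarith [Nat.mul_le_mul_left p.cost h3, Nat.mul_le_mul_left q.cost h4]
  | loop x p ih =>
    have hn2 : n ^ 2 ≤ W := hmono (le_max_right _ _) hW
    have hnW : n + 1 < W := by nlinarith
    have h0W : 0 < W := by omega
    -- the loop from the `k`-th iteration on, by induction on the number of iterations that are left
    have main : ∀ m k, k + m = n → ∀ s, Represents n s (LoopState.iter (p.run n inp) x k σ) →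
        s.reg (counterReg l) = k →
        ∃ t s', t ≤ m * (p.cost * n ^ p.depth + 3) + 1 ∧
          (RamProgram.whileLt (counterReg l) 2 <| (RamProgram.add (varReg x) (counterReg l) 0).seq <|
            (p.code (l + 1)).seq <| RamProgram.add (counterReg l) (counterReg l) 1).Exec W inp s
              (LoopState.iter (p.run n inp) x k σ).o t s' ((loop x p).run n inp σ).o ∧
          Represents n s' ((loop x p).run n inp σ) ∧
          ∀ j < l, s'.reg (counterReg j) = s.reg (counterReg j) := by
      intro m
      induction m with
      | zero =>
        intro k hk s hs hc
        obtain rfl : k = n := by omega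
        exact ⟨1, s, by omega, .whileFalse (by rw [hc, hs.two]; omega), hs, fun _ _ => rfl⟩
      | succ m ihm =>
        intro k hk s hs hc
        set τ := LoopState.iter (p.run n inp) x k σ with hτ
        have hτb : τ.Bounded n := by
          have : ∀ i ≤ n, (LoopState.iter (p.run n inp) x i σ).Bounded n := by
            intro i
            induction i with
            | zero => intro _; exact hσ
            | succ i ihi =>
              intro hi
              exact bounded_run ((ihi (by omega)).setV _ (by omega))
          exact this k (by omega)
        have x₁ := RamProgram.Exec.add (W := W) (inp := inp) (varReg x) (counterReg l) 0 s τ.o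
          (by rw [hc, hs.zero]; omega)
        rw [hc, hs.zero, add_zero] at x₁
        obtain ⟨t₂, s₂, ht₂, x₂, h₂, c₂⟩ := ih (l + 1) (hτb.setV x (by omega : k ≤ n))
          (hs.setV x k) (hmono (le_max_left _ _) hW)
        have hc₂ : s₂.reg (counterReg l) = k := by
          rw [c₂ l (by omega), RamStore.setReg_of_ne _ _ (hvc x l).symm, hc]
        have x₃ := RamProgram.Exec.add (W := W) (inp := inp) (counterReg l) (counterReg l) 1 s₂
          (p.run n inp (τ.setV x k)).o (by rw [hc₂, h₂.one]; omega)
        rw [hc₂, h₂.one] at x₃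
        have h₃ : Represents n (s₂.setReg (counterReg l) (k + 1)) (p.run n inp (τ.setV x k)) :=
          ⟨fun y => by rw [RamStore.setReg_of_ne _ _ (hvc y l), h₂.v], h₂.m,
            by rw [RamStore.setReg_of_ne _ _ (hsc (by norm_num) l), h₂.zero],
            by rw [RamStore.setReg_of_ne _ _ (hsc (by norm_num) l), h₂.one],
            by rw [RamStore.setReg_of_ne _ _ (hsc (by norm_num) l), h₂.two],
            by rw [RamStore.setReg_of_ne _ _ (hsc (by norm_num) l), h₂.three]⟩
        obtain ⟨t₄, s₄, ht₄, x₄, h₄, c₄⟩ := ihm (k + 1) (by omega) _ h₃ (RamStore.setReg_self _ _ _)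
        refine ⟨_, s₄, ?_, .whileTrue (by rw [hc, hs.two]; omega) (x₁.seq (x₂.seq x₃)) x₄, h₄, ?_⟩
        · ring_nf at ht₂ ht₄ ⊢
          omega
        · intro j hj
          rw [c₄ j hj, RamStore.setReg_of_ne _ _ (by unfold counterReg; omega), c₂ j (by omega),
            RamStore.setReg_of_ne _ _ (hvc x j).symm]
    have x₁ := RamProgram.Exec.const (W := W) (inp := inp) (counterReg l) 0 s σ.o h0W
    have h₁ : Represents n (s.setReg (counterReg l) 0) σ :=
      ⟨fun y => by rw [RamStore.setReg_of_ne _ _ (hvc y l), hs.v], hs.m,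
        by rw [RamStore.setReg_of_ne _ _ (hsc (by norm_num) l), hs.zero],
        by rw [RamStore.setReg_of_ne _ _ (hsc (by norm_num) l), hs.one],
        by rw [RamStore.setReg_of_ne _ _ (hsc (by norm_num) l), hs.two],
        by rw [RamStore.setReg_of_ne _ _ (hsc (by norm_num) l), hs.three]⟩
    obtain ⟨t₂, s₂, ht₂, x₂, h₂, c₂⟩ := main n 0 (by omega) _ h₁ (RamStore.setReg_self _ _ _)
    refine ⟨_, s₂, ?_, x₁.seq x₂, h₂, fun j hj => ?_⟩
    · have h3 := hpow1 p.depth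
      simp only [cost, depth, pow_succ]
      nlinarith [Nat.mul_le_mul_left n h3]
    · rw [c₂ j hj, RamStore.setReg_of_ne _ _ (by unfold counterReg; omega)]

end Simulation

open RamProgram in
/-- The RAM program that sets up the constant registers and then runs the code of `p`. -/
def LoopProg.compile (p : LoopProg) : RamProgram :=
  (const 0 0).seq <| (const 1 1).seq <| (read 2 0).seq <| (add 3 2 1).seq <| p.code 0

/-- `Represents` without the condition on the constant registers, which do not hold their values
before the first request. -/
structure WeaklyRepresents (n : ℕ) (s : RamStore) (σ : LoopState) : Prop where
  v : ∀ x, s.reg (varReg x) = σ.v x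
  m : ∀ a i j, i ≤ n → j ≤ n → s.mem (cellAddress n a i j) = σ.m a i j

/-- A compiled program simulates the loop program; the four additional steps set up the constant
registers. -/
lemma LoopProg.exec_compile {n : ℕ} {inp : List ℕ} (hn : 2 ≤ n) (hin : ∀ w ∈ inp, w ≤ n)
    (h0 : inp.getD 0 0 = n) (p : LoopProg) {σ : LoopState} (hσ : σ.Bounded n) {s : RamStore}
    (hs : WeaklyRepresents n s σ) {K : ℕ} (hK : p.width ≤ K) (hK2 : 2 ≤ K) :
    ∃ t s', t ≤ p.cost * n ^ p.depth + 4 ∧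
      p.compile.Exec (n ^ K) inp s σ.o t s' (p.run n inp σ).o ∧
      WeaklyRepresents n s' (p.run n inp σ) := by
  have hn2 : n ^ 2 ≤ n ^ K := Nat.pow_le_pow_right (by omega) hK2
  have hnW : n + 1 < n ^ K := by nlinarith
  have x₁ := RamProgram.Exec.const (W := n ^ K) (inp := inp) 0 0 s σ.o (by omega)
  set s₁ := s.setReg 0 0 with hs₁
  have x₂ := RamProgram.Exec.const (W := n ^ K) (inp := inp) 1 1 s₁ σ.o (by omega)
  set s₂ := s₁.setReg 1 1 with hs₂
  have e0 : s₂.reg 0 = 0 := by simp [hs₂, hs₁, RamStore.setReg]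
  have x₃ := RamProgram.Exec.read (W := n ^ K) (inp := inp) 2 0 s₂ σ.o (by rw [e0, h0]; omega)
  rw [e0, h0] at x₃
  set s₃ := s₂.setReg 2 n with hs₃
  have e1 : s₃.reg 2 + s₃.reg 1 = n + 1 := by simp [hs₃, hs₂, RamStore.setReg]
  have x₄ := RamProgram.Exec.add (W := n ^ K) (inp := inp) 3 2 1 s₃ σ.o (by omega)
  rw [e1] at x₄
  set s₄ := s₃.setReg 3 (n + 1) with hs₄
  have h₄ : Represents n s₄ σ := by
    refine ⟨fun x => ?_, hs.m, ?_, ?_, ?_, ?_⟩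
    · rw [hs₄, RamStore.setReg_of_ne _ _ (by unfold varReg; omega), hs₃,
        RamStore.setReg_of_ne _ _ (by unfold varReg; omega), hs₂,
        RamStore.setReg_of_ne _ _ (by unfold varReg; omega), hs₁,
        RamStore.setReg_of_ne _ _ (by unfold varReg; omega), hs.v]
    all_goals simp [hs₄, hs₃, hs₂, hs₁, RamStore.setReg]
  obtain ⟨t, s₅, ht, x₅, h₅, -⟩ := p.exec_code hn hin 0 hσ h₄
    (Nat.pow_le_pow_right (by omega) hK)
  exact ⟨_, s₅, by omega, x₁.seq (x₂.seq (x₃.seq (x₄.seq x₅))), h₅.v, h₅.m⟩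

/-! ### The expander mixing lemma -/

section Mixing

open Matrix

variable {n d : ℕ} {lam : ℝ} {G : SimpleGraph (Fin n)} [DecidableRel G.Adj]

/-- An orthonormal basis of eigenvectors as plain vectors: Parseval's identity, the eigenvalue
equations, and the bound on all eigenvalues but one. -/
lemma IsNDLambdaGraph.exists_eigenbasis (h : IsNDLambdaGraph n d lam G) (hn : 0 < n) :
    ∃ (u : Fin n → Fin n → ℝ) (μ : Fin n → ℝ) (i₀ : Fin n),
      (∀ x y : Fin n → ℝ, ∑ i, (x ⬝ᵥ u i) * (u i ⬝ᵥ y) = x ⬝ᵥ y) ∧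
      (∀ i, G.adjMatrix ℝ *ᵥ u i = μ i • u i) ∧ ∀ i, i ≠ i₀ → |μ i| ≤ lam := by
  obtain ⟨-, hA, hlam⟩ := h
  let e : Fin n ≃ Fin (Fintype.card (Fin n)) :=
    (Fintype.equivOfCardEq (Fintype.card_fin _) : Fin (Fintype.card (Fin n)) ≃ Fin n).symm
  refine ⟨fun i => (hA.eigenvectorBasis i).ofLp, hA.eigenvalues, e.symm ⟨0, by simpa using hn⟩,
    fun x y => ?_, fun i => hA.mulVec_eigenvectorBasis i, fun i hi => ?_⟩
  · have := hA.eigenvectorBasis.sum_inner_mul_inner (WithLp.toLp 2 x) (WithLp.toLp 2 y)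
    simp only [EuclideanSpace.inner_eq_star_dotProduct, star_trivial] at this
    rw [dotProduct_comm x y, ← this]
    exact Finset.sum_congr rfl fun i _ => by rw [dotProduct_comm x, dotProduct_comm _ y]
  · refine hlam _ (Nat.pos_of_ne_zero fun h0 => hi ?_)
    rw [Equiv.eq_symm_apply]
    exact Fin.ext h0

/-- The number of pairs in `X × Y` that are joined by an edge. -/
def edgeCount (G : SimpleGraph (Fin n)) [DecidableRel G.Adj] (X Y : Finset (Fin n)) : ℕ :=
  ∑ x ∈ X, (Y.filter (G.Adj x)).card

/-- The upper bound of the expander mixing lemma. -/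
def MixingBound (d : ℕ) (lam : ℝ) (G : SimpleGraph (Fin n)) [DecidableRel G.Adj] : Prop :=
  ∀ X Y : Finset (Fin n), (edgeCount G X Y : ℝ) ≤
    d * X.card * Y.card / n + lam * (√X.card * √Y.card)

lemma IsNDLambdaGraph.mixingBound (h : IsNDLambdaGraph n d lam G) (hn : 1 < n) (hlam : lam < d) :
    MixingBound d lam G := by
  obtain ⟨u, μ, i₀, hpar, heig, hμ⟩ := h.exists_eigenbasis (by omega)
  set A := G.adjMatrix ℝ with hA
  have hsymm : ∀ i (x : Fin n → ℝ), u i ⬝ᵥ (A *ᵥ x) = μ i * (u i ⬝ᵥ x) := by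
    intro i x
    rw [dotProduct_mulVec, ← mulVec_transpose, hA, SimpleGraph.transpose_adjMatrix, heig,
      smul_dotProduct, smul_eq_mul]
  let one : Fin n → ℝ := fun _ => 1
  have hone : A *ᵥ one = (d : ℝ) • one := by
    funext v
    have := G.adjMatrix_mulVec_const_apply_of_regular (α := ℝ) (a := 1) h.1 (v := v)
    rw [Pi.smul_apply, smul_eq_mul]
    exact this
  have horth : ∀ i, i ≠ i₀ → u i ⬝ᵥ one = 0 := by
    intro i hi
    have h1 := hsymm i one
    rw [hone, dotProduct_smul, smul_eq_mul] at h1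
    have h2 : μ i ≠ d := fun h3 => by
      have := hμ i hi
      rw [h3] at this
      exact absurd ((le_abs_self _).trans this) (not_le.mpr hlam)
    have h3 : (d - μ i) * (u i ⬝ᵥ one) = 0 := by linarith
    rcases mul_eq_zero.mp h3 with h4 | h4
    · exact absurd (by linarith) h2
    · exact h4
  have hfirst : ∀ x : Fin n → ℝ, (x ⬝ᵥ u i₀) * (u i₀ ⬝ᵥ one) = x ⬝ᵥ one := by
    intro x
    rw [← hpar x one, Finset.sum_eq_single i₀ (fun i _ hi => by rw [horth i hi, mul_zero])
      (fun h => absurd (Finset.mem_univ _) h)]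
  have hc : (u i₀ ⬝ᵥ one) ^ 2 = n := by
    have := hfirst one
    rw [dotProduct_comm one (u i₀)] at this
    rw [sq, this]
    simp [one, dotProduct]
  have hnpos : (0 : ℝ) < n := by exact_mod_cast (by omega : 0 < n)
  have hμ₀ : μ i₀ = d := by
    have h1 := hsymm i₀ one
    rw [hone, dotProduct_smul, smul_eq_mul] at h1
    have h2 : u i₀ ⬝ᵥ one ≠ 0 := fun h0 => by rw [h0] at hc; norm_num at hc; linarith
    exact (mul_right_cancel₀ h2 h1).symm
  intro X Y
  let f : Finset (Fin n) → Fin n → ℝ := fun X v => if v ∈ X then 1 else 0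
  have hf1 : ∀ X, f X ⬝ᵥ one = X.card := fun X => by simp [f, one, dotProduct]
  have hf2 : ∀ X, f X ⬝ᵥ f X = X.card := fun X => by simp [f, dotProduct]
  have hE : (edgeCount G X Y : ℝ) = f X ⬝ᵥ (A *ᵥ f Y) := by
    simp only [edgeCount, hA, dotProduct, SimpleGraph.adjMatrix_mulVec_apply, f, Nat.cast_sum]
    simp only [ite_mul, one_mul, zero_mul, Finset.sum_ite_mem, Finset.univ_inter,
      Finset.sum_const, nsmul_eq_mul, mul_one]
    refine Finset.sum_congr rfl fun x _ => ?_
    congr 2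
    ext y
    simp [and_comm]
  -- The main term comes from the constant eigenvector, the error term from all others.
  rw [hE, ← hpar, ← Finset.add_sum_erase _ _ (Finset.mem_univ i₀)]
  refine add_le_add (le_of_eq ?_) ?_
  · rw [hsymm, hμ₀]
    have h1 := hfirst (f X)
    have h2 := hfirst (f Y)
    rw [hf1] at h1 h2
    rw [dotProduct_comm (u i₀) (f Y), ← h1, ← h2, eq_div_iff hnpos.ne', ← hc]
    ring
  · have habs : ∀ i ∈ Finset.univ.erase i₀, (f X ⬝ᵥ u i) * (u i ⬝ᵥ A *ᵥ f Y) ≤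
        lam * (|f X ⬝ᵥ u i| * |u i ⬝ᵥ f Y|) := by
      intro i hi
      rw [hsymm]
      refine (le_abs_self _).trans ?_
      rw [abs_mul, abs_mul]
      nlinarith [hμ i (Finset.ne_of_mem_erase hi),
        mul_nonneg (abs_nonneg (f X ⬝ᵥ u i)) (abs_nonneg (u i ⬝ᵥ f Y))]
    refine (Finset.sum_le_sum habs).trans ?_
    rw [← Finset.mul_sum]
    have hlam0 : 0 ≤ lam := by
      have : Nontrivial (Fin n) := Fin.nontrivial_iff_two_le.mpr hn
      obtain ⟨i, hi⟩ := exists_ne i₀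
      exact (abs_nonneg _).trans (hμ i hi)
    refine mul_le_mul_of_nonneg_left ?_ hlam0
    have hnorm : ∀ X, ∑ i, |f X ⬝ᵥ u i| ^ 2 = X.card := by
      intro X
      rw [← hf2, ← hpar]
      exact Finset.sum_congr rfl fun i _ => by rw [sq_abs, sq, dotProduct_comm (u i)]
    calc ∑ i ∈ Finset.univ.erase i₀, |f X ⬝ᵥ u i| * |u i ⬝ᵥ f Y|
        ≤ ∑ i, |f X ⬝ᵥ u i| * |f Y ⬝ᵥ u i| := by
          simp only [dotProduct_comm _ (f Y)]
          exact Finset.sum_le_univ_sum_of_nonneg fun i => by positivity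
      _ ≤ √(∑ i, |f X ⬝ᵥ u i| ^ 2) * √(∑ i, |f Y ⬝ᵥ u i| ^ 2) :=
          Real.sum_mul_le_sqrt_mul_sqrt _ _ _
      _ = √X.card * √Y.card := by rw [hnorm, hnorm]

end Mixing

/-! ### Small sets and balls in an expander -/

section Expansion

variable {n d : ℕ} {lam : ℝ} {G : SimpleGraph (Fin n)} [DecidableRel G.Adj]

/-- The number of neighbours of `v` in `X`. -/
def degIn (G : SimpleGraph (Fin n)) [DecidableRel G.Adj] (X : Finset (Fin n)) (v : Fin n) : ℕ :=
  (X.filter (G.Adj v)).card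

lemma degIn_mono {X Y : Finset (Fin n)} (h : X ⊆ Y) (v : Fin n) : degIn G X v ≤ degIn G Y v :=
  Finset.card_le_card (Finset.filter_subset_filter _ h)

lemma MixingBound.mul_card_le (hmix : MixingBound d lam G) {c : ℝ} {X Y : Finset (Fin n)}
    (h : ∀ v ∈ X, c ≤ degIn G Y v) :
    c * X.card ≤ d * X.card * Y.card / n + lam * (√X.card * √Y.card) := by
  refine le_trans ?_ (hmix X Y)
  rw [edgeCount, Nat.cast_sum, mul_comm, ← nsmul_eq_mul]
  exact Finset.card_nsmul_le_sum _ _ _ h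

/-- The eigenvalue bound cannot be very small. -/
lemma MixingBound.le_sq_mul (hmix : MixingBound d lam G) (hn : 0 < n) (hd : 0 < d)
    (hreg : G.IsRegularOfDegree d) : 0 < lam ∧ (d : ℝ) ≤ n ^ 2 * lam := by
  have hn' : (1 : ℝ) ≤ n := by exact_mod_cast hn
  have hd' : (0 : ℝ) < d := by exact_mod_cast hd
  let v : Fin n := ⟨0, hn⟩
  have hdeg : degIn G (Finset.univ.erase v) v = d := by
    rw [← hreg v, ← SimpleGraph.card_neighborFinset_eq_degree, degIn]
    congr 1
    ext w
    simp only [Finset.mem_filter, Finset.mem_erase, Finset.mem_univ, and_true,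
      SimpleGraph.mem_neighborFinset]
    exact ⟨fun h => h.2, fun h => ⟨h.ne', h⟩⟩
  have h := hmix.mul_card_le (c := d) (X := {v}) (Y := Finset.univ.erase v) fun w hw => by
    rw [Finset.mem_singleton.mp hw, hdeg]
  rw [Finset.card_erase_of_mem (Finset.mem_univ v), Finset.card_singleton, Finset.card_univ,
    Fintype.card_fin, Nat.cast_sub hn] at h
  simp only [Nat.cast_one, mul_one, Real.sqrt_one, one_mul] at h
  have h1 : (d : ℝ) ≤ n * (lam * √(n - 1)) := by
    have h2 : (d : ℝ) * (n - 1) / n * n = d * (n - 1) := div_mul_cancel₀ _ (by linarith)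
    nlinarith
  have hs : √((n : ℝ) - 1) ≤ n := by
    rw [Real.sqrt_le_left (by linarith)]
    nlinarith
  have hs0 := Real.sqrt_nonneg ((n : ℝ) - 1)
  have hlam : 0 < lam := by
    by_contra! hcon
    have : lam * √((n : ℝ) - 1) ≤ 0 := mul_nonpos_of_nonpos_of_nonneg hcon hs0
    nlinarith
  refine ⟨hlam, h1.trans ?_⟩
  rw [sq, mul_assoc, mul_comm (n : ℝ) lam]
  exact mul_le_mul_of_nonneg_left (mul_le_mul_of_nonneg_left hs hlam.le) (by linarith)

/-- A nonempty small set has a vertex with few neighbours in it. -/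
lemma MixingBound.exists_degIn_le (hmix : MixingBound d lam G) (hd : 0 < d)
    (hlam : 200 * lam ≤ d) {X : Finset (Fin n)} (hne : X.Nonempty) (hX : 200 * X.card ≤ n) :
    ∃ v ∈ X, 50 * degIn G X v ≤ d := by
  by_contra! hcon
  have hx : (0 : ℝ) < X.card := by exact_mod_cast hne.card_pos
  have hd' : (0 : ℝ) < d := by exact_mod_cast hd
  have hX' : 200 * (X.card : ℝ) ≤ n := by exact_mod_cast hX
  have h := hmix.mul_card_le (c := d / 50) (X := X) (Y := X) fun v hv => by
    have : (d : ℝ) < 50 * degIn G X v := by exact_mod_cast hcon v hv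
    linarith
  rw [Real.mul_self_sqrt hx.le] at h
  have h1 : (d : ℝ) * X.card * X.card / n ≤ d * X.card / 200 := by
    rw [div_le_div_iff₀ (by linarith) (by norm_num)]
    nlinarith [mul_pos hd' hx]
  nlinarith [mul_pos hd' hx]

/-- `B` contains every vertex that has more than `d / 50` neighbours in `B`. -/
def IsJamClosed (d : ℕ) (G : SimpleGraph (Fin n)) [DecidableRel G.Adj] (B : Finset (Fin n)) :
    Prop :=
  ∀ v, d < 50 * degIn G B v → v ∈ B

open Classical in
/-- The least set that contains `S` and every vertex with more than `d / 50` neighbours in it. -/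
noncomputable def jamClosure (d : ℕ) (G : SimpleGraph (Fin n)) [DecidableRel G.Adj]
    (S : Finset (Fin n)) : Finset (Fin n) :=
  Finset.univ.filter fun v => ∀ B, S ⊆ B → IsJamClosed d G B → v ∈ B

lemma subset_jamClosure (S : Finset (Fin n)) : S ⊆ jamClosure d G S := fun v hv => by
  simp only [jamClosure, Finset.mem_filter_univ]
  exact fun B hB _ => hB hv

lemma jamClosure_subset {S B : Finset (Fin n)} (h : S ⊆ B) (hB : IsJamClosed d G B) :
    jamClosure d G S ⊆ B := fun v hv => by
  simp only [jamClosure, Finset.mem_filter_univ] at hv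
  exact hv B h hB

lemma isJamClosed_jamClosure (S : Finset (Fin n)) : IsJamClosed d G (jamClosure d G S) := by
  intro v hv
  simp only [jamClosure, Finset.mem_filter_univ]
  intro B hB hcl
  exact hcl v (hv.trans_le (Nat.mul_le_mul_left 50 (degIn_mono (jamClosure_subset hB hcl) v)))

lemma jamClosure_mono {S S' : Finset (Fin n)} (h : S ⊆ S') :
    jamClosure d G S ⊆ jamClosure d G S' :=
  jamClosure_subset (h.trans (subset_jamClosure S')) (isJamClosed_jamClosure S')

/-- A small set `B` is at most twice as large as a part `S` of it, if all other vertices of `B` have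
many neighbours in `B`. -/
lemma MixingBound.card_le_two_mul (hmix : MixingBound d lam G) (hd : 0 < d)
    (hlam : 200 * lam ≤ d) {S B : Finset (Fin n)} (hSB : S ⊆ B)
    (hB : ∀ v ∈ B, v ∉ S → d < 50 * degIn G B v) (hcard : 100 * B.card ≤ n) :
    B.card ≤ 2 * S.card := by
  have hsum := Finset.card_sdiff_add_card_eq_card hSB
  rcases Nat.eq_zero_or_pos (B \ S).card with h0 | hpos
  · omega
  have hx : (0 : ℝ) < (B \ S).card := by exact_mod_cast hpos
  have hd' : (0 : ℝ) < d := by exact_mod_cast hd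
  have hX' : 100 * (B.card : ℝ) ≤ n := by exact_mod_cast hcard
  have hb : ((B \ S).card : ℝ) ≤ B.card := by exact_mod_cast (by omega : (B \ S).card ≤ B.card)
  have h := hmix.mul_card_le (c := d / 50) (X := B \ S) (Y := B) fun v hv => by
    rw [Finset.mem_sdiff] at hv
    have : (d : ℝ) < 50 * degIn G B v := by exact_mod_cast hB v hv.1 hv.2
    linarith
  set x : ℝ := ((B \ S).card : ℝ)
  set b : ℝ := (B.card : ℝ)
  have h1 : (d : ℝ) * x * b / n ≤ d * x / 100 := by
    rw [div_le_div_iff₀ (by linarith) (by norm_num)]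
    nlinarith [mul_pos hd' hx]
  have hsx := Real.sqrt_pos.mpr hx
  have hsb : 0 ≤ √b := Real.sqrt_nonneg b
  have h2 : lam * (√x * √b) ≤ d / 200 * (√x * √b) :=
    mul_le_mul_of_nonneg_right (by linarith) (by positivity)
  have hxx : √x * √x = x := Real.mul_self_sqrt hx.le
  have hbb : √b * √b = b := Real.mul_self_sqrt (hx.le.trans hb)
  -- The vertices outside `S` have more than `d / 50` neighbours in `B`, but the density of `G`
  -- accounts for `d / 100` only.
  have h3 : 2 * √x ≤ √b := by
    have h4 : (d * √x) * (2 * √x) ≤ (d * √x) * √b := by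
      nlinarith
    exact le_of_mul_le_mul_left h4 (by positivity)
  have h5 : 4 * x ≤ b := by nlinarith
  have h6 : (4 : ℝ) * ((B \ S).card : ℝ) ≤ (B.card : ℝ) := h5
  have h7 : 4 * (B \ S).card ≤ B.card := by exact_mod_cast h6
  omega

/-- The closure of a small set is small: a maximal set that arises from `S` by adding vertices and
is small is at most twice as large as `S`, so that nothing can be added to it. -/
lemma MixingBound.card_jamClosure (hmix : MixingBound d lam G) (hd : 0 < d)
    (hlam : 200 * lam ≤ d) (hn : 200 ≤ n) {S : Finset (Fin n)} (hS : 400 * S.card ≤ n) :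
    200 * (jamClosure d G S).card ≤ n := by
  classical
  let P : Finset (Finset (Fin n)) := Finset.univ.filter fun B =>
    S ⊆ B ∧ (∀ v ∈ B, v ∉ S → d < 50 * degIn G B v) ∧ 100 * B.card ≤ n
  have hSP : S ∈ P := by
    simp only [P, Finset.mem_filter_univ]
    exact ⟨subset_rfl, fun v hv hv' => absurd hv hv', by omega⟩
  obtain ⟨B, hBP, hmax⟩ := P.exists_max_image Finset.card ⟨S, hSP⟩
  have hB := hBP
  simp only [P, Finset.mem_filter_univ] at hB
  obtain ⟨hSB, hsup, hc⟩ := hB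
  have hcard := hmix.card_le_two_mul hd hlam hSB hsup hc
  have hcl : IsJamClosed d G B := by
    intro v hv
    by_contra hvB
    have hins : insert v B ∈ P := by
      simp only [P, Finset.mem_filter_univ]
      refine ⟨hSB.trans (Finset.subset_insert _ _), fun w hw hwS => ?_, ?_⟩
      · have hmono := degIn_mono (G := G) (Finset.subset_insert v B) w
        rcases Finset.mem_insert.mp hw with rfl | hw
        · omega
        · have := hsup w hw hwS
          omega
      · rw [Finset.card_insert_of_notMem hvB]
        omega
    have := hmax _ hins
    rw [Finset.card_insert_of_notMem hvB] at this
    omega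
  have := Finset.card_le_card (jamClosure_subset hSB hcl)
  omega

open Classical in
/-- The vertices that can be reached from `a` in at most `i` steps along `R`. -/
noncomputable def stepBall (R : Fin n → Fin n → Prop) (a : Fin n) : ℕ → Finset (Fin n)
  | 0 => {a}
  | i + 1 => stepBall R a i ∪ Finset.univ.filter fun w => ∃ v ∈ stepBall R a i, R v w

lemma stepBall_subset (R : Fin n → Fin n → Prop) (a : Fin n) (i : ℕ) :
    stepBall R a i ⊆ stepBall R a (i + 1) := by
  classical
  rw [stepBall]; exact Finset.subset_union_left

lemma mem_stepBall_succ {R : Fin n → Fin n → Prop} {a v w : Fin n} {i : ℕ}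
    (hv : v ∈ stepBall R a i) (hR : R v w) : w ∈ stepBall R a (i + 1) := by
  classical
  rw [stepBall, Finset.mem_union, Finset.mem_filter_univ]
  exact Or.inr ⟨v, hv, hR⟩

open Classical in
/-- If every vertex can be left along `3 d / 4` edges, then balls grow by a factor `d / lam` until
they contain half of the vertices. -/
lemma MixingBound.lt_two_mul_card_stepBall (hmix : MixingBound d lam G) (hn : 0 < n)
    (hlam0 : 0 < lam) (hlam : 200 * lam ≤ d) {R : Fin n → Fin n → Prop}
    (hRG : ∀ v w, R v w → G.Adj v w)
    (hdeg : ∀ v, 3 * d ≤ 4 * (Finset.univ.filter (R v)).card) (a : Fin n) {i : ℕ}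
    (hi : (n : ℝ) ≤ (d / lam) ^ i) : n < 2 * (stepBall R a i).card := by
  by_contra! hcon
  have hn' : (0 : ℝ) < n := by exact_mod_cast hn
  have hq : 200 ≤ d / lam := by rwa [le_div_iff₀ hlam0]
  have hgrow : ∀ j ≤ i, (d / lam) ^ j ≤ (stepBall R a j).card := by
    intro j
    induction j with
    | zero => intro _; simp [stepBall]
    | succ j ih =>
      intro hj
      have hle : ∀ k, j + 1 ≤ k → (stepBall R a (j + 1)).card ≤ (stepBall R a k).card := by
        intro k hk
        induction k, hk using Nat.le_induction with
        | base => exact le_rfl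
        | succ k _ ihk => exact ihk.trans (Finset.card_le_card (stepBall_subset R a k))
      have hy : 2 * (stepBall R a (j + 1)).card ≤ n := by have := hle i hj; omega
      have h := hmix.mul_card_le (c := 3 * d / 4) (X := stepBall R a j)
        (Y := stepBall R a (j + 1)) fun v hv => by
          have h1 : (Finset.univ.filter (R v)).card ≤ degIn G (stepBall R a (j + 1)) v := by
            refine Finset.card_le_card fun w hw => ?_
            rw [Finset.mem_filter_univ] at hw
            rw [Finset.mem_filter]
            exact ⟨mem_stepBall_succ hv hw, hRG v w hw⟩
          have h2 : 3 * (d : ℝ) ≤ 4 * degIn G (stepBall R a (j + 1)) v := by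
            exact_mod_cast (hdeg v).trans (Nat.mul_le_mul_left 4 h1)
          linarith
      have ih := ih (by omega)
      have hy' : 2 * ((stepBall R a (j + 1)).card : ℝ) ≤ n := by exact_mod_cast hy
      set x : ℝ := ((stepBall R a j).card : ℝ)
      set y : ℝ := ((stepBall R a (j + 1)).card : ℝ)
      have hx : 0 < x := lt_of_lt_of_le (by positivity) ih
      have hd' : (0 : ℝ) < d := by linarith
      have hyn : 0 ≤ y := Nat.cast_nonneg _
      have h1 : (d : ℝ) * x * y / n ≤ d * x / 2 := by
        rw [div_le_div_iff₀ hn' (by norm_num)]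
        nlinarith [mul_pos hd' hx]
      have hsx := Real.sqrt_pos.mpr hx
      have hxx : √x * √x = x := Real.mul_self_sqrt hx.le
      have hyy : √y * √y = y := Real.mul_self_sqrt hyn
      -- At most `d * x / 2` of the `3 * d * x / 4` edges are accounted for by the density of `G`;
      -- the rest has to come from the error term `lam * √(x * y)`.
      have h3 : d / lam * √x ≤ 4 * √y := by
        rw [div_mul_eq_mul_div, div_le_iff₀ hlam0]
        have h4 : √x * (d * √x) ≤ √x * (4 * √y * lam) := by nlinarith
        exact le_of_mul_le_mul_left h4 hsx
      have h5 : (d / lam) * (d / lam) * x ≤ 16 * y := by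
        have := mul_le_mul h3 h3 (by positivity) (by positivity)
        calc (d / lam) * (d / lam) * x = (d / lam) * (d / lam) * (√x * √x) := by rw [hxx]
          _ = (d / lam * √x) * (d / lam * √x) := by ring
          _ ≤ 4 * √y * (4 * √y) := this
          _ = 16 * (√y * √y) := by ring
          _ = 16 * y := by rw [hyy]
      have h6 : 0 < d / lam * x := by positivity
      rw [pow_succ]
      nlinarith
  have h1 := hgrow i le_rfl
  have h2 : 2 * ((stepBall R a i).card : ℝ) ≤ n := by exact_mod_cast hcon
  linarith

end Expansion

/-! ### Edges used by a family of paths -/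

section Family

variable {n d : ℕ} {G : SimpleGraph (Fin n)}

/-- The number of edges of the path `P` at the vertex `v`. -/
def RoutedPath.degree (P : RoutedPath G) (v : Fin n) : ℕ := P.edges.countP fun e => v ∈ e

lemma SimpleGraph.Walk.IsPath.countP_edges_le {a b : Fin n} {p : G.Walk a b} (hp : p.IsPath)
    (v : Fin n) : (p.edges.countP fun e => v ∈ e) ≤ 2 ∧
      (v = a → (p.edges.countP fun e => v ∈ e) ≤ 1) := by
  induction p with
  | nil => simp
  | @cons u w b h p ih =>
    rw [SimpleGraph.Walk.cons_isPath_iff] at hp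
    obtain ⟨ih1, ih2⟩ := ih hp.1
    rw [SimpleGraph.Walk.edges_cons, List.countP_cons]
    by_cases hv : v = u
    · have h0 : (p.edges.countP fun e => v ∈ e) = 0 := by
        rw [List.countP_eq_zero]
        intro e he hve
        rw [decide_eq_true_eq, hv] at hve
        exact hp.2 (p.mem_support_of_mem_edges he hve)
      rw [h0]
      constructor
      · split_ifs <;> omega
      · intro _; split_ifs <;> omega
    · refine ⟨?_, fun h => absurd h hv⟩
      by_cases hw : v = w
      · have := ih2 hw
        split_ifs <;> omega
      · rw [if_neg (by simp [hv, hw])]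
        exact ih1

lemma RoutedPath.degree_le_two (P : RoutedPath G) (v : Fin n) : P.degree v ≤ 2 :=
  (P.path.2.countP_edges_le v).1

lemma RoutedPath.degree_le_one (P : RoutedPath G) {v : Fin n} (hv : v = P.src ∨ v = P.dst) :
    P.degree v ≤ 1 := by
  rcases hv with hv | hv
  · exact (P.path.2.countP_edges_le v).2 hv
  · have := (P.path.2.reverse.countP_edges_le v).2 hv
    rwa [SimpleGraph.Walk.edges_reverse, List.countP_reverse] at this

lemma RoutedPath.degree_eq_zero (P : RoutedPath G) {v : Fin n} (hv : v ∉ P.vertices) :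
    P.degree v = 0 := by
  rw [RoutedPath.degree, List.countP_eq_zero]
  intro e he hve
  exact hv (P.path.1.mem_support_of_mem_edges he (by simpa using hve))

lemma RoutedPath.sum_degree_le (P : RoutedPath G) : ∑ v, P.degree v ≤ 2 * P.length := by
  have key : ∀ l : List (Sym2 (Fin n)), ∑ v, l.countP (fun e => v ∈ e) ≤ 2 * l.length := by
    intro l
    induction l with
    | nil => simp
    | cons e l ih =>
      simp only [List.countP_cons, Finset.sum_add_distrib, List.length_cons]
      have h1 : ∑ v : Fin n, (if decide (v ∈ e) = true then 1 else 0) ≤ 2 := by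
        rw [← Finset.card_filter]
        induction e using Sym2.ind with
        | _ x y =>
          refine (Finset.card_le_card (t := {x, y}) fun v hv => ?_).trans Finset.card_le_two
          simpa using hv
      omega
  rw [RoutedPath.length, ← SimpleGraph.Walk.length_edges]
  exact key P.edges

/-- The edges of all paths of a family. -/
def usedEdges (F : Multiset (RoutedPath G)) : Multiset (Sym2 (Fin n)) :=
  F.bind fun P => (P.edges : Multiset (Sym2 (Fin n)))

@[simp] lemma usedEdges_cons (P : RoutedPath G) (F : Multiset (RoutedPath G)) :
    usedEdges (P ::ₘ F) = (P.edges : Multiset (Sym2 (Fin n))) + usedEdges F :=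
  Multiset.cons_bind _ _ _

@[simp] lemma usedEdges_zero : usedEdges (0 : Multiset (RoutedPath G)) = 0 := rfl

/-- The number of edges at `v` that are used by a family of paths. -/
def usedDegree (F : Multiset (RoutedPath G)) (v : Fin n) : ℕ :=
  (F.map fun P => P.degree v).sum

@[simp] lemma usedDegree_cons (P : RoutedPath G) (F : Multiset (RoutedPath G)) (v : Fin n) :
    usedDegree (P ::ₘ F) v = P.degree v + usedDegree F v := by
  simp [usedDegree]

lemma usedDegree_eq_countP (F : Multiset (RoutedPath G)) (v : Fin n) :
    usedDegree F v = (usedEdges F).countP fun e => v ∈ e := by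
  induction F using Multiset.induction_on with
  | empty => simp [usedDegree]
  | cons P F ih =>
    rw [usedDegree_cons, usedEdges_cons, Multiset.countP_add, ih, Multiset.coe_countP]
    rfl

lemma usedDegree_eq_card {F : Multiset (RoutedPath G)} (hF : (usedEdges F).Nodup) (v : Fin n) :
    usedDegree F v = (Finset.univ.filter fun w => s(v, w) ∈ usedEdges F).card := by
  classical
  rw [usedDegree_eq_countP, Multiset.countP_eq_card_filter,
    ← Multiset.toFinset_card_of_nodup (hF.filter _),
    ← Finset.card_image_of_injective (f := fun w => s(v, w)) _
      (fun w w' h => Sym2.congr_right.mp h)]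
  congr 1
  ext e
  simp only [Multiset.mem_toFinset, Multiset.mem_filter, Finset.mem_image, Finset.mem_filter_univ]
  constructor
  · rintro ⟨he, hv⟩
    obtain ⟨w, rfl⟩ := hv
    exact ⟨w, he, rfl⟩
  · rintro ⟨w, hw, rfl⟩
    exact ⟨hw, Sym2.mem_mk_left v w⟩

lemma sum_usedDegree_le (F : Multiset (RoutedPath G)) :
    ∑ v, usedDegree F v ≤ 2 * (F.map RoutedPath.length).sum := by
  induction F using Multiset.induction_on with
  | empty => simp [usedDegree]
  | cons P F ih =>
    simp only [usedDegree_cons, Finset.sum_add_distrib, Multiset.map_cons, Multiset.sum_cons]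
    have := P.sum_degree_le
    omega

lemma endpointCount_cons (P : RoutedPath G) (F : Multiset (RoutedPath G)) (v : Fin n) :
    endpointCount (P ::ₘ F) v =
      (if P.src = v ∨ P.dst = v then 1 else 0) + endpointCount F v := by
  classical
  simp only [endpointCount, Multiset.filter_cons]
  split_ifs <;> simp [add_comm]

open Classical in
/-- The number of edges of `P` at `v`, unless `P` ends in `v` or has an edge from `v` to `I v`.
For a vertex `v` that was jammed when `P` was chosen this number is `0`. -/
noncomputable def oldDegree (I : Fin n → Finset (Fin n)) (v : Fin n) (P : RoutedPath G) : ℕ :=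
  if v = P.src ∨ v = P.dst ∨ ∃ w ∈ I v, s(v, w) ∈ P.edges then 0 else P.degree v

lemma oldDegree_le (I : Fin n → Finset (Fin n)) (v : Fin n) (P : RoutedPath G) :
    oldDegree I v P ≤ P.degree v := by
  unfold oldDegree; split_ifs <;> omega

lemma RoutedPath.degree_le (P : RoutedPath G) (I : Fin n → Finset (Fin n)) (v : Fin n) :
    P.degree v ≤ oldDegree I v P + (if P.src = v ∨ P.dst = v then 1 else 0) +
      2 * ∑ w ∈ I v, P.edges.count s(v, w) := by
  have h2 := P.degree_le_two v
  by_cases h : P.src = v ∨ P.dst = v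
  · have := P.degree_le_one (v := v) (h.imp Eq.symm Eq.symm)
    rw [if_pos h]
    omega
  · rw [if_neg h]
    push Not at h
    by_cases hI : ∃ w ∈ I v, s(v, w) ∈ P.edges
    · obtain ⟨w, hw, hP⟩ := hI
      have h1 : 0 < P.edges.count s(v, w) := List.count_pos_iff.mpr hP
      have := Finset.single_le_sum (f := fun w => P.edges.count s(v, w))
        (fun _ _ => Nat.zero_le _) hw
      omega
    · rw [oldDegree, if_neg (by rintro (h1 | h1 | h1); exacts [h.1 h1.symm, h.2 h1.symm, hI h1])]
      omega

/-- The edges at `v` come from old paths, from paths that end in `v`, and from paths that use one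
of the edges between `v` and `I v`. -/
lemma usedDegree_le {F : Multiset (RoutedPath G)} (hF : (usedEdges F).Nodup)
    (I : Fin n → Finset (Fin n)) (v : Fin n) :
    usedDegree F v ≤ (F.map (oldDegree I v)).sum + endpointCount F v + 2 * (I v).card := by
  have h1 : usedDegree F v ≤ (F.map (oldDegree I v)).sum + endpointCount F v +
      2 * ∑ w ∈ I v, (usedEdges F).count s(v, w) := by
    clear hF
    induction F using Multiset.induction_on with
    | empty => simp [usedDegree]
    | cons P F ih =>
      simp only [usedDegree_cons, Multiset.map_cons, Multiset.sum_cons, endpointCount_cons,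
        usedEdges_cons, Multiset.count_add, Finset.sum_add_distrib, Multiset.coe_count]
      have := P.degree_le I v
      omega
  have h2 : ∑ w ∈ I v, (usedEdges F).count s(v, w) ≤ (I v).card := by
    rw [Finset.card_eq_sum_ones]
    exact Finset.sum_le_sum fun w _ => Multiset.nodup_iff_count_le_one.mp hF _
  omega

end Family

/-! ### Jammed vertices and the invariant of the routing family -/

section Invariant

variable {n d : ℕ} {lam : ℝ} {G : SimpleGraph (Fin n)} [DecidableRel G.Adj]

/-- The jammed vertices: those at which at least `d / 20` edges are used, closed under adding
vertices with more than `d / 50` jammed neighbours. -/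
noncomputable def jammed (d : ℕ) (F : Multiset (RoutedPath G)) : Finset (Fin n) :=
  jamClosure d G (Finset.univ.filter fun v => d ≤ 20 * usedDegree F v)

lemma jammed_zero (hd : 0 < d) : jammed d (0 : Multiset (RoutedPath G)) = ∅ := by
  refine Finset.subset_empty.mp (jamClosure_subset (fun v hv => ?_) fun v hv => ?_)
  · simp [usedDegree, hd.ne'] at hv
  · simp [degIn] at hv

lemma jammed_mono (P : RoutedPath G) (F : Multiset (RoutedPath G)) :
    jammed d F ⊆ jammed d (P ::ₘ F) := by
  refine jamClosure_mono fun v hv => ?_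
  rw [Finset.mem_filter_univ] at hv ⊢
  rw [usedDegree_cons]
  omega

lemma usedDegree_lt_of_notMem_jammed {F : Multiset (RoutedPath G)} {v : Fin n}
    (hv : v ∉ jammed d F) : 20 * usedDegree F v < d := by
  by_contra! h
  exact hv (subset_jamClosure _ ((Finset.mem_filter_univ v).mpr h))

lemma degIn_le_of_notMem_jammed {F : Multiset (RoutedPath G)} {v : Fin n}
    (hv : v ∉ jammed d F) : 50 * degIn G (jammed d F) v ≤ d := by
  by_contra! h
  exact hv (isJamClosed_jamClosure _ v h)

/-- The invariant of the family `F` of paths. A jammed vertex `v` may be entered only from the set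
`I v`, which is fixed as long as `v` is jammed; `ρ` bounds the lengths of the paths. The bound in
`old_le` is `d / 20` plus two edges for the path by which `v` becomes jammed. -/
structure RoutingInvariant (d r : ℕ) (ρ : ℝ) (F : Multiset (RoutedPath G))
    (I : Fin n → Finset (Fin n)) : Prop where
  nodup : (usedEdges F).Nodup
  length_le : ∀ P ∈ F, (P.length : ℝ) ≤ ρ
  card_le : F.card ≤ r
  endpoint_lt : ∀ v, (endpointCount F v : ℝ) < d / 200 + 1
  entry_card : ∀ v ∈ jammed d F, 50 * (I v).card ≤ 2 * d
  entry : ∀ v ∈ jammed d F, ∀ w ∈ jammed d F, G.Adj v w → v ∈ I w ∨ w ∈ I v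
  old_le : ∀ v ∈ jammed d F, 20 * (F.map (oldDegree I v)).sum ≤ d + 40

/-- The steps `v → w` that a new path may take: along an unused edge, and into a jammed vertex `w`
only from `I w`. -/
def AllowedStep (d : ℕ) (F : Multiset (RoutedPath G)) (I : Fin n → Finset (Fin n))
    (v w : Fin n) : Prop :=
  G.Adj v w ∧ s(v, w) ∉ usedEdges F ∧ (w ∈ jammed d F → v ∈ I w)

lemma RoutingInvariant.zero (r : ℕ) {ρ : ℝ} (hd : 0 < d) (I : Fin n → Finset (Fin n)) :
    RoutingInvariant d r ρ (0 : Multiset (RoutedPath G)) I := by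
  have hj := jammed_zero (G := G) hd
  refine ⟨Multiset.nodup_zero, by simp, by simp, fun v => ?_, ?_, ?_, ?_⟩
  · simp only [endpointCount, Multiset.filter_zero, Multiset.card_zero, Nat.cast_zero]
    positivity
  all_goals simp [hj]

open Classical in
/-- Every vertex can be left in most directions. -/
lemma RoutingInvariant.card_allowedStep {r : ℕ} {ρ : ℝ} {F : Multiset (RoutedPath G)}
    {I : Fin n → Finset (Fin n)} (h : RoutingInvariant d r ρ F I) (hd : 200 < d)
    (hreg : G.IsRegularOfDegree d) (v : Fin n) :
    3 * d ≤ 4 * (Finset.univ.filter (AllowedStep d F I v)).card := by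
  have hd' : (200 : ℝ) < d := by exact_mod_cast hd
  have hep := h.endpoint_lt v
  have hcard := usedDegree_eq_card h.nodup v
  by_cases hv : v ∈ jammed d F
  -- At most `d / 20 + 2` edges of old paths, fewer than `d / 200 + 1` of paths that end in `v`, and
  -- `3 * |I v| ≤ 3 * d / 25` further ones are lost, which is less than `d / 4` for `d > 200`.
  · have hsub : G.neighborFinset v ⊆ Finset.univ.filter (AllowedStep d F I v) ∪
        ((Finset.univ.filter fun w => s(v, w) ∈ usedEdges F) ∪ I v) := by
      intro w hw
      rw [SimpleGraph.mem_neighborFinset] at hw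
      simp only [Finset.mem_union, Finset.mem_filter_univ, AllowedStep]
      by_cases h1 : s(v, w) ∈ usedEdges F
      · tauto
      · by_cases h2 : w ∈ jammed d F
        · have := h.entry v hv w h2 hw
          tauto
        · tauto
    have h1 := Finset.card_le_card hsub
    rw [SimpleGraph.card_neighborFinset_eq_degree, hreg v] at h1
    have h2 := Finset.card_union_le (Finset.univ.filter (AllowedStep d F I v))
      ((Finset.univ.filter fun w => s(v, w) ∈ usedEdges F) ∪ I v)
    have h3 := Finset.card_union_le (Finset.univ.filter fun w => s(v, w) ∈ usedEdges F) (I v)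
    have h4 := usedDegree_le h.nodup I v
    have h5 := h.old_le v hv
    have h6 := h.entry_card v hv
    have h7 : 200 * endpointCount F v < d + 200 := by
      have : (200 * endpointCount F v : ℝ) < d + 200 := by linarith
      exact_mod_cast this
    omega
  -- At most `d / 20` edges at `v` are used, and at most `d / 50` go to jammed vertices.
  · have hsub : G.neighborFinset v ⊆ Finset.univ.filter (AllowedStep d F I v) ∪
        ((Finset.univ.filter fun w => s(v, w) ∈ usedEdges F) ∪
          (jammed d F).filter (G.Adj v)) := by
      intro w hw
      rw [SimpleGraph.mem_neighborFinset] at hw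
      simp only [Finset.mem_union, AllowedStep, Finset.mem_filter, Finset.mem_univ, true_and]
      tauto
    have h1 := Finset.card_le_card hsub
    rw [SimpleGraph.card_neighborFinset_eq_degree, hreg v] at h1
    have h2 := Finset.card_union_le (Finset.univ.filter (AllowedStep d F I v))
      ((Finset.univ.filter fun w => s(v, w) ∈ usedEdges F) ∪ (jammed d F).filter (G.Adj v))
    have h3 := Finset.card_union_le (Finset.univ.filter fun w => s(v, w) ∈ usedEdges F)
      ((jammed d F).filter (G.Adj v))
    have h4 := usedDegree_lt_of_notMem_jammed hv
    have h5 := degIn_le_of_notMem_jammed hv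
    unfold degIn at h5
    omega

/-- There are few jammed vertices if the paths do not have too many edges in total. -/
lemma card_jammed_le (hmix : MixingBound d lam G) (hd : 0 < d) (hlam : 200 * lam ≤ d)
    (hn : 200 ≤ n) {r : ℕ} {ρ : ℝ} (hρ : 0 ≤ ρ)
    {F : Multiset (RoutedPath G)} (hcard : F.card ≤ r)
    (hlen : ∀ P ∈ F, (P.length : ℝ) ≤ ρ) (hr : 16000 * (r * ρ) ≤ n * d) :
    200 * (jammed d F).card ≤ n := by
  refine hmix.card_jamClosure hd hlam hn ?_
  set S := Finset.univ.filter fun v => d ≤ 20 * usedDegree F v with hS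
  have h1 : S.card * d ≤ 20 * ∑ v, usedDegree F v := by
    rw [Finset.mul_sum, ← smul_eq_mul]
    refine (Finset.card_nsmul_le_sum S _ d fun v hv => ?_).trans
      (Finset.sum_le_univ_sum_of_nonneg fun _ => Nat.zero_le _)
    exact (Finset.mem_filter_univ v).mp hv
  have h2 := sum_usedDegree_le F
  have h3 : ((F.map RoutedPath.length).sum : ℝ) ≤ r * ρ := by
    calc ((F.map RoutedPath.length).sum : ℝ) = (F.map fun P => (P.length : ℝ)).sum := by
          rw [Nat.cast_multiset_sum, Multiset.map_map]; rfl
      _ ≤ (F.map fun P => (P.length : ℝ)).card • ρ :=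
          Multiset.sum_le_card_nsmul _ _ fun x hx => by
            obtain ⟨P, hP, rfl⟩ := Multiset.mem_map.mp hx
            exact hlen P hP
      _ = F.card * ρ := by rw [Multiset.card_map, nsmul_eq_mul]
      _ ≤ r * ρ := mul_le_mul_of_nonneg_right (by exact_mod_cast hcard) hρ
  have h4 : ((S.card * d : ℕ) : ℝ) ≤ (20 * (2 * (F.map RoutedPath.length).sum) : ℕ) := by
    exact_mod_cast h1.trans (Nat.mul_le_mul_left 20 h2)
  simp only [Nat.cast_mul, Nat.cast_ofNat] at h4
  have hd' : (0 : ℝ) < d := by exact_mod_cast hd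
  have h5 : (400 * S.card : ℝ) * d ≤ n * d := by linarith
  have h6 := le_of_mul_le_mul_right h5 hd'
  exact_mod_cast h6

/-- A new path of allowed steps preserves the invariant, if the entry sets are kept for the
vertices that were already jammed and suitably chosen for the vertices that become jammed. -/
lemma RoutingInvariant.cons {r : ℕ} {ρ : ℝ} {F : Multiset (RoutedPath G)}
    {I I' : Fin n → Finset (Fin n)} (h : RoutingInvariant d r ρ F I) {P : RoutedPath G}
    (hdisj : ∀ e ∈ P.edges, e ∉ usedEdges F) (hlen : (P.length : ℝ) ≤ ρ) (hcard : F.card < r)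
    (hsrc : (endpointCount F P.src : ℝ) < d / 200) (hdst : (endpointCount F P.dst : ℝ) < d / 200)
    (hentry : ∀ v ∈ jammed d F, v ∈ P.vertices →
      v = P.src ∨ v = P.dst ∨ ∃ w ∈ I v, s(v, w) ∈ P.edges)
    (hI : ∀ v ∈ jammed d F, I' v = I v)
    (hcard' : ∀ v ∈ jammed d (P ::ₘ F), v ∉ jammed d F → 50 * (I' v).card ≤ 2 * d)
    (hadj : ∀ v ∈ jammed d (P ::ₘ F), v ∉ jammed d F → ∀ w ∈ jammed d (P ::ₘ F), G.Adj v w →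
      v ∈ I' w ∨ w ∈ I' v) :
    RoutingInvariant d r ρ (P ::ₘ F) I' := by
  refine ⟨?_, ?_, ?_, fun v => ?_, fun v hv => ?_, fun v hv w hw hvw => ?_, fun v hv => ?_⟩
  · rw [usedEdges_cons, Multiset.nodup_add]
    refine ⟨Multiset.coe_nodup.mpr P.path.2.isTrail.edges_nodup, h.nodup, ?_⟩
    rw [Multiset.disjoint_left]
    exact fun {e} he => hdisj e (Multiset.mem_coe.mp he)
  · intro Q hQ
    rcases Multiset.mem_cons.mp hQ with rfl | hQ
    exacts [hlen, h.length_le Q hQ]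
  · rw [Multiset.card_cons]; exact hcard
  · rw [endpointCount_cons]
    split_ifs with hv
    · push_cast
      rcases hv with rfl | rfl <;> linarith
    · rw [zero_add]; exact h.endpoint_lt v
  · by_cases hvF : v ∈ jammed d F
    · rw [hI v hvF]; exact h.entry_card v hvF
    · exact hcard' v hv hvF
  · by_cases hvF : v ∈ jammed d F
    · by_cases hwF : w ∈ jammed d F
      · rw [hI v hvF, hI w hwF]; exact h.entry v hvF w hwF hvw
      · exact (hadj w hw hwF v hv hvw.symm).symm
    · exact hadj v hv hvF w hw hvw
  · rw [Multiset.map_cons, Multiset.sum_cons]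
    by_cases hvF : v ∈ jammed d F
    · have h1 : ∀ Q : RoutedPath G, oldDegree I' v Q = oldDegree I v Q := fun Q => by
        simp only [oldDegree, hI v hvF]
      have h2 : oldDegree I v P = 0 := by
        by_cases hvP : v ∈ P.vertices
        · exact if_pos (hentry v hvF hvP)
        · have h3 := oldDegree_le I v P
          rw [P.degree_eq_zero hvP] at h3
          omega
      simp only [h1, h2, zero_add]
      exact h.old_le v hvF
    -- Before `P` was added, fewer than `d / 20` edges at `v` were used, and `P` has at most two.
    · have h1 := usedDegree_lt_of_notMem_jammed hvF
      have h2 := oldDegree_le I' v P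
      have h3 := P.degree_le_two v
      have h4 : (F.map (oldDegree I' v)).sum ≤ usedDegree F v :=
        Multiset.sum_map_le_sum_map _ _ fun Q _ => oldDegree_le I' v Q
      omega

/-- A removed path can only make vertices lose their jams, and every bound of the invariant is
monotone in the family. -/
lemma RoutingInvariant.of_cons {r : ℕ} {ρ : ℝ} {F : Multiset (RoutedPath G)}
    {I I' : Fin n → Finset (Fin n)} {P : RoutedPath G}
    (h : RoutingInvariant d r ρ (P ::ₘ F) I)
    (hI : ∀ v ∈ jammed d F, I' v = I v) : RoutingInvariant d r ρ F I' := by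
  have hsub := jammed_mono (d := d) P F
  refine ⟨?_, ?_, ?_, fun v => ?_, fun v hv => ?_, fun v hv w hw hvw => ?_, fun v hv => ?_⟩
  · have := h.nodup
    rw [usedEdges_cons, Multiset.nodup_add] at this
    exact this.2.1
  · exact fun Q hQ => h.length_le Q (Multiset.mem_cons_of_mem hQ)
  · have := h.card_le
    rw [Multiset.card_cons] at this
    omega
  · refine lt_of_le_of_lt ?_ (h.endpoint_lt v)
    rw [endpointCount_cons]
    push_cast
    linarith [show (0 : ℝ) ≤ (if P.src = v ∨ P.dst = v then 1 else 0) by split_ifs <;> norm_num]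
  · rw [hI v hv]; exact h.entry_card v (hsub hv)
  · rw [hI v hv, hI w hw]; exact h.entry v (hsub hv) w (hsub hw) hvw
  · have h1 : ∀ Q : RoutedPath G, oldDegree I' v Q = oldDegree I v Q := fun Q => by
      simp only [oldDegree, hI v hv]
    rw [Multiset.map_congr rfl fun Q _ => h1 Q]
    have := h.old_le v (hsub hv)
    rw [Multiset.map_cons, Multiset.sum_cons] at this
    omega

end Invariant

/-! ### Search trees and the path through a meeting point -/

section SearchTree

variable {n : ℕ} {R : Fin n → Fin n → Prop} {a b z : Fin n} {L P L' P' : ℕ → ℕ}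

/-- The arrays `L` and `P` describe a breadth-first search tree for the relation `R` with root `a`:
`L v` is the distance from `a` plus one, or `0` if `v` is not reached, and `P v` is the parent of
`v`. -/
structure IsSearchTree (R : Fin n → Fin n → Prop) (a : Fin n) (L P : ℕ → ℕ) : Prop where
  root : L a = 1
  parent_root : P a = a
  eq_root : ∀ v : Fin n, L v = 1 → v = a
  parent : ∀ w : Fin n, 2 ≤ L w → ∃ v : Fin n, P w = v ∧ L v + 1 = L w ∧ R v w
  step : ∀ v w : Fin n, R v w → 0 < L v → L v < n → 0 < L w ∧ L w ≤ L v + 1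

lemma IsSearchTree.of_mem_stepBall (h : IsSearchTree R a L P) {i : ℕ} (hi : i < n) {w : Fin n}
    (hw : w ∈ stepBall R a i) : 0 < L w ∧ L w ≤ i + 1 := by
  classical
  induction i generalizing w with
  | zero =>
    rw [stepBall, Finset.mem_singleton] at hw
    rw [hw, h.root]
    omega
  | succ i ih =>
    rw [stepBall, Finset.mem_union, Finset.mem_filter_univ] at hw
    rcases hw with hw | ⟨v, hv, hvw⟩
    · have := ih (by omega) hw
      omega
    · have h1 := ih (by omega) hv
      have h2 := h.step v w hvw h1.1 (by omega)
      omega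

/-- The chain of ancestors of a vertex, which stays at the root once it has arrived there. -/
lemma IsSearchTree.exists_chain (h : IsSearchTree R a L P) (hz : 0 < L z) :
    ∃ c : ℕ → Fin n, c 0 = z ∧ (∀ j, P (c j) = c (j + 1)) ∧
      (∀ j, L (c j) = L z - 1 - j + 1) ∧ (∀ j, j + 1 < L z → R (c (j + 1)) (c j)) ∧
      ∀ j, L z ≤ j + 1 → c j = a := by
  let p : Fin n → Fin n := fun w => if hw : P w < n then ⟨P w, hw⟩ else w
  let c : ℕ → Fin n := fun j => p^[j] z
  have hc : ∀ j, c (j + 1) = p (c j) := fun j => Function.iterate_succ_apply' p j z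
  have hp : ∀ w : Fin n, P w < n → P w = p w := fun w hw => by simp [p, hw]
  have hL : ∀ j, L (c j) = L z - 1 - j + 1 ∧ P (c j) < n := by
    have hlt : ∀ w : Fin n, 0 < L w → P w < n := by
      intro w hw
      by_cases h2 : 2 ≤ L w
      · obtain ⟨v, hv, -⟩ := h.parent w h2
        rw [hv]; exact v.2
      · rw [h.eq_root w (by omega), h.parent_root]; exact a.2
    intro j
    induction j with
    | zero => exact ⟨by simp only [c, Function.iterate_zero, id]; omega, hlt z hz⟩
    | succ j ih =>
      have h1 : L (c (j + 1)) = L z - 1 - (j + 1) + 1 := by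
        rw [hc]
        by_cases h2 : 2 ≤ L (c j)
        · obtain ⟨v, hv, hv2, -⟩ := h.parent _ h2
          have : p (c j) = v := Fin.ext (by rw [← hp _ ih.2, hv])
          rw [this]
          omega
        · have h3 : c j = a := h.eq_root _ (by omega)
          have : p (c j) = a := Fin.ext (by rw [← hp _ ih.2, h3, h.parent_root])
          rw [this, h.root]
          omega
      exact ⟨h1, hlt _ (by omega)⟩
  refine ⟨c, rfl, fun j => by rw [hc, hp _ (hL j).2], fun j => (hL j).1, fun j hj => ?_,
    fun j hj => h.eq_root _ (by rw [(hL j).1]; omega)⟩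
  obtain ⟨v, hv, -, hR⟩ := h.parent (c j) (by rw [(hL j).1]; omega)
  have : c (j + 1) = v := Fin.ext (by rw [hc, ← hp _ (hL j).2, hv])
  rw [this]
  exact hR

/-- The chain of `c` read backwards for `k` steps, and then the chain of `c'` read forwards. -/
def joinChains (k : ℕ) (c c' : ℕ → Fin n) (i : ℕ) : Fin n := if i ≤ k then c (k - i) else c' (i - k)

/-- If `z` minimizes the sum of the levels in two search trees, then the chains from `z` to the
two roots meet in `z` only. -/
lemma joinChains_injOn (hmin : ∀ v : Fin n, 0 < L v → 0 < L' v → L z + L' z ≤ L v + L' v)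
    (hz : 0 < L z) (hz' : 0 < L' z) {c c' : ℕ → Fin n}
    (hc : ∀ j, L (c j) = L z - 1 - j + 1) (hc' : ∀ j, L' (c' j) = L' z - 1 - j + 1) :
    Set.InjOn (joinChains (L z - 1) c c') {i | i ≤ L z - 1 + (L' z - 1)} := by
  have key : ∀ i j, i ≤ j → i ≤ L z - 1 + (L' z - 1) → j ≤ L z - 1 + (L' z - 1) →
      joinChains (L z - 1) c c' i = joinChains (L z - 1) c c' j → i = j := by
    intro i j hij hi hj h
    unfold joinChains at h
    by_cases h1 : j ≤ L z - 1
    · rw [if_pos (hij.trans h1), if_pos h1] at h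
      have h2 := hc (L z - 1 - i)
      have h3 := hc (L z - 1 - j)
      rw [h] at h2
      omega
    · by_cases h2 : i ≤ L z - 1
      · rw [if_pos h2, if_neg h1] at h
        have h3 := hc (L z - 1 - i)
        have h4 := hc' (j - (L z - 1))
        have h5 := hmin (c (L z - 1 - i)) (by omega) (by rw [h]; omega)
        rw [← h] at h4
        omega
      · rw [if_neg h1, if_neg h2] at h
        have h3 := hc' (i - (L z - 1))
        have h4 := hc' (j - (L z - 1))
        rw [h] at h3
        omega
  intro i hi j hj h
  rcases le_total i j with hij | hij
  · exact key i j hij hi hj h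
  · exact (key j i hij hj hi h.symm).symm

lemma SimpleGraph.exists_walk_of_adj {V : Type*} {G : SimpleGraph V} (f : ℕ → V) (m : ℕ)
    (h : ∀ i < m, G.Adj (f i) (f (i + 1))) :
    ∃ p : G.Walk (f 0) (f m), p.support = (List.range (m + 1)).map f ∧
      p.edges = (List.range m).map fun i => s(f i, f (i + 1)) := by
  induction m generalizing f with
  | zero => exact ⟨.nil, by simp, by simp⟩
  | succ m ih =>
    obtain ⟨p, hp, hpe⟩ := ih (fun i => f (i + 1)) fun i hi => h (i + 1) (by omega)
    refine ⟨.cons (h 0 (by omega)) p, ?_, ?_⟩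
    · rw [SimpleGraph.Walk.support_cons, hp, List.range_succ_eq_map (n := m + 1), List.map_cons,
        List.map_map]
      rfl
    · rw [SimpleGraph.Walk.edges_cons, hpe, List.range_succ_eq_map (n := m), List.map_cons,
        List.map_map]
      rfl

end SearchTree

section MeetingPath

variable {n d : ℕ} {G : SimpleGraph (Fin n)} [DecidableRel G.Adj] {F : Multiset (RoutedPath G)}
  {I : Fin n → Finset (Fin n)} {a b z : Fin n} {L P L' P' : ℕ → ℕ}

/-- The path from `a` to `b` through a best meeting point of two search trees for the allowed
steps is edge-disjoint from the family, and it enters jammed vertices as required. -/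
lemma exists_meeting_path (hT : IsSearchTree (AllowedStep d F I) a L P)
    (hT' : IsSearchTree (AllowedStep d F I) b L' P')
    (hmin : ∀ v : Fin n, 0 < L v → 0 < L' v → L z + L' z ≤ L v + L' v)
    (hz : 0 < L z) (hz' : 0 < L' z) :
    ∃ (c c' : ℕ → Fin n) (p : G.Path a b), c 0 = z ∧ (∀ j, P (c j) = c (j + 1)) ∧
      (∀ j, L (c j) = L z - 1 - j + 1) ∧ (∀ j, L z ≤ j + 1 → c j = a) ∧
      c' 0 = z ∧ (∀ j, P' (c' j) = c' (j + 1)) ∧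
      (∀ j, L' (c' j) = L' z - 1 - j + 1) ∧ (∀ j, L' z ≤ j + 1 → c' j = b) ∧
      L z - 1 + (L' z - 1) < n ∧
      p.1.support =
        (List.range (L z - 1 + (L' z - 1) + 1)).map (joinChains (L z - 1) c c') ∧
      p.1.edges = (List.range (L z - 1 + (L' z - 1))).map
        (fun i => s(joinChains (L z - 1) c c' i, joinChains (L z - 1) c c' (i + 1))) ∧
      (∀ e ∈ p.1.edges, e ∉ usedEdges F) ∧
      ∀ v ∈ jammed d F, v ∈ p.1.support → v = a ∨ v = b ∨ ∃ w ∈ I v, s(v, w) ∈ p.1.edges := by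
  obtain ⟨c, c0, cP, cL, cR, ca⟩ := hT.exists_chain hz
  obtain ⟨c', c0', cP', cL', cR', ca'⟩ := hT'.exists_chain hz'
  have hinj := joinChains_injOn hmin hz hz' cL cL'
  set k := L z - 1 with hk
  set l := L' z - 1 with hl
  set f := joinChains k c c' with hf
  have hstep1 : ∀ i, i < k → AllowedStep d F I (f i) (f (i + 1)) := by
    intro i hi
    have h1 : f i = c (k - (i + 1) + 1) := by
      rw [hf, joinChains, if_pos hi.le]; congr 1; omega
    have h2 : f (i + 1) = c (k - (i + 1)) := by
      rw [hf, joinChains, if_pos (by omega)]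
    rw [h1, h2]
    exact cR _ (by omega)
  have hstep2 : ∀ i, k ≤ i → i < k + l → AllowedStep d F I (f (i + 1)) (f i) := by
    intro i hi hi'
    have h1 : f (i + 1) = c' (i - k + 1) := by
      rw [hf, joinChains, if_neg (by omega)]; congr 1; omega
    have h2 : f i = c' (i - k) := by
      rw [hf, joinChains]
      split_ifs with h
      · have : i = k := by omega
        subst this
        simp [c0, c0']
      · rfl
    rw [h1, h2]
    exact cR' _ (by omega)
  have hadj : ∀ i < k + l, G.Adj (f i) (f (i + 1)) ∧ s(f i, f (i + 1)) ∉ usedEdges F := by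
    intro i hi
    by_cases h : i < k
    · exact ⟨(hstep1 i h).1, (hstep1 i h).2.1⟩
    · have := hstep2 i (by omega) hi
      exact ⟨this.1.symm, by rw [Sym2.eq_swap]; exact this.2.1⟩
  have hf0 : f 0 = a := by
    rw [hf, joinChains, if_pos (Nat.zero_le _)]
    exact ca _ (by omega)
  have hfm : f (k + l) = b := by
    rw [hf, joinChains]
    split_ifs with h
    · have h1 : l = 0 := by omega
      have h2 := ca' 0 (by omega)
      rw [c0'] at h2
      rw [h1, add_zero, Nat.sub_self, c0, h2]
    · rw [Nat.add_sub_cancel_left]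
      exact ca' _ (by omega)
  obtain ⟨p, hp, hpe⟩ := SimpleGraph.exists_walk_of_adj f (k + l) fun i hi => (hadj i hi).1
  have hnodup : p.support.Nodup := by
    rw [hp]
    refine List.nodup_range.map_on fun i hi j hj h => hinj ?_ ?_ h
    · have := List.mem_range.mp hi
      change i ≤ k + l
      omega
    · have := List.mem_range.mp hj
      change j ≤ k + l
      omega
  have hlt : k + l < n := by
    have := hnodup.length_le_card
    rw [hp, List.length_map, List.length_range, Fintype.card_fin] at this
    omega
  refine ⟨c, c', ⟨p.copy hf0 hfm, ?_⟩, c0, cP, cL, ca, c0', cP', cL', ca', hlt, ?_, ?_, ?_, ?_⟩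
  · rw [SimpleGraph.Walk.isPath_copy]
    exact SimpleGraph.Walk.IsPath.mk' hnodup
  · simpa using hp
  · simpa using hpe
  · intro e he
    simp only [SimpleGraph.Walk.edges_copy, hpe, List.mem_map, List.mem_range] at he
    obtain ⟨i, hi, rfl⟩ := he
    exact (hadj i hi).2
  · intro v hv hvs
    simp only [SimpleGraph.Walk.support_copy, hp, List.mem_map, List.mem_range] at hvs
    obtain ⟨i, hi, rfl⟩ := hvs
    have hedge : ∀ j < k + l, s(f j, f (j + 1)) ∈ (p.copy hf0 hfm).edges := by
      intro j hj
      rw [SimpleGraph.Walk.edges_copy, hpe]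
      exact List.mem_map.mpr ⟨j, List.mem_range.mpr hj, rfl⟩
    rcases Nat.eq_zero_or_pos i with h0 | h0
    · exact Or.inl (by rw [h0, hf0])
    · rcases eq_or_ne i (k + l) with h1 | h1
      · exact Or.inr (Or.inl (by rw [h1, hfm]))
      · refine Or.inr (Or.inr ?_)
        by_cases h2 : i ≤ k
        · have h3 := hstep1 (i - 1) (by omega)
          have h4 := hedge (i - 1) (by omega)
          rw [Nat.sub_add_cancel h0] at h3 h4
          exact ⟨_, h3.2.2 hv, by rw [Sym2.eq_swap]; exact h4⟩
        · exact ⟨_, (hstep2 i (by omega) (by omega)).2.2 hv, hedge i (by omega)⟩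

end MeetingPath

/-! ### The routing program -/

/-- The entry of the adjacency matrix for the vertices in the variables `x` and `y`. -/
def LoopExpr.adj (x y : ℕ) : LoopExpr :=
  .input (.add (.lit 2) (.add (.mul (.var x) .size) (.var y)))

/-- The degree of the graph. -/
def LoopExpr.deg : LoopExpr := .input (.lit 1)

/-- The `j`-th word of the current request. -/
def LoopExpr.request (j : ℕ) : LoopExpr := .input (.add (.lit (2 + j)) (.mul .size .size))

/-- `1` if the value of `e` is `0`, and `0` otherwise. -/
def LoopExpr.isZero (e : LoopExpr) : LoopExpr := .sub (.lit 1) e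

/-- `1` if the values of `e` and `f` are equal, and `0` otherwise. -/
def LoopExpr.isEq (e f : LoopExpr) : LoopExpr := isZero (.add (.sub e f) (.sub f e))

/-- Run `p` if `e` is positive. -/
def LoopProg.when (e : LoopExpr) (p : LoopProg) : LoopProg := .ite e p .skip

/-- Set the variable `x` to the sum of the values of `e` for `0, …, n - 1` in the variable `9`. -/
def LoopProg.sum (x : ℕ) (e : LoopExpr) : LoopProg :=
  .seq (.set x (.lit 0)) (.loop 9 (.set x (.add (.var x) e)))

namespace Router

open LoopExpr LoopProg

/-!
The arrays of the routing program are

* `0`: the pairs of vertices that are joined by a used edge,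
* `1`: the entry sets, where row `v` is the indicator of the set `I v`,
* `2`: the jammed vertices before the current request,
* `3`: the jammed vertices after the current request,
* `4`: the vertices that have become jammed and have no entry set yet,
* `5`, `6` and `7`, `8`: the levels and parents of the search trees from the two given vertices,
* `9`: the vertices of a path.

The variables are `0`, `1` (the given vertices), `2` (their meeting point), `3` (whether some
meeting point is known), `4` (the number of vertices of the path), `5` (whether its edges become used),
`6` (the kind of the request), and `7` to `15` (auxiliary).
-/

/-- One step of the closure: add the vertex in the variable `8` if it has to be jammed. With
truncated subtraction, the tests `d ≤ 20 * x` and `d < 50 * y` are `0 < 20 * x + 1 - d` and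
`0 < 50 * y - d`. -/
def closureStep : LoopProg :=
  .seq (.sum 10 (.mul (.cell 3 9 9) (adj 8 9))) <| .seq (.sum 11 (.cell 0 8 9)) <|
    .when (.add (.sub (.add (.mul (.lit 20) (.var 11)) (.lit 1)) deg)
      (.sub (.mul (.lit 50) (.var 10)) deg)) (.put 3 8 8 (.lit 1))

/-- Compute the jammed vertices. -/
def closure : LoopProg :=
  .seq (.loop 8 (.put 3 8 8 (.lit 0))) (.loop 7 (.loop 8 closureStep))

/-- One step of the computation of entry sets: if the vertex in the variable `8` has few
neighbours without entry set that become jammed, then choose its entry set. -/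
def entryStep : LoopProg :=
  .seq (.sum 10 (.mul (.cell 4 9 9) (adj 8 9))) <|
    .when (.mul (.cell 4 8 8) (.sub (.add deg (.lit 1)) (.mul (.lit 50) (.var 10)))) <|
      .seq (.loop 9 (.put 1 8 9 (.mul (adj 8 9) (.add (.cell 2 9 9) (.cell 4 9 9)))))
        (.put 4 8 8 (.lit 0))

/-- Compute entry sets for the vertices that become jammed. -/
def entrySets : LoopProg :=
  .seq (.loop 8 (.put 4 8 8 (.mul (.cell 3 8 8) (isZero (.cell 2 8 8)))))
    (.loop 7 (.loop 8 entryStep))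

/-- Whether a path may go from the vertex in the variable `8` to the one in the variable `9`. -/
def allowed : LoopExpr :=
  .mul (adj 8 9) (.mul (isZero (.cell 0 8 9)) (isZero (.mul (.cell 2 9 9) (isZero (.cell 1 9 8)))))

/-- One step of the breadth-first search with the arrays `L` and `P`: if the vertex in the
variable `8` has the level that is treated in this round, and the one in the variable `9` is new and
may be reached from it, then the latter becomes its child. No level above `n` is assigned, as stored
values are truncated at `n`. -/
def searchStep (L P : ℕ) : LoopProg :=
  .when (.mul (isEq (.cell L 8 8) (.add (.var 7) (.lit 1))) <| .mul allowed <|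
      .mul (isZero (.cell L 9 9)) (.sub .size (.add (.var 7) (.lit 1)))) <|
    .seq (.put L 9 9 (.add (.var 7) (.lit 2))) (.put P 9 9 (.var 8))

/-- Breadth-first search from the vertex in the variable `s`. -/
def search (s L P : ℕ) : LoopProg :=
  .seq (.loop 8 (.put L 8 8 (.lit 0))) <| .seq (.put L s s (.lit 1)) <|
    .seq (.put P s s (.var s)) (.loop 7 (.loop 8 (.loop 9 (searchStep L P))))

/-- Find a vertex with the least sum of levels. -/
def meet : LoopProg :=
  .seq (.set 3 (.lit 0)) <| .loop 8 <| .when (.mul (.cell 5 8 8) (.cell 7 8 8)) <|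
    .ite (.var 3)
      (.when (.sub (.add (.cell 5 2 2) (.cell 7 2 2)) (.add (.cell 5 8 8) (.cell 7 8 8)))
        (.set 2 (.var 8)))
      (.seq (.set 2 (.var 8)) (.set 3 (.lit 1)))

/-- Write the path through the meeting point into the array `9`. -/
def trace : LoopProg :=
  .seq (.set 10 (.var 2)) <|
  .seq (.loop 7 (.seq (.set 14 (.sub (.cell 5 10 10) (.lit 1)))
    (.seq (.put 9 14 14 (.var 10)) (.set 10 (.cell 6 10 10))))) <|
  .seq (.set 10 (.var 2)) <|
  .seq (.loop 7 (.seq (.set 14 (.add (.sub (.cell 5 2 2) (.lit 1))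
      (.sub (.cell 7 2 2) (.cell 7 10 10))))
    (.seq (.put 9 14 14 (.var 10)) (.set 10 (.cell 8 10 10))))) <|
  .set 4 (.sub (.add (.cell 5 2 2) (.cell 7 2 2)) (.lit 1))

/-- Output the path in the array `9`. -/
def output : LoopProg := .loop 7 (.when (.sub (.var 4) (.var 7)) (.out (.cell 9 7 7)))

/-- Mark the edges of the path in the array `9` as used or unused. -/
def mark : LoopProg :=
  .loop 7 <| .seq (.set 15 (.add (.var 7) (.lit 1))) <| .when (.sub (.var 4) (.var 15)) <|
    .seq (.set 12 (.cell 9 7 7)) <| .seq (.set 13 (.cell 9 15 15)) <|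
      .seq (.put 0 12 13 (.var 5)) (.put 0 13 12 (.var 5))

/-- Find and output a path between the two given vertices. -/
def findPath : LoopProg :=
  .seq (.set 0 (request 1)) <| .seq (.set 1 (request 2)) <| .seq (search 0 5 6) <|
    .seq (search 1 7 8) <| .seq meet <| .seq trace <| .seq output (.set 5 (.lit 1))

/-- Read the path that is to be removed. -/
def readPath : LoopProg :=
  .seq (.loop 7 (.put 9 7 7 (.input (.add (.add (.lit 4) (.mul .size .size)) (.var 7))))) <|
    .seq (.set 4 (request 1)) (.set 5 (.lit 0))

/-- Answer a request. -/
def main : LoopProg :=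
  .seq (.set 6 (request 0)) <| .seq (.ite (.var 6) readPath findPath) <| .seq mark <|
    .seq closure <| .seq entrySets (.loop 8 (.put 2 8 8 (.cell 3 8 8)))

end Router

/-! ### Sets and relations encoded in arrays -/

section Correctness

open LoopExpr LoopProg

variable {n d : ℕ} {G : SimpleGraph (Fin n)} [DecidableRel G.Adj] {inp : List ℕ}

/-- The input starts with a description of the graph. -/
structure InputDescribes (d : ℕ) (G : SimpleGraph (Fin n)) [DecidableRel G.Adj] (inp : List ℕ) :
    Prop where
  size : inp.getD 0 0 = n
  degree : inp.getD 1 0 = d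
  adj : ∀ v w : Fin n, inp.getD (2 + (v * n + w)) 0 = if G.Adj v w then 1 else 0

/-- The diagonal of the array `a` is the indicator of the set `X`. -/
def Encodes (m : ℕ → ℕ → ℕ → ℕ) (a : ℕ) (X : Finset (Fin n)) : Prop :=
  ∀ v : Fin n, m a v v = if v ∈ X then 1 else 0

/-- The array `a` is the indicator of the relation `R`. -/
def EncodesRel (m : ℕ → ℕ → ℕ → ℕ) (a : ℕ) (R : Fin n → Fin n → Prop) : Prop :=
  ∀ v w : Fin n, (R v w → m a v w = 1) ∧ (¬ R v w → m a v w = 0)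

lemma LoopExpr.eval_adj (hin : InputDescribes d G inp) {τ : LoopState} {x y : ℕ} {v w : Fin n}
    (hx : τ.v x = v) (hy : τ.v y = w) :
    (adj x y).eval n inp τ = if G.Adj v w then 1 else 0 := by
  simp only [LoopExpr.adj, eval, hx, hy]
  exact hin.adj v w

lemma LoopExpr.eval_deg (hin : InputDescribes d G inp) (τ : LoopState) :
    deg.eval n inp τ = d := hin.degree

lemma LoopProg.run_when (e : LoopExpr) (p : LoopProg) (τ : LoopState) :
    (LoopProg.when e p).run n inp τ = if 0 < e.eval n inp τ then p.run n inp τ else τ := rfl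

lemma LoopProg.run_seq (p q : LoopProg) (τ : LoopState) :
    (LoopProg.seq p q).run n inp τ = q.run n inp (p.run n inp τ) := rfl

lemma LoopProg.run_ite (e : LoopExpr) (p q : LoopProg) (τ : LoopState) :
    (LoopProg.ite e p q).run n inp τ =
      if 0 < e.eval n inp τ then p.run n inp τ else q.run n inp τ := rfl

lemma LoopProg.run_set (x : ℕ) (e : LoopExpr) (τ : LoopState) :
    (LoopProg.set x e).run n inp τ = τ.setV x (min (e.eval n inp τ) n) := rfl

lemma LoopProg.run_put (a x y : ℕ) (e : LoopExpr) (τ : LoopState) :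
    (LoopProg.put a x y e).run n inp τ =
      τ.setM a (τ.v x) (τ.v y) (min (e.eval n inp τ) n) := rfl

lemma LoopProg.run_out (e : LoopExpr) (τ : LoopState) :
    (LoopProg.out e).run n inp τ = τ.app (e.eval n inp τ) := rfl

lemma filter_val_lt_succ (i : Fin n) :
    (Finset.univ.filter fun w : Fin n => (w : ℕ) < i + 1) =
      insert i (Finset.univ.filter fun w : Fin n => (w : ℕ) < i) := by
  ext w
  simp only [Finset.mem_filter_univ, Finset.mem_insert, Fin.ext_iff]
  omega

lemma LoopProg.run_sum {τ : LoopState} {x : ℕ} {e : LoopExpr} (hx : x ≠ 9) (g : Fin n → ℕ)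
    (hg : ∀ w, g w ≤ 1) (he : ∀ (τ' : LoopState) (w : Fin n), τ'.m = τ.m →
      (∀ y, y ≠ x → y ≠ 9 → τ'.v y = τ.v y) → τ'.v 9 = w → e.eval n inp τ' = g w) :
    ((LoopProg.sum x e).run n inp τ).v x = ∑ w, g w ∧
      (∀ y, y ≠ x → y ≠ 9 → ((LoopProg.sum x e).run n inp τ).v y = τ.v y) ∧
      ((LoopProg.sum x e).run n inp τ).m = τ.m := by
  have hmain := run_loop (n := n) (inp := inp) (x := 9) (p := .set x (.add (.var x) e))
    (σ := (LoopProg.set x (.lit 0)).run n inp τ)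
    (fun i σ => σ.v x = ∑ w ∈ Finset.univ.filter fun w : Fin n => (w : ℕ) < i, g w ∧
      (∀ y, y ≠ x → y ≠ 9 → σ.v y = τ.v y) ∧ σ.m = τ.m)
    ⟨by simp [run_set, eval], fun y hy _ => by simp [run_set, hy], rfl⟩ ?_
  · have huniv : (Finset.univ.filter fun w : Fin n => (w : ℕ) < n) = Finset.univ := by
      ext w; simp
    rw [huniv] at hmain
    exact hmain
  · rintro i σ ⟨h1, h2, h3⟩
    have h4 : e.eval n inp (σ.setV 9 i) = g i :=
      he _ i h3 (fun y hy hy9 => by simp [hy9, h2 y hy hy9]) (by simp)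
    refine ⟨?_, fun y hy hy9 => ?_, h3⟩
    · rw [run_set, LoopState.setV_v, if_pos rfl, eval, h4, eval, LoopState.setV_v, if_neg hx, h1,
        filter_val_lt_succ, Finset.sum_insert (by simp), add_comm (g i)]
      refine min_eq_left ?_
      have hle : ∑ w ∈ Finset.univ.filter (fun w : Fin n => (w : ℕ) < i), g w ≤ i := by
        refine (Finset.sum_le_card_nsmul _ _ 1 fun w _ => hg w).trans ?_
        rw [smul_eq_mul, mul_one]
        exact (Finset.card_le_card_of_injOn
          (s := Finset.univ.filter fun w : Fin n => (w : ℕ) < i) (t := Finset.range i)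
          (fun w => (w : ℕ)) (fun w hw => by simpa using hw)
          (fun w _ w' _ h => Fin.ext h)).trans (by simp)
      have := hg i
      have := i.2
      omega
    · rw [run_set, LoopState.setV_v, if_neg hy, LoopState.setV_v, if_neg hy9, h2 y hy hy9]

lemma Encodes.update {m : ℕ → ℕ → ℕ → ℕ} {a : ℕ} {X : Finset (Fin n)} (h : Encodes m a X)
    {m' : ℕ → ℕ → ℕ → ℕ} {u : Fin n} {c : ℕ}
    (hm : ∀ v : Fin n, m' a v v = if v = u then c else m a v v) {X' : Finset (Fin n)}
    (hc : c = if u ∈ X' then 1 else 0) (hX : ∀ v, v ≠ u → (v ∈ X' ↔ v ∈ X)) :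
    Encodes m' a X' := by
  intro v
  rw [hm]
  split_ifs with h1 h2 h2
  · subst h1; rw [hc, if_pos h2]
  · subst h1; rw [hc, if_neg h2]
  · rw [h v, if_pos ((hX v h1).mp h2)]
  · rw [h v, if_neg fun h3 => h2 ((hX v h1).mpr h3)]

/-- A loop that writes the diagonal of an array. -/
lemma LoopProg.run_loop_put_diag {τ : LoopState} {a : ℕ} {e : LoopExpr} (X : Finset (Fin n))
    (he : ∀ (τ' : LoopState) (v : Fin n), (∀ a', a' ≠ a → τ'.m a' = τ.m a') →
      τ'.v 8 = v → e.eval n inp τ' = if v ∈ X then 1 else 0) :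
    Encodes ((LoopProg.loop 8 (.put a 8 8 e)).run n inp τ).m a X := by
  have hmain := run_loop (n := n) (inp := inp) (x := 8) (p := .put a 8 8 e) (σ := τ)
    (fun i σ => (∀ a', a' ≠ a → σ.m a' = τ.m a') ∧
      ∀ v : Fin n, (v : ℕ) < i → σ.m a v v = if v ∈ X then 1 else 0)
    ⟨fun _ _ => rfl, fun v hv => by omega⟩ ?_
  · exact fun v => hmain.2 v v.2
  · rintro i σ ⟨h1, h2⟩
    have hv : e.eval n inp (σ.setV 8 i) = if i ∈ X then 1 else 0 := he _ i h1 (by simp)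
    refine ⟨fun a' ha' => ?_, fun v hv' => ?_⟩
    · funext j k
      simp [run_put, LoopState.setM_m, ha', h1 a' ha']
    · have hn : 1 ≤ n := i.pos
      simp only [run_put, LoopState.setM_m, LoopState.setV_v, if_true, true_and, hv,
        LoopState.setV_m, and_self]
      by_cases hvi : (v : ℕ) = i
      · rw [if_pos hvi, Fin.ext hvi]
        split_ifs <;> omega
      · rw [if_neg hvi]
        exact h2 v (by omega)

lemma LoopProg.run_sum_degIn (hin : InputDescribes d G inp) {τ : LoopState} {a : ℕ}
    {v : Fin n} {X : Finset (Fin n)} (hv : τ.v 8 = v) (hX : Encodes τ.m a X) :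
    ((LoopProg.sum 10 (.mul (.cell a 9 9) (adj 8 9))).run n inp τ).v 10 = degIn G X v ∧
      (∀ y, y ≠ 10 → y ≠ 9 →
        ((LoopProg.sum 10 (.mul (.cell a 9 9) (adj 8 9))).run n inp τ).v y = τ.v y) ∧
      ((LoopProg.sum 10 (.mul (.cell a 9 9) (adj 8 9))).run n inp τ).m = τ.m := by
  have h := run_sum (n := n) (inp := inp) (τ := τ) (x := 10)
    (e := .mul (.cell a 9 9) (adj 8 9)) (by norm_num)
    (fun w => if w ∈ X ∧ G.Adj v w then 1 else 0) (fun w => by split_ifs <;> omega) (by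
      intro τ' w h1 h2 h3
      rw [eval, eval_adj hin ((h2 8 (by norm_num) (by norm_num)).trans hv) h3, eval, h1, h3, hX w]
      by_cases ha : w ∈ X <;> by_cases hb : G.Adj v w <;> simp [ha, hb])
  rwa [← Finset.card_filter, show (Finset.univ.filter fun w => w ∈ X ∧ G.Adj v w) =
    X.filter (G.Adj v) by ext w; simp] at h

/-! ### The program for jammed vertices and entry sets -/

section Closure

variable {F : Multiset (RoutedPath G)}

lemma run_closureStep (hin : InputDescribes d G inp) (hF : (usedEdges F).Nodup) {τ : LoopState}
    {v : Fin n} {X : Finset (Fin n)} (hv : τ.v 8 = v) (hX : Encodes τ.m 3 X)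
    (hU : EncodesRel τ.m 0 fun v w => s(v, w) ∈ usedEdges F) :
    Encodes (Router.closureStep.run n inp τ).m 3
      (if d ≤ 20 * usedDegree F v ∨ d < 50 * degIn G X v then insert v X else X) := by
  classical
  have hn : 1 ≤ n := v.pos
  obtain ⟨c1, c2, c3⟩ := run_sum_degIn hin hv hX
  set τ₁ := (LoopProg.sum 10 (.mul (.cell 3 9 9) (adj 8 9))).run n inp τ with hτ₁
  obtain ⟨d1, d2, d3⟩ := run_sum (n := n) (inp := inp) (τ := τ₁) (x := 11)
    (e := .cell 0 8 9) (by norm_num)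
    (fun w => if s(v, w) ∈ usedEdges F then 1 else 0) (fun w => by split_ifs <;> omega) (by
      intro τ' w h1 h2 h3
      rw [eval, h1, h2 8 (by norm_num) (by norm_num), c2 8 (by norm_num) (by norm_num), h3, hv, c3]
      split_ifs with h
      exacts [(hU v w).1 h, (hU v w).2 h])
  set τ₂ := (LoopProg.sum 11 (.cell 0 8 9)).run n inp τ₁ with hτ₂
  have e1 : τ₂.v 10 = degIn G X v := by
    rw [d2 10 (by norm_num) (by norm_num), c1]
  have e2 : τ₂.v 11 = usedDegree F v := by
    rw [d1, usedDegree_eq_card hF, Finset.card_filter]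
  have e3 : τ₂.m = τ.m := d3.trans c3
  have e4 : τ₂.v 8 = v := by
    rw [d2 8 (by norm_num) (by norm_num), c2 8 (by norm_num) (by norm_num), hv]
  have hrun : Router.closureStep.run n inp τ =
      (LoopProg.when (.add (.sub (.add (.mul (.lit 20) (.var 11)) (.lit 1)) deg)
      (.sub (.mul (.lit 50) (.var 10)) deg)) (.put 3 8 8 (.lit 1))).run n inp τ₂ := rfl
  rw [hrun, run_when]
  simp only [eval, eval_deg hin, e1, e2]
  by_cases hcond : d ≤ 20 * usedDegree F v ∨ d < 50 * degIn G X v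
  · rw [if_pos (by omega), if_pos hcond, run_put, e4]
    refine hX.update (u := v) (c := 1) (fun w => ?_) (by simp) (fun w hw => by simp [hw])
    rw [LoopState.setM_m, e3]
    simp only [true_and, and_self, ← Fin.ext_iff, eval]
    rw [min_eq_left hn]
  · rw [if_neg (by omega), if_neg hcond]
    rwa [e3]

end Closure

end Correctness

section Jam

open LoopExpr LoopProg

variable {n d : ℕ} {G : SimpleGraph (Fin n)} [DecidableRel G.Adj] {inp : List ℕ}
  {F : Multiset (RoutedPath G)}

/-- The rounds of the closure compute the jammed vertices. -/
lemma run_closure (hin : InputDescribes d G inp) (hF : (usedEdges F).Nodup) {τ : LoopState}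
    (hU : EncodesRel τ.m 0 fun v w => s(v, w) ∈ usedEdges F) :
    Encodes (Router.closure.run n inp τ).m 3 (jammed d F) := by
  classical
  set S : Finset (Fin n) := Finset.univ.filter fun v => d ≤ 20 * usedDegree F v with hS
  set J := jammed d F with hJ
  have hSJ : S ⊆ J := subset_jamClosure S
  have hcl : IsJamClosed d G J := isJamClosed_jamClosure S
  have hframe : ∀ (x : ℕ) (σ : LoopState),
      EncodesRel σ.m 0 (fun v w => s(v, w) ∈ usedEdges F) →
      EncodesRel (Router.closureStep.run n inp (σ.setV 8 x)).m 0
        (fun v w => s(v, w) ∈ usedEdges F) := by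
    intro x σ h
    unfold EncodesRel
    rw [run_m (by decide)]
    exact h
  -- Every round adds a vertex until the closure is reached, so that `n` rounds suffice.
  have hmain := run_loop (n := n) (inp := inp) (x := 7) (p := .loop 8 Router.closureStep)
    (σ := (LoopProg.loop 8 (.put 3 8 8 (.lit 0))).run n inp τ)
    (fun i σ => EncodesRel σ.m 0 (fun v w => s(v, w) ∈ usedEdges F) ∧
      ∃ X, X ⊆ J ∧ Encodes σ.m 3 X ∧ (i ≤ X.card ∨ J ⊆ X)) ⟨?_, ∅, ?_, ?_, ?_⟩ ?_
  · obtain ⟨-, X, hXJ, hX, hi⟩ := hmain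
    have hJX : J ⊆ X := by
      rcases hi with hi | hi
      · have : X = Finset.univ := by
          rw [← Finset.card_eq_iff_eq_univ, Fintype.card_fin]
          exact le_antisymm (by simpa using Finset.card_le_univ X) hi
        rw [this]; exact Finset.subset_univ J
      · exact hi
    rw [hXJ.antisymm hJX] at hX
    exact hX
  · unfold EncodesRel
    rw [run_m (by decide)]
    exact hU
  · exact Finset.empty_subset J
  · exact run_loop_put_diag ∅ fun τ' v _ _ => by simp [eval]
  · exact Or.inl (Nat.zero_le _)
  · rintro i σ ⟨hUσ, X, hXJ, hX, hi⟩
    have hround := run_loop (n := n) (inp := inp) (x := 8) (p := Router.closureStep)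
      (σ := σ.setV 7 i)
      (fun j σ => EncodesRel σ.m 0 (fun v w => s(v, w) ∈ usedEdges F) ∧
        ∃ Y, X ⊆ Y ∧ Y ⊆ J ∧ Encodes σ.m 3 Y ∧ ∀ v : Fin n, (v : ℕ) < j →
          (v ∈ S ∨ d < 50 * degIn G X v) → v ∈ Y)
      ⟨hUσ, X, subset_rfl, hXJ, hX, fun v hv => by omega⟩ ?_
    · obtain ⟨hU', Y, hXY, hYJ, hY, hnew⟩ := hround
      refine ⟨hU', Y, hYJ, hY, ?_⟩
      by_cases hJX : J ⊆ X
      · exact Or.inr (hJX.trans hXY)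
      · left
        have hne : X ≠ Y := by
          rintro rfl
          refine hJX (jamClosure_subset (fun v hv => hnew v v.2 (Or.inl hv)) fun v hv =>
            hnew v v.2 (Or.inr hv))
        have h1 := Finset.card_lt_card (hXY.ssubset_of_ne hne)
        have h2 := hi.resolve_right hJX
        omega
    · rintro v ρ ⟨hUρ, Y, hXY, hYJ, hY, hnew⟩
      have hstep := run_closureStep hin hF (τ := ρ.setV 8 v) (v := v) (by simp) hY hUρ
      refine ⟨hframe _ _ hUρ, _, ?_, ?_, hstep, ?_⟩
      · split_ifs
        · exact hXY.trans (Finset.subset_insert _ _)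
        · exact hXY
      · split_ifs with hc
        · refine Finset.insert_subset ?_ hYJ
          rcases hc with hc | hc
          · exact hSJ ((Finset.mem_filter_univ v).mpr hc)
          · exact hcl v (hc.trans_le (Nat.mul_le_mul_left 50 (degIn_mono hYJ v)))
        · exact hYJ
      · intro w hw hcw
        by_cases hwv : w = v
        · subst hwv
          rw [if_pos]
          · exact Finset.mem_insert_self _ _
          · rcases hcw with hcw | hcw
            · exact Or.inl ((Finset.mem_filter_univ w).mp hcw)
            · exact Or.inr (hcw.trans_le (Nat.mul_le_mul_left 50 (degIn_mono hXY w)))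
        · have hwY := hnew w (by have := Fin.val_ne_of_ne hwv; omega) hcw
          split_ifs
          · exact Finset.mem_insert_of_mem hwY
          · exact hwY

/-- The entry sets that are chosen for the vertices of `T`, of which those of `X` still have to be
treated; `B` is the set of the vertices that were jammed before. -/
structure EntryState (d : ℕ) (G : SimpleGraph (Fin n)) [DecidableRel G.Adj]
    (B T X : Finset (Fin n)) (I I' : Fin n → Finset (Fin n)) : Prop where
  subset : X ⊆ T
  old : ∀ v, v ∉ T → I' v = I v
  few : ∀ v ∈ T, v ∉ X → ∃ Y, 50 * degIn G Y v ≤ d ∧ I' v = (B ∪ Y).filter (G.Adj v)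
  adj : ∀ v ∈ T, v ∉ X → ∀ w ∈ B ∪ X, G.Adj v w → w ∈ I' v
  adj' : ∀ v ∈ T, v ∉ X → ∀ w ∈ T, w ∉ X → G.Adj v w → v ∈ I' w ∨ w ∈ I' v

lemma EntryState.erase {B T X : Finset (Fin n)} {I I' : Fin n → Finset (Fin n)}
    (h : EntryState d G B T X I I') {u : Fin n} (hu : u ∈ X) (hd : 50 * degIn G X u ≤ d) :
    EntryState d G B T (X.erase u) I
      (Function.update I' u ((B ∪ X).filter (G.Adj u))) := by
  have hself : Function.update I' u ((B ∪ X).filter (G.Adj u)) u = (B ∪ X).filter (G.Adj u) :=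
    Function.update_self ..
  have hne : ∀ v, v ≠ u → Function.update I' u ((B ∪ X).filter (G.Adj u)) v = I' v :=
    fun v hv => Function.update_of_ne hv ..
  have hX : ∀ v, v ∉ X.erase u → v ≠ u → v ∉ X := fun v hv hvu hvX =>
    hv (Finset.mem_erase.mpr ⟨hvu, hvX⟩)
  refine ⟨(Finset.erase_subset _ _).trans h.subset, fun v hv => ?_, fun v hv hvX => ?_,
    fun v hv hvX w hw hvw => ?_, fun v hv hvX w hw hwX hvw => ?_⟩
  · rw [hne v fun h' => hv (h' ▸ h.subset hu), h.old v hv]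
  · by_cases hvu : v = u
    · subst hvu
      exact ⟨X, hd, hself⟩
    · rw [hne v hvu]
      exact h.few v hv (hX v hvX hvu)
  · have hw' : w ∈ B ∪ X := Finset.union_subset_union_right (Finset.erase_subset _ _) hw
    by_cases hvu : v = u
    · subst hvu
      rw [hself, Finset.mem_filter]
      exact ⟨hw', hvw⟩
    · rw [hne v hvu]
      exact h.adj v hv (hX v hvX hvu) w hw' hvw
  · by_cases hvu : v = u
    · subst hvu
      have hwv : w ≠ v := hvw.ne'
      left
      rw [hne w hwv]
      exact h.adj w hw (hX w hwX hwv) v (Finset.mem_union_right _ hu) hvw.symm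
    · by_cases hwu : w = u
      · subst hwu
        right
        rw [hne v hvu]
        exact h.adj v hv (hX v hvX hvu) w (Finset.mem_union_right _ hu) hvw
      · rw [hne v hvu, hne w hwu]
        exact h.adj' v hv (hX v hvX hvu) w hw (hX w hwX hwu) hvw

lemma run_entryStep (hin : InputDescribes d G inp) {τ : LoopState} {v : Fin n}
    {B X : Finset (Fin n)} {I : Fin n → Finset (Fin n)} (hBX : Disjoint B X) (hv : τ.v 8 = v)
    (hB : Encodes τ.m 2 B) (hX : Encodes τ.m 4 X) (hI : EncodesRel τ.m 1 fun v w => w ∈ I v) :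
    if v ∈ X ∧ 50 * degIn G X v ≤ d then
      Encodes (Router.entryStep.run n inp τ).m 4 (X.erase v) ∧
        EncodesRel (Router.entryStep.run n inp τ).m 1
          fun u w => w ∈ Function.update I v ((B ∪ X).filter (G.Adj v)) u
    else Encodes (Router.entryStep.run n inp τ).m 4 X ∧
      EncodesRel (Router.entryStep.run n inp τ).m 1 fun v w => w ∈ I v := by
  have hn : 1 ≤ n := v.pos
  obtain ⟨c1, c2, c3⟩ := run_sum_degIn hin hv hX
  set τ₁ := (LoopProg.sum 10 (.mul (.cell 4 9 9) (adj 8 9))).run n inp τ with hτ₁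
  have e4 : τ₁.v 8 = v := by rw [c2 8 (by norm_num) (by norm_num), hv]
  have hrun : Router.entryStep.run n inp τ =
      (LoopProg.when (.mul (.cell 4 8 8) (.sub (.add deg (.lit 1)) (.mul (.lit 50) (.var 10)))) <|
      .seq (.loop 9 (.put 1 8 9 (.mul (adj 8 9) (.add (.cell 2 9 9) (.cell 4 9 9)))))
        (.put 4 8 8 (.lit 0))).run n inp τ₁ := rfl
  rw [hrun, run_when]
  have hval : (LoopExpr.mul (.cell 4 8 8)
      (.sub (.add deg (.lit 1)) (.mul (.lit 50) (.var 10)))).eval n inp τ₁ =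
      (if v ∈ X then 1 else 0) * (d + 1 - 50 * degIn G X v) := by
    simp only [eval, eval_deg hin, c1, e4, c3, hX v]
  rw [hval]
  by_cases hc : v ∈ X ∧ 50 * degIn G X v ≤ d
  · rw [if_pos hc, if_pos (by rw [if_pos hc.1]; omega), run_seq]
    have hloop := run_loop (n := n) (inp := inp) (x := 9)
      (p := .put 1 8 9 (.mul (adj 8 9) (.add (.cell 2 9 9) (.cell 4 9 9)))) (σ := τ₁)
      (fun i σ => σ.v 8 = v ∧ (∀ a, a ≠ 1 → σ.m a = τ.m a) ∧ ∀ u w : Fin n, σ.m 1 u w =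
        if u = v ∧ (w : ℕ) < i then (if w ∈ (B ∪ X).filter (G.Adj v) then 1 else 0)
        else τ.m 1 u w)
      ⟨e4, fun a _ => by rw [c3], fun u w => by rw [c3]; simp⟩ ?_
    · obtain ⟨f1, f2, f3⟩ := hloop
      set τ₂ := (LoopProg.loop 9
        (.put 1 8 9 (.mul (adj 8 9) (.add (.cell 2 9 9) (.cell 4 9 9))))).run n inp τ₁
      constructor
      · refine hX.update (u := v) (c := 0) (fun w => ?_) (by simp) (fun w hw => by simp [hw])
        rw [run_put, LoopState.setM_m, f1, f2 4 (by norm_num)]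
        simp only [true_and, and_self, ← Fin.ext_iff, eval, Nat.zero_min]
      · intro u w
        rw [run_put, LoopState.setM_m, if_neg (by norm_num), f3]
        by_cases huv : u = v
        · subst huv
          simp only [true_and, w.2, if_true, Function.update_self]
          constructor
          · intro h; rw [if_pos h]
          · intro h; rw [if_neg h]
        · simp only [huv, false_and, if_false]
          rw [Function.update_of_ne huv]
          exact hI u w
    · rintro i σ ⟨g1, g2, g3⟩
      refine ⟨by simp [run_put, g1], fun a ha => ?_, fun u w => ?_⟩
      · funext j k
        simp [run_put, LoopState.setM_m, ha, g2 a ha]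
      · have hv8 : (σ.setV 9 i).v 8 = v := by simp [g1]
        have hv9 : (σ.setV 9 i).v 9 = i := by simp
        have hev : (LoopExpr.mul (adj 8 9) (.add (.cell 2 9 9) (.cell 4 9 9))).eval n inp
            (σ.setV 9 i) = if i ∈ (B ∪ X).filter (G.Adj v) then 1 else 0 := by
          simp only [eval, eval_adj hin hv8 hv9, hv9, LoopState.setV_m, g2 2 (by norm_num),
            g2 4 (by norm_num), hB i, hX i, Finset.mem_filter, Finset.mem_union]
          have hdis : ¬ (i ∈ B ∧ i ∈ X) := fun h => (Finset.disjoint_left.mp hBX) h.1 h.2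
          by_cases h1 : i ∈ B <;> by_cases h2 : i ∈ X <;> by_cases h3 : G.Adj v i <;>
            simp_all
        rw [run_put, LoopState.setM_m, hev, hv8, hv9, LoopState.setV_m, g3]
        have hmin : min (if i ∈ (B ∪ X).filter (G.Adj v) then 1 else 0) n =
            if i ∈ (B ∪ X).filter (G.Adj v) then 1 else 0 := by split_ifs <;> omega
        rw [hmin]
        by_cases huv : u = v
        · subst huv
          by_cases hwi : w = i
          · subst hwi; simp
          · have : ((w : ℕ) < i + 1) ↔ (w : ℕ) < i := by
              have := Fin.val_ne_of_ne hwi; omega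
            simp only [Fin.val_ne_of_ne hwi, and_false, if_false, this]
        · simp [huv, Fin.val_ne_of_ne huv]
  · rw [if_neg hc, if_neg, c3]
    · exact ⟨hX, hI⟩
    · by_cases h1 : v ∈ X
      · have : d < 50 * degIn G X v := by by_contra! h; exact hc ⟨h1, h⟩
        rw [if_pos h1]; omega
      · rw [if_neg h1]; omega

/-- If all nonempty subsets of the set `J \ B` of the vertices that become jammed have vertices of
low degree, then all these vertices get entry sets. -/
lemma run_entrySets (hin : InputDescribes d G inp) {τ : LoopState} {B J : Finset (Fin n)}
    {I : Fin n → Finset (Fin n)} (hB : Encodes τ.m 2 B) (hJ : Encodes τ.m 3 J)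
    (hI : EncodesRel τ.m 1 fun v w => w ∈ I v)
    (hlow : ∀ X ⊆ J \ B, X.Nonempty → ∃ v ∈ X, 50 * degIn G X v ≤ d) :
    ∃ I', EncodesRel (Router.entrySets.run n inp τ).m 1 (fun v w => w ∈ I' v) ∧
      EntryState d G B (J \ B) ∅ I I' := by
  have hframe : ∀ (x : ℕ) (σ : LoopState), Encodes σ.m 2 B →
      Encodes (Router.entryStep.run n inp (σ.setV 8 x)).m 2 B := by
    intro x σ h
    unfold Encodes
    rw [run_m (by decide)]
    exact h
  -- Every round treats some vertex of the set `X` of those that remain, so that `n` rounds suffice.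
  have hmain := run_loop (n := n) (inp := inp) (x := 7) (p := .loop 8 Router.entryStep)
    (σ := (LoopProg.loop 8 (.put 4 8 8 (.mul (.cell 3 8 8) (isZero (.cell 2 8 8))))).run n inp τ)
    (fun i σ => Encodes σ.m 2 B ∧ ∃ X I', Encodes σ.m 4 X ∧
      EncodesRel σ.m 1 (fun v w => w ∈ I' v) ∧ EntryState d G B (J \ B) X I I' ∧
      (X.card + i ≤ n ∨ X = ∅)) ⟨?_, J \ B, I, ?_, ?_, ?_, ?_⟩ ?_
  · obtain ⟨-, X, I', -, hI', hE, hX⟩ := hmain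
    have : X = ∅ := hX.elim (fun h => Finset.card_eq_zero.mp (by omega)) id
    rw [this] at hE
    exact ⟨I', hI', hE⟩
  · unfold Encodes
    rw [run_m (by decide)]
    exact hB
  · refine run_loop_put_diag (J \ B) fun τ' v h1 h2 => ?_
    simp only [eval, isZero, h2, h1 3 (by norm_num), h1 2 (by norm_num), hB v, hJ v,
      Finset.mem_sdiff]
    by_cases ha : v ∈ J <;> by_cases hb : v ∈ B <;> simp [ha, hb]
  · unfold EncodesRel
    rw [run_m (by decide)]
    exact hI
  · exact ⟨subset_rfl, fun _ _ => rfl, fun v h h' => absurd h h', fun v h h' => absurd h h',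
      fun v h h' => absurd h h'⟩
  · exact Or.inl (by simpa using Finset.card_le_univ (J \ B))
  · rintro i σ ⟨hBσ, X, I', hX, hI', hE, hi⟩
    have hround := run_loop (n := n) (inp := inp) (x := 8) (p := Router.entryStep)
      (σ := σ.setV 7 i)
      (fun j σ => Encodes σ.m 2 B ∧ ∃ Y I', Encodes σ.m 4 Y ∧
        EncodesRel σ.m 1 (fun v w => w ∈ I' v) ∧ EntryState d G B (J \ B) Y I I' ∧ Y ⊆ X ∧
        ∀ v : Fin n, (v : ℕ) < j → 50 * degIn G X v ≤ d → v ∉ Y)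
      ⟨hBσ, X, I', hX, (show EncodesRel (σ.setV 7 i).m 1 (fun v w => w ∈ I' v) from hI'), hE,
        subset_rfl, fun v hv => by omega⟩ ?_
    · obtain ⟨hB', Y, I'', hY, hI'', hE', hYX, hnew⟩ := hround
      refine ⟨hB', Y, I'', hY, hI'', hE', ?_⟩
      rcases X.eq_empty_or_nonempty with h0 | hne
      · exact Or.inr (Finset.subset_empty.mp (h0 ▸ hYX))
      · left
        obtain ⟨v, hvX, hv⟩ := hlow X hE.subset hne
        have h1 : Y ≠ X := fun h => hnew v v.2 hv (h ▸ hvX)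
        have h2 := Finset.card_lt_card (hYX.ssubset_of_ne h1)
        have h3 := hi.resolve_right hne.ne_empty
        omega
    · rintro v ρ ⟨hBρ, Y, I'', hY, hI'', hE', hYX, hnew⟩
      have hdis : Disjoint B Y := by
        rw [Finset.disjoint_left]
        intro w hwB hwY
        exact (Finset.mem_sdiff.mp (hE'.subset hwY)).2 hwB
      have hstep := run_entryStep hin (τ := ρ.setV 8 v) (v := v) hdis (by simp) hBρ hY hI''
      refine ⟨hframe _ _ hBρ, ?_⟩
      split_ifs at hstep with hc
      · refine ⟨_, _, hstep.1, hstep.2, hE'.erase hc.1 hc.2,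
          (Finset.erase_subset _ _).trans hYX, fun w hw hwd hwY => ?_⟩
        have h1 := Finset.mem_erase.mp hwY
        exact hnew w (by have := Fin.val_ne_of_ne h1.1; omega) hwd h1.2
      · refine ⟨_, _, hstep.1, hstep.2, hE', hYX, fun w hw hwd hwY => ?_⟩
        by_cases hwv : w = v
        · subst hwv
          exact hc ⟨hwY, (Nat.mul_le_mul_left 50 (degIn_mono hYX w)).trans hwd⟩
        · exact hnew w (by have := Fin.val_ne_of_ne hwv; omega) hwd hwY

end Jam

/-! ### The program for breadth-first search -/

section Search

open LoopExpr LoopProg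

variable {n : ℕ} {R : Fin n → Fin n → Prop} {a : Fin n} {L P : ℕ → ℕ}

/-- The state of a breadth-first search in the round that treats the vertices `v` of level `i + 1`:
the steps from smaller levels, and those from this level to pairs below `(j, k)`, are done. -/
structure SearchState (R : Fin n → Fin n → Prop) (a : Fin n) (L P : ℕ → ℕ) (i j k : ℕ) :
    Prop where
  root : L a = 1
  parent_root : P a = a
  eq_root : ∀ v : Fin n, L v = 1 → v = a
  parent : ∀ w : Fin n, 2 ≤ L w → ∃ v : Fin n, P w = v ∧ L v + 1 = L w ∧ R v w
  bound : ∀ v : Fin n, L v ≤ i + 2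
  done : ∀ v w : Fin n, R v w → 0 < L v → L v < n →
    (L v < i + 1 ∨ L v = i + 1 ∧ ((v : ℕ) < j ∨ (v : ℕ) = j ∧ (w : ℕ) < k)) →
      0 < L w ∧ L w ≤ L v + 1

lemma SearchState.skip {i : ℕ} {v w : Fin n} (h : SearchState R a L P i v w)
    (hc : ¬ (L v = i + 1 ∧ R v w ∧ L w = 0 ∧ i + 1 < n)) : SearchState R a L P i v (w + 1) := by
  refine ⟨h.root, h.parent_root, h.eq_root, h.parent, h.bound, fun x y hxy hx hxn hcase => ?_⟩
  by_cases hnew : L x = i + 1 ∧ (x : ℕ) = v ∧ (y : ℕ) = w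
  · obtain ⟨h1, h2, h3⟩ := hnew
    obtain rfl := Fin.ext h2
    obtain rfl := Fin.ext h3
    have := h.bound y
    have h4 : L y ≠ 0 := fun h5 => hc ⟨h1, hxy, h5, by omega⟩
    omega
  · exact h.done x y hxy hx hxn (by omega)

lemma SearchState.visit {i : ℕ} {v w : Fin n} (h : SearchState R a L P i v w)
    (hv : L v = i + 1) (hR : R v w) (hw : L w = 0) {L' P' : ℕ → ℕ}
    (hL : ∀ x : Fin n, L' x = if x = w then i + 2 else L x)
    (hP : ∀ x : Fin n, P' x = if x = w then (v : ℕ) else P x) :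
    SearchState R a L' P' i v (w + 1) := by
  have hne : ∀ {x : Fin n}, 0 < L x → x ≠ w := fun hx h' => by rw [h', hw] at hx; omega
  have hL' : ∀ {x : Fin n}, x ≠ w → L' x = L x := fun hx => by rw [hL, if_neg hx]
  have hP' : ∀ {x : Fin n}, x ≠ w → P' x = P x := fun hx => by rw [hP, if_neg hx]
  have ha : a ≠ w := hne (by rw [h.root]; omega)
  have hLw : L' w = i + 2 := by rw [hL, if_pos rfl]
  refine ⟨by rw [hL' ha, h.root], by rw [hP' ha, h.parent_root], fun x hx => ?_, fun y hy => ?_,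
    fun x => ?_, fun x y hxy hx hxn hcase => ?_⟩
  · by_cases hxw : x = w
    · rw [hxw, hLw] at hx; omega
    · exact h.eq_root x (by rwa [hL' hxw] at hx)
  · by_cases hyw : y = w
    · subst hyw
      refine ⟨v, by rw [hP, if_pos rfl], ?_, hR⟩
      rw [hL' (hne (by omega)), hLw, hv]
    · rw [hL' hyw] at hy
      obtain ⟨x, h1, h2, h3⟩ := h.parent y hy
      exact ⟨x, by rw [hP' hyw, h1], by rw [hL' (hne (by omega)), hL' hyw, h2], h3⟩
  · by_cases hxw : x = w
    · rw [hxw, hLw]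
    · rw [hL' hxw]; exact h.bound x
  · have hxw : x ≠ w := by
      rintro rfl
      rw [hLw] at hcase
      omega
    rw [hL' hxw] at hx hxn hcase ⊢
    by_cases hyw : y = w
    · subst hyw
      rw [hLw]
      by_cases hnew : L x = i + 1 ∧ (x : ℕ) = v
      · omega
      · have := h.done x y hxy hx hxn (by omega)
        omega
    · rw [hL' hyw]
      have := Fin.val_ne_of_ne hyw
      exact h.done x y hxy hx hxn (by omega)

variable {inp : List ℕ}

/-- Breadth-first search computes a search tree. The `i`-th round inspects the steps from the
vertices of level `i + 1`. -/
lemma run_search {s l p : ℕ} (hs : s ≠ 7 ∧ s ≠ 8 ∧ s ≠ 9) (hl : 3 ≤ l) (hp : 3 ≤ p) (hlp : l ≠ p)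
    {τ : LoopState} (hτ : τ.v s = a)
    (hR : ∀ (τ' : LoopState) (v w : Fin n), (∀ b < 3, τ'.m b = τ.m b) → τ'.v 8 = v → τ'.v 9 = w →
      (R v w → Router.allowed.eval n inp τ' = 1) ∧ (¬ R v w → Router.allowed.eval n inp τ' = 0)) :
    IsSearchTree R a (fun v => ((Router.search s l p).run n inp τ).m l v v)
      (fun v => ((Router.search s l p).run n inp τ).m p v v) := by
  have hn : 1 ≤ n := a.pos
  let Good : ℕ → ℕ → ℕ → LoopState → Prop := fun i j k σ => (∀ b < 3, σ.m b = τ.m b) ∧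
    SearchState R a (fun v => σ.m l v v) (fun v => σ.m p v v) i j k
  set τ₁ := (LoopProg.loop 8 (.put l 8 8 (.lit 0))).run n inp τ with hτ₁
  have h1 : Encodes τ₁.m l (∅ : Finset (Fin n)) :=
    run_loop_put_diag ∅ fun τ' v _ _ => by simp [eval]
  have h1s : τ₁.v s = a := by
    rw [hτ₁, run_v (by simp [vars, hs.2.1]), hτ]
  have h1m : ∀ b < 3, τ₁.m b = τ.m b := fun b hb => by
    rw [hτ₁, run_m (by simp only [arrays, List.mem_singleton]; omega)]
  set τ₂ := (LoopProg.put p s s (.var s)).run n inp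
    ((LoopProg.put l s s (.lit 1)).run n inp τ₁) with hτ₂
  have h2l : ∀ v : Fin n, τ₂.m l v v = if v = a then 1 else 0 := by
    intro v
    simp only [hτ₂, run_put, LoopState.setM_m, LoopState.setM_v, h1s, eval, hlp, false_and,
      if_false, true_and, and_self, ← Fin.ext_iff, h1 v, Finset.notMem_empty]
    rw [min_eq_left hn]
  have h2p : τ₂.m p a a = a := by
    simp only [hτ₂, run_put, LoopState.setM_m, LoopState.setM_v, h1s, eval, and_self, if_true]
    exact min_eq_left a.2.le
  have h2m : ∀ b < 3, τ₂.m b = τ.m b := fun b hb => by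
    rw [hτ₂, run_m (by simp only [arrays, List.mem_singleton]; omega),
      run_m (by simp only [arrays, List.mem_singleton]; omega), h1m b hb]
  have hstart : Good 0 0 0 τ₂ := by
    refine ⟨h2m, by simp [h2l], h2p, fun v hv => ?_, fun w hw => ?_, fun v => ?_,
      fun v w _ _ _ h => by omega⟩
    · by_contra h; simp [h2l, h] at hv
    · simp only [h2l] at hw; split_ifs at hw <;> omega
    · simp only [h2l]; split_ifs <;> omega
  have hstep : ∀ (i v w : Fin n) (σ : LoopState), σ.v 7 = i → σ.v 8 = v → σ.v 9 = w →
      Good i v w σ → Good i v (w + 1) ((Router.searchStep l p).run n inp σ) := by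
    rintro i v w σ h7 h8 h9 ⟨hm, hS⟩
    refine ⟨fun b hb => ?_, ?_⟩
    · rw [run_m, hm b hb]
      simp only [Router.searchStep, LoopProg.when, arrays, List.mem_append, List.mem_singleton,
        List.not_mem_nil, or_false]
      omega
    · obtain ⟨hR1, hR2⟩ := hR σ v w hm h8 h9
      rw [Router.searchStep, run_when]
      have hval : (LoopExpr.mul (isEq (.cell l 8 8) (.add (.var 7) (.lit 1))) <|
          .mul Router.allowed <| .mul (isZero (.cell l 9 9))
            (.sub .size (.add (.var 7) (.lit 1)))).eval n inp σ =
          (1 - ((σ.m l v v - (i + 1)) + ((i + 1) - σ.m l v v))) *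
            (Router.allowed.eval n inp σ * ((1 - σ.m l w w) * (n - (i + 1)))) := by
        simp only [eval, isEq, isZero, h7, h8, h9]
      rw [hval]
      by_cases hc : σ.m l v v = i + 1 ∧ R v w ∧ σ.m l w w = 0 ∧ (i : ℕ) + 1 < n
      · have hpos : 0 < (1 - ((σ.m l v v - (i + 1)) + ((i + 1) - σ.m l v v))) *
            (Router.allowed.eval n inp σ * ((1 - σ.m l w w) * (n - (i + 1)))) := by
          rw [hc.1, hR1 hc.2.1, hc.2.2.1]
          simp only [Nat.sub_self, Nat.sub_zero, add_zero, one_mul]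
          omega
        rw [if_pos hpos]
        refine hS.visit hc.1 hc.2.1 hc.2.2.1 (fun x => ?_) fun x => ?_
        · simp only [run_seq, run_put, LoopState.setM_m, LoopState.setM_v, h7, h9, eval, hlp,
            false_and, if_false, true_and, and_self, ← Fin.ext_iff]
          rw [min_eq_left (by omega)]
        · simp only [run_seq, run_put, LoopState.setM_m, LoopState.setM_v, h8, h9, eval,
            hlp.symm, false_and, if_false, true_and, and_self, ← Fin.ext_iff]
          rw [min_eq_left v.2.le]
      · rw [if_neg]
        · exact hS.skip hc
        · by_cases hRvw : R v w
          · rw [hR1 hRvw]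
            simp only [not_and, not_lt, Nat.pos_iff_ne_zero, ne_eq, not_not, mul_eq_zero] at hc ⊢
            have := hc
            by_cases e1 : σ.m l v v = i + 1
            · by_cases e2 : σ.m l w w = 0
              · have := hc e1 hRvw e2
                omega
              · omega
            · omega
          · rw [hR2 hRvw]; simp
  have hvars : (Router.searchStep l p).vars = [] := rfl
  have hmain := run_loop (n := n) (inp := inp) (x := 7)
    (p := .loop 8 (.loop 9 (Router.searchStep l p))) (σ := τ₂) (fun i σ => Good i 0 0 σ) hstart ?_
  · obtain ⟨-, hS⟩ := hmain
    exact ⟨hS.root, hS.parent_root, hS.eq_root, hS.parent,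
      fun v w hvw hv hvn => hS.done v w hvw hv hvn (Or.inl (Nat.lt_succ_of_lt hvn))⟩
  · intro i σ hσ
    have hmid := run_loop (n := n) (inp := inp) (x := 8)
      (p := .loop 9 (Router.searchStep l p)) (σ := σ.setV 7 i)
      (fun j ρ => ρ.v 7 = i ∧ Good i j 0 ρ) ⟨by simp, hσ⟩ ?_
    · obtain ⟨-, hm, hS⟩ := hmid
      refine ⟨hm, hS.root, hS.parent_root, hS.eq_root, hS.parent, fun v => ?_,
        fun v w hvw hv hvn hcase => hS.done v w hvw hv hvn (by omega)⟩
      have := hS.bound v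
      omega
    · rintro v ρ ⟨h7, hρ⟩
      have hin := run_loop (n := n) (inp := inp) (x := 9)
        (p := Router.searchStep l p) (σ := ρ.setV 8 v)
        (fun k μ => μ.v 7 = i ∧ μ.v 8 = v ∧ Good i v k μ) ⟨by simp [h7], by simp, hρ⟩ ?_
      · obtain ⟨g7, -, hm, hS⟩ := hin
        refine ⟨g7, hm, hS.root, hS.parent_root, hS.eq_root, hS.parent, hS.bound,
          fun v w hvw hv hvn hcase => hS.done v w hvw hv hvn (by omega)⟩
      · rintro w μ ⟨g7, g8, hμ⟩
        refine ⟨?_, ?_, hstep i v w _ (by simp [g7]) (by simp [g8]) (by simp) hμ⟩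
        · rw [run_v (by simp [hvars])]; simp [g7]
        · rw [run_v (by simp [hvars])]; simp [g8]

end Search

/-! ### The programs that trace, output and mark a path -/

section Trace

open LoopExpr LoopProg

variable {n : ℕ} {inp : List ℕ} {τ : LoopState}

/-- The program `Router.meet` finds a meeting point with the least sum of levels. -/
lemma run_meet (hex : ∃ v : Fin n, 0 < τ.m 5 v v ∧ 0 < τ.m 7 v v) :
    ∃ z : Fin n, (Router.meet.run n inp τ).v 2 = z ∧ 0 < τ.m 5 z z ∧ 0 < τ.m 7 z z ∧
      ∀ v : Fin n, 0 < τ.m 5 v v → 0 < τ.m 7 v v →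
        τ.m 5 z z + τ.m 7 z z ≤ τ.m 5 v v + τ.m 7 v v := by
  have hmain := run_loop (n := n) (inp := inp) (x := 8)
    (p := .when (.mul (.cell 5 8 8) (.cell 7 8 8)) <| .ite (.var 3)
      (.when (.sub (.add (.cell 5 2 2) (.cell 7 2 2)) (.add (.cell 5 8 8) (.cell 7 8 8)))
        (.set 2 (.var 8)))
      (.seq (.set 2 (.var 8)) (.set 3 (.lit 1)))) (σ := (LoopProg.set 3 (.lit 0)).run n inp τ)
    (fun i σ => σ.m = τ.m ∧
      ((σ.v 3 = 0 ∧ ∀ v : Fin n, (v : ℕ) < i → ¬ (0 < τ.m 5 v v ∧ 0 < τ.m 7 v v)) ∨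
        (0 < σ.v 3 ∧ ∃ z : Fin n, σ.v 2 = z ∧ 0 < τ.m 5 z z ∧ 0 < τ.m 7 z z ∧
          ∀ v : Fin n, (v : ℕ) < i → 0 < τ.m 5 v v → 0 < τ.m 7 v v →
            τ.m 5 z z + τ.m 7 z z ≤ τ.m 5 v v + τ.m 7 v v)))
    ⟨rfl, Or.inl ⟨by simp [run_set, eval], fun v hv => by omega⟩⟩ ?_
  · obtain ⟨-, ⟨-, h⟩ | ⟨-, z, hz, h1, h2, h3⟩⟩ := hmain
    · obtain ⟨v, hv⟩ := hex
      exact absurd hv (h v v.2)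
    · exact ⟨z, hz, h1, h2, fun v => h3 v v.2⟩
  · rintro i σ ⟨hm, hcase⟩
    have hi := i.2.le
    have hn : 1 ≤ n := i.pos
    have hlt : ∀ v : Fin n, (v : ℕ) < i + 1 → v = i ∨ (v : ℕ) < i := fun v hv => by
      rw [Fin.ext_iff]; omega
    rw [run_when]
    simp only [eval, LoopState.setV_m, LoopState.setV_v, if_true, hm]
    by_cases hc : 0 < τ.m 5 i i ∧ 0 < τ.m 7 i i
    · rw [if_pos (Nat.mul_pos hc.1 hc.2), run_ite]
      simp only [eval, LoopState.setV_v]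
      rcases hcase with ⟨h3, hno⟩ | ⟨h3, z, hz, hz1, hz2, hz3⟩
      · rw [if_neg (by simp [h3])]
        refine ⟨by simp [run_seq, run_set, hm],
          Or.inr ⟨?_, i, ?_, hc.1, hc.2, fun v hv h5 h7 => ?_⟩⟩
        · simp only [run_seq, run_set, eval, LoopState.setV_v, if_true]; omega
        · simp [run_seq, run_set, eval, hi]
        · rcases hlt v hv with rfl | hv
          · exact le_rfl
          · exact absurd ⟨h5, h7⟩ (hno v hv)
      · rw [if_pos (by simpa using h3), run_when]
        simp only [eval, LoopState.setV_v, LoopState.setV_m, if_true, hm]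
        simp only [show (2 : ℕ) ≠ 8 by norm_num, if_false, hz]
        split_ifs with hbetter
        · refine ⟨by simp [run_set, hm], Or.inr ⟨by simpa [run_set] using h3, i, ?_, hc.1, hc.2,
            fun v hv h5 h7 => ?_⟩⟩
          · simp [run_set, eval, hi]
          · rcases hlt v hv with rfl | hv
            · exact le_rfl
            · have := hz3 v hv h5 h7
              omega
        · refine ⟨hm, Or.inr ⟨by simpa using h3, z, by simpa using hz, hz1, hz2,
            fun v hv h5 h7 => ?_⟩⟩
          rcases hlt v hv with rfl | hv
          · omega
          · exact hz3 v hv h5 h7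
    · rw [if_neg]
      · refine ⟨hm, hcase.imp (fun h => ⟨by simpa using h.1, fun v hv => ?_⟩) ?_⟩
        · rcases hlt v hv with rfl | hv
          · exact hc
          · exact h.2 v hv
        · rintro ⟨h3, z, hz, hz1, hz2, hz3⟩
          refine ⟨by simpa using h3, z, by simpa using hz, hz1, hz2, fun v hv h5 h7 => ?_⟩
          rcases hlt v hv with rfl | hv
          · exact absurd ⟨h5, h7⟩ hc
          · exact hz3 v hv h5 h7
      · intro h
        exact hc ⟨Nat.pos_of_mul_pos_right h, Nat.pos_of_mul_pos_left h⟩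

/-- The program `Router.trace` writes the path from `a` through `z` to `b` into the array `9`. Both
of its loops run `n` times, beyond the root of the search tree; there they write the root again, to
the same place. -/
lemma run_trace {z a b : Fin n} {c c' : ℕ → Fin n} (hτ : τ.v 2 = z) (hz : 0 < τ.m 5 z z)
    (hz' : 0 < τ.m 7 z z) (c0 : c 0 = z) (cP : ∀ j, τ.m 6 (c j) (c j) = c (j + 1))
    (cL : ∀ j, τ.m 5 (c j) (c j) = τ.m 5 z z - 1 - j + 1) (ca : ∀ j, τ.m 5 z z ≤ j + 1 → c j = a)
    (c0' : c' 0 = z) (cP' : ∀ j, τ.m 8 (c' j) (c' j) = c' (j + 1))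
    (cL' : ∀ j, τ.m 7 (c' j) (c' j) = τ.m 7 z z - 1 - j + 1)
    (ca' : ∀ j, τ.m 7 z z ≤ j + 1 → c' j = b) (hlt : τ.m 5 z z - 1 + (τ.m 7 z z - 1) < n) :
    (Router.trace.run n inp τ).v 4 = τ.m 5 z z - 1 + (τ.m 7 z z - 1) + 1 ∧
      ∀ i ≤ τ.m 5 z z - 1 + (τ.m 7 z z - 1),
        (Router.trace.run n inp τ).m 9 i i = joinChains (τ.m 5 z z - 1) c c' i := by
  obtain ⟨k, hk⟩ : ∃ k, τ.m 5 z z = k + 1 := ⟨τ.m 5 z z - 1, by omega⟩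
  obtain ⟨l, hl⟩ : ∃ l, τ.m 7 z z = l + 1 := ⟨τ.m 7 z z - 1, by omega⟩
  simp only [hk, hl, Nat.add_sub_cancel] at cL ca cL' ca' hlt ⊢
  set τ₁ := (LoopProg.set 10 (.var 2)).run n inp τ with hτ₁
  have h1 := run_loop (n := n) (inp := inp) (x := 7)
    (p := .seq (.set 14 (.sub (.cell 5 10 10) (.lit 1)))
      (.seq (.put 9 14 14 (.var 10)) (.set 10 (.cell 6 10 10)))) (σ := τ₁)
    (fun i σ => σ.v 10 = c i ∧ σ.v 2 = z ∧ (∀ a', a' ≠ 9 → σ.m a' = τ.m a') ∧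
      ∀ x ≤ k, k < x + i → σ.m 9 x x = c (k - x))
    ⟨by simp [hτ₁, run_set, eval, hτ, c0, z.2.le], by simp [hτ₁, run_set, hτ], fun _ _ => rfl,
      fun x hx hx' => by omega⟩ ?_
  swap
  · rintro i σ ⟨g10, g2, gm, g9⟩
    have hn : ∀ j : ℕ, (c j : ℕ) ≤ n := fun j => (c j).2.le
    have e14 : min (σ.m 5 (c i) (c i) - 1) n = k - i := by
      rw [gm 5 (by norm_num), cL]; omega
    simp only [run_seq, run_set, run_put, eval, LoopState.setV_v, LoopState.setV_m,
      LoopState.setM_v, g10]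
    norm_num
    simp only [e14]
    refine ⟨?_, g2, fun a' ha' => ?_, fun x hx hxi => ?_⟩
    · simp only [LoopState.setM_m]
      norm_num
      rw [gm 6 (by norm_num), cP]
      exact min_eq_left (hn _)
    · funext x y
      simp [LoopState.setM_m, ha', gm a' ha']
    · simp only [LoopState.setM_m, true_and, and_self]
      split_ifs with h
      · by_cases hik : (i : ℕ) ≤ k
        · congr 2; omega
        · rw [ca i (by omega), ca (k - x) (by omega)]
      · exact g9 x hx (by omega)
  obtain ⟨-, g2, gm, g9⟩ := h1
  set τ₂ := (LoopProg.loop 7 (.seq (.set 14 (.sub (.cell 5 10 10) (.lit 1)))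
      (.seq (.put 9 14 14 (.var 10)) (.set 10 (.cell 6 10 10))))).run n inp τ₁ with hτ₂
  set τ₃ := (LoopProg.set 10 (.var 2)).run n inp τ₂ with hτ₃
  have h3 := run_loop (n := n) (inp := inp) (x := 7)
    (p := .seq (.set 14 (.add (.sub (.cell 5 2 2) (.lit 1))
      (.sub (.cell 7 2 2) (.cell 7 10 10))))
      (.seq (.put 9 14 14 (.var 10)) (.set 10 (.cell 8 10 10)))) (σ := τ₃)
    (fun i σ => σ.v 10 = c' i ∧ σ.v 2 = z ∧ (∀ a', a' ≠ 9 → σ.m a' = τ.m a') ∧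
      (∀ x ≤ k, σ.m 9 x x = c (k - x)) ∧
      ∀ x ≤ k + l, k < x → x < k + i → σ.m 9 x x = c' (x - k))
    ⟨by simp [hτ₃, run_set, eval, g2, c0', z.2.le], by simp [hτ₃, run_set, g2], gm,
      fun x hx => g9 x hx (by omega), fun x hx hx' => by omega⟩ ?_
  swap
  · rintro i σ ⟨g10, g2, gm, g9, g9'⟩
    have hn : ∀ j : ℕ, (c' j : ℕ) ≤ n := fun j => (c' j).2.le
    have e14 : min (σ.m 5 z z - 1 + (σ.m 7 z z - σ.m 7 (c' i) (c' i))) n = k + min (i : ℕ) l := by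
      rw [gm 5 (by norm_num), gm 7 (by norm_num), cL', hk, hl]; omega
    simp only [run_seq, run_set, run_put, eval, LoopState.setV_v, LoopState.setV_m,
      LoopState.setM_v, g10, g2]
    norm_num
    simp only [e14]
    refine ⟨?_, fun a' ha' => ?_, fun x hx => ?_, fun x hx hxk hxi => ?_⟩
    · simp only [LoopState.setM_m]
      norm_num
      rw [gm 8 (by norm_num), cP']
      exact min_eq_left (hn _)
    · funext x y
      simp [LoopState.setM_m, ha', gm a' ha']
    · simp only [LoopState.setM_m, true_and, and_self]
      split_ifs with h
      · have hx0 : k - x = 0 := by omega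
        rw [hx0, c0]
        rcases Nat.eq_zero_or_pos i with h0 | h0
        · rw [h0, c0']
        · rw [ca' i (by omega), ← c0', ca' 0 (by omega)]
      · exact g9 x hx
    · simp only [LoopState.setM_m, true_and, and_self]
      split_ifs with h
      · by_cases hil : (i : ℕ) ≤ l
        · congr 2; omega
        · rw [ca' i (by omega), ca' (x - k) (by omega)]
      · exact g9' x hx hxk (by omega)
  obtain ⟨-, k2, km, k9, k9'⟩ := h3
  set τ₄ := (LoopProg.loop 7 (.seq (.set 14 (.add (.sub (.cell 5 2 2) (.lit 1))
      (.sub (.cell 7 2 2) (.cell 7 10 10))))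
      (.seq (.put 9 14 14 (.var 10)) (.set 10 (.cell 8 10 10))))).run n inp τ₃ with hτ₄
  have hrun : Router.trace.run n inp τ =
      (LoopProg.set 4 (.sub (.add (.cell 5 2 2) (.cell 7 2 2)) (.lit 1))).run n inp τ₄ := rfl
  rw [hrun]
  refine ⟨?_, fun i hi => ?_⟩
  · simp only [run_set, eval, LoopState.setV_v, if_true, k2, km 5 (by norm_num),
      km 7 (by norm_num), hk, hl]
    omega
  · rw [run_set, LoopState.setV_m, joinChains]
    split_ifs with h
    · exact k9 i h
    · exact k9' i hi (by omega) (by omega)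

/-- The program `Router.output` outputs the first `M` vertices in the array `9`. -/
lemma run_output {f : ℕ → Fin n} {M : ℕ} (hM : τ.v 4 = M) (hMn : M ≤ n)
    (hf : ∀ i < M, τ.m 9 i i = f i) :
    (Router.output.run n inp τ).o = τ.o ++ (List.range M).map fun i => (f i : ℕ) := by
  have hmain := run_loop (n := n) (inp := inp) (x := 7)
    (p := .when (.sub (.var 4) (.var 7)) (.out (.cell 9 7 7))) (σ := τ)
    (fun i σ => σ.v 4 = M ∧ σ.m = τ.m ∧
      σ.o = τ.o ++ (List.range (min i M)).map fun i => (f i : ℕ)) ⟨hM, rfl, by simp⟩ ?_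
  · obtain ⟨-, -, h⟩ := hmain
    rw [min_eq_right hMn] at h
    exact h
  · rintro i σ ⟨h4, hm, ho⟩
    rw [run_when]
    simp only [eval, LoopState.setV_v, if_true, show (4 : ℕ) ≠ 7 by norm_num, if_false, h4]
    by_cases hi : (i : ℕ) < M
    · rw [if_pos (by omega), run_out]
      refine ⟨by simp [h4], hm, ?_⟩
      rw [min_eq_left (by omega), List.range_succ, List.map_append, ← List.append_assoc,
        LoopState.app_o, LoopState.setV_o, ho, min_eq_left hi.le]
      simp [eval, hm, hf i hi]
    · rw [if_neg (by omega)]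
      refine ⟨by simp [h4], hm, ?_⟩
      rw [LoopState.setV_o, ho, min_eq_right (by omega), min_eq_right (by omega)]

/-- The program `Router.mark` marks the pairs of consecutive vertices in the array `9` with the
value of the variable `5`. -/
lemma run_mark {f : ℕ → Fin n} {M : ℕ} (hM : τ.v 4 = M) (hMn : M ≤ n) (hbit : τ.v 5 ≤ n)
    (hf : ∀ i < M, τ.m 9 i i = f i) (v w : Fin n) :
    (Router.mark.run n inp τ).m 0 v w =
      if s(v, w) ∈ (List.range (M - 1)).map (fun i => s(f i, f (i + 1))) then τ.v 5
      else τ.m 0 v w := by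
  have hmain := run_loop (n := n) (inp := inp) (x := 7)
    (p := .seq (.set 15 (.add (.var 7) (.lit 1))) <| .when (.sub (.var 4) (.var 15)) <|
    .seq (.set 12 (.cell 9 7 7)) <| .seq (.set 13 (.cell 9 15 15)) <|
      .seq (.put 0 12 13 (.var 5)) (.put 0 13 12 (.var 5))) (σ := τ)
    (fun i σ => σ.v 4 = M ∧ σ.v 5 = τ.v 5 ∧ σ.m 9 = τ.m 9 ∧ ∀ v w : Fin n, σ.m 0 v w =
      if s(v, w) ∈ (List.range (min i (M - 1))).map (fun i => s(f i, f (i + 1))) then τ.v 5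
      else τ.m 0 v w) ⟨hM, rfl, rfl, fun v w => by simp⟩ ?_
  · have h := hmain.2.2.2 v w
    rw [min_eq_right (by omega)] at h
    exact h
  · rintro i σ ⟨h4, h5, h9, h0⟩
    have hi1 : (i : ℕ) + 1 ≤ n := i.2
    rw [run_seq, run_when]
    simp only [run_set, eval, LoopState.setV_v, if_true, show (4 : ℕ) ≠ 15 by norm_num,
      show (4 : ℕ) ≠ 7 by norm_num, if_false, h4, min_eq_left hi1]
    by_cases hi : (i : ℕ) + 1 < M
    · rw [if_pos (by omega)]
      have e12 : min (τ.m 9 i i) n = f i := by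
        rw [hf i (by omega)]; exact min_eq_left (f i).2.le
      have e13 : min (τ.m 9 (i + 1) (i + 1)) n = f (i + 1) := by
        rw [hf _ hi]; exact min_eq_left (f _).2.le
      simp only [run_seq, run_set, run_put, eval, LoopState.setV_v, LoopState.setV_m,
        LoopState.setM_v, h9]
      norm_num
      rw [e12, e13, h5, min_eq_left hbit]
      refine ⟨h4, rfl, ?_, fun v w => ?_⟩
      · funext x y
        simp [LoopState.setM_m, h9]
      · rw [min_eq_left (by omega), List.range_succ]
        simp only [LoopState.setM_m, true_and, LoopState.setV_m, h0, List.map_append,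
          List.mem_append, List.map_cons, List.map_nil, List.mem_singleton, ← Fin.ext_iff,
          min_eq_left (show (i : ℕ) ≤ M - 1 by omega), Sym2.eq_iff]
        by_cases hA : v = f i ∧ w = f (i + 1)
        · simp [hA]
        · by_cases hB : v = f (i + 1) ∧ w = f i
          · simp [hB]
          · simp only [hA, hB, if_false, or_false]
    · rw [if_neg (by omega)]
      refine ⟨by simp [h4], by simp [h5], h9, fun v w => ?_⟩
      rw [min_eq_right (by omega)]
      have := h0 v w
      rw [min_eq_right (by omega)] at this
      exact this

end Trace

/-! ### Finding, reading and registering a path -/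

section ReadPath

open LoopExpr LoopProg

variable {n : ℕ} {G : SimpleGraph (Fin n)} {inp : List ℕ}

lemma SimpleGraph.Walk.edges_eq_map_range {V : Type*} {G : SimpleGraph V} {a b : V}
    (p : G.Walk a b) :
    p.edges = (List.range p.length).map fun i => s(p.getVert i, p.getVert (i + 1)) := by
  induction p with
  | nil => simp
  | cons hadj p ih =>
    rw [edges_cons, length_cons, List.range_succ_eq_map, List.map_cons, List.map_map, ih]
    simp [Function.comp_def]

/-- The program `Router.readPath` copies the path `P` from the request. The entries of the array `9`
beyond the end of the path have no meaning. -/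
lemma run_readPath {τ : LoopState} {P : RoutedPath G} (hlen : P.length < n)
    (h1 : inp.getD (2 + 1 + n * n) 0 = P.length + 1)
    (h2 : ∀ j < P.length + 1, inp.getD (4 + n * n + j) 0 = P.path.1.getVert j) :
    (Router.readPath.run n inp τ).v 4 = P.length + 1 ∧ (Router.readPath.run n inp τ).v 5 = 0 ∧
      ∀ j < P.length + 1, (Router.readPath.run n inp τ).m 9 j j = P.path.1.getVert j := by
  have hmain := run_loop (n := n) (inp := inp) (x := 7)
    (p := .put 9 7 7 (.input (.add (.add (.lit 4) (.mul .size .size)) (.var 7)))) (σ := τ)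
    (fun i σ => ∀ j < i, j < P.length + 1 → σ.m 9 j j = P.path.1.getVert j)
    (fun j hj => by omega) ?_
  · refine ⟨?_, ?_, fun j hj => hmain j (by omega) hj⟩
    · simp only [Router.readPath, run_seq, run_set, request, eval, LoopState.setV_v, h1]
      norm_num
      exact hlen
    · simp [Router.readPath, run_seq, run_set, eval]
  · intro i σ hσ j hji hj
    simp only [run_put, LoopState.setM_m, LoopState.setV_v, if_true, true_and, and_self, eval]
    split_ifs with hc
    · rw [← hc, h2 j hj]
      exact min_eq_left (P.path.1.getVert j).2.le
    · exact hσ j (by omega) hj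

end ReadPath

section Requests

open LoopExpr LoopProg

variable {n d : ℕ} {G : SimpleGraph (Fin n)} [DecidableRel G.Adj] {inp : List ℕ}
  {F : Multiset (RoutedPath G)} {I : Fin n → Finset (Fin n)}

/-- The arrays `0`, `1` and `2` describe the used edges, the entry sets and the jammed vertices. -/
structure DescribesFamily (d : ℕ) (F : Multiset (RoutedPath G)) (I : Fin n → Finset (Fin n))
    (m : ℕ → ℕ → ℕ → ℕ) : Prop where
  used : EncodesRel m 0 fun v w => s(v, w) ∈ usedEdges F
  entry : EncodesRel m 1 fun v w => w ∈ I v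
  jammed : Encodes m 2 (jammed d F)

lemma DescribesFamily.eval_allowed (hin : InputDescribes d G inp) {τ : LoopState}
    (h : DescribesFamily d F I τ.m) {τ' : LoopState} {v w : Fin n} (hm : ∀ b < 3, τ'.m b = τ.m b)
    (hv : τ'.v 8 = v) (hw : τ'.v 9 = w) :
    (AllowedStep d F I v w → Router.allowed.eval n inp τ' = 1) ∧
      (¬ AllowedStep d F I v w → Router.allowed.eval n inp τ' = 0) := by
  have h0 := h.used v w
  have h1 := h.entry w v
  have h2 := h.jammed w
  simp only [Router.allowed, eval, isZero, eval_adj hin hv hw, hv, hw, hm 0 (by norm_num),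
    hm 1 (by norm_num), hm 2 (by norm_num), h2, AllowedStep]
  by_cases c1 : G.Adj v w <;> by_cases c2 : s(v, w) ∈ usedEdges F <;>
    by_cases c3 : w ∈ _root_.jammed d F <;> by_cases c4 : v ∈ I w <;> simp_all

/-- If more than half of the vertices can be reached from every vertex by `i` allowed steps, then
`Router.findPath` finds a path of length at most `2 i`, which it outputs and leaves in the
array `9`. -/
lemma run_findPath (hin : InputDescribes d G inp) {τ : LoopState}
    (h : DescribesFamily d F I τ.m) {a b : Fin n} (ha : inp.getD (2 + 1 + n * n) 0 = a)
    (hb : inp.getD (2 + 2 + n * n) 0 = b) {i : ℕ} (hi : i < n)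
    (hball : ∀ v, n < 2 * (stepBall (AllowedStep d F I) v i).card) :
    ∃ (p : G.Path a b) (f : ℕ → Fin n),
      (Router.findPath.run n inp τ).o = τ.o ++ encodePath ⟨a, b, p⟩ ∧
      (∀ b < 3, (Router.findPath.run n inp τ).m b = τ.m b) ∧
      (Router.findPath.run n inp τ).v 4 = p.1.length + 1 ∧ p.1.length < n ∧
      (∀ j < p.1.length + 1, (Router.findPath.run n inp τ).m 9 j j = f j) ∧
      (Router.findPath.run n inp τ).v 5 = 1 ∧
      p.1.edges = (List.range p.1.length).map (fun j => s(f j, f (j + 1))) ∧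
      p.1.length ≤ 2 * i ∧ (∀ e ∈ p.1.edges, e ∉ usedEdges F) ∧
      ∀ v ∈ jammed d F, v ∈ p.1.support → v = a ∨ v = b ∨ ∃ w ∈ I v, s(v, w) ∈ p.1.edges := by
  classical
  set τ₁ := (LoopProg.set 1 (request 2)).run n inp ((LoopProg.set 0 (request 1)).run n inp τ)
    with hτ₁
  have h1a : τ₁.v 0 = a := by
    simp only [hτ₁, run_set, request, eval, LoopState.setV_v, zero_ne_one, if_false, if_true, ha]
    exact min_eq_left a.2.le
  have h1b : τ₁.v 1 = b := by
    simp only [hτ₁, run_set, request, eval, LoopState.setV_v, if_true, hb]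
    exact min_eq_left b.2.le
  have h1m : τ₁.m = τ.m := rfl
  set τ₂ := (Router.search 0 5 6).run n inp τ₁ with hτ₂
  have h2m : ∀ c < 3, τ₂.m c = τ.m c := fun c hc => by
    rw [hτ₂, run_m, h1m]
    interval_cases c <;> decide
  have hT : IsSearchTree (AllowedStep d F I) a (fun v => τ₂.m 5 v v) (fun v => τ₂.m 6 v v) :=
    run_search (by norm_num) (by norm_num) (by norm_num) (by norm_num) h1a
      fun τ' v w hm => h.eval_allowed hin hm
  have h2b : τ₂.v 1 = b := by rw [hτ₂, run_v (by decide), h1b]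
  set τ₃ := (Router.search 1 7 8).run n inp τ₂ with hτ₃
  have h3m : ∀ c < 3, τ₃.m c = τ.m c := fun c hc => by
    rw [hτ₃, run_m, h2m c hc]
    interval_cases c <;> decide
  have hT' : IsSearchTree (AllowedStep d F I) b (fun v => τ₃.m 7 v v) (fun v => τ₃.m 8 v v) :=
    run_search (by norm_num) (by norm_num) (by norm_num) (by norm_num) h2b
      fun τ' v w hm => h.eval_allowed hin fun c hc => (hm c hc).trans (h2m c hc)
  have h35 : τ₃.m 5 = τ₂.m 5 := run_m (by decide) _
  have h36 : τ₃.m 6 = τ₂.m 6 := run_m (by decide) _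
  rw [← h35, ← h36] at hT
  -- Two balls with more than half of the vertices each have a common vertex.
  obtain ⟨x, hx, hx'⟩ : ∃ x, x ∈ stepBall (AllowedStep d F I) a i ∧
      x ∈ stepBall (AllowedStep d F I) b i := by
    by_contra! hcon
    have hdis : Disjoint (stepBall (AllowedStep d F I) a i) (stepBall (AllowedStep d F I) b i) :=
      Finset.disjoint_left.mpr hcon
    have h1 := Finset.card_le_univ
      (stepBall (AllowedStep d F I) a i ∪ stepBall (AllowedStep d F I) b i)
    rw [Finset.card_union_of_disjoint hdis, Fintype.card_fin] at h1
    have h2 := hball a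
    have h3 := hball b
    omega
  have hxa := hT.of_mem_stepBall hi hx
  have hxb := hT'.of_mem_stepBall hi hx'
  obtain ⟨z, hz2, hz5, hz7, hmin⟩ := run_meet (inp := inp) (τ := τ₃) ⟨x, hxa.1, hxb.1⟩
  set τ₄ := Router.meet.run n inp τ₃ with hτ₄
  have h4m : τ₄.m = τ₃.m := run_m_eq (by decide) _
  obtain ⟨c, c', p, c0, cP, cL, ca, c0', cP', cL', ca', hlt, hsupp, hedges, hdisj, hentry⟩ :=
    exists_meeting_path hT hT' hmin hz5 hz7
  simp only [← h4m] at cP cL ca cP' cL' ca' hlt hsupp hedges hz5 hz7 hmin hxa hxb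
  have htr := run_trace (inp := inp) hz2 hz5 hz7 c0 cP cL ca c0' cP' cL' ca' hlt
  set τ₅ := Router.trace.run n inp τ₄ with hτ₅
  have h5m : ∀ c < 3, τ₅.m c = τ.m c := fun c hc => by
    rw [hτ₅, run_m, h4m, h3m c hc]
    interval_cases c <;> decide
  set f := joinChains (τ₄.m 5 z z - 1) c c' with hf
  have hlen : p.1.length = τ₄.m 5 z z - 1 + (τ₄.m 7 z z - 1) := by
    rw [← SimpleGraph.Walk.length_edges, hedges, List.length_map, List.length_range]
  rw [← hlen] at htr hsupp hedges hlt
  set τ₆ := Router.output.run n inp τ₅ with hτ₆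
  have h6m : τ₆.m = τ₅.m := run_m_eq (by decide) _
  have h6o : τ₆.o = τ₅.o ++ (List.range (p.1.length + 1)).map fun i => (f i : ℕ) :=
    run_output htr.1 hlt fun j hj => htr.2 j (by omega)
  have h5o : τ₅.o = τ.o := by
    rw [hτ₅, run_o (by simp [Router.trace, Silent]), hτ₄,
      run_o (by simp [Router.meet, LoopProg.when, Silent]), hτ₃,
      run_o (by simp [Router.search, Router.searchStep, LoopProg.when, Silent]), hτ₂,
      run_o (by simp [Router.search, Router.searchStep, LoopProg.when, Silent])]
    rfl
  have hrun : Router.findPath.run n inp τ = (LoopProg.set 5 (.lit 1)).run n inp τ₆ := rfl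
  rw [hrun]
  refine ⟨p, f, ?_, fun c hc => ?_, ?_, hlt, fun j hj => ?_, ?_, hedges, ?_, hdisj, hentry⟩
  · rw [run_set, LoopState.setV_o, h6o, h5o, encodePath, RoutedPath.vertices, hsupp,
      List.map_map]
    rfl
  · rw [run_set, LoopState.setV_m, h6m, h5m c hc]
  · rw [run_set, LoopState.setV_v, if_neg (by norm_num), hτ₆, run_v (by decide), htr.1]
  · rw [run_set, LoopState.setV_m, h6m, htr.2 j (by omega)]
  · rw [run_set, LoopState.setV_v, if_pos rfl, eval]
    exact min_eq_left a.pos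
  · have h1 := hmin x hxa.1 hxb.1
    have h2 := hxa.2
    have h3 := hxb.2
    omega

/-- Once the used edges are marked, the remaining parts of the program update the jammed vertices
and the entry sets. -/
lemma run_update (hin : InputDescribes d G inp) {F' : Multiset (RoutedPath G)}
    (hF : (usedEdges F').Nodup) {τ : LoopState} {B : Finset (Fin n)}
    (hU : EncodesRel τ.m 0 fun v w => s(v, w) ∈ usedEdges F')
    (hI : EncodesRel τ.m 1 fun v w => w ∈ I v) (hB : Encodes τ.m 2 B)
    (hlow : ∀ X ⊆ jammed d F' \ B, X.Nonempty → ∃ v ∈ X, 50 * degIn G X v ≤ d) :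
    ∃ I', DescribesFamily d F' I' ((LoopProg.seq Router.closure <| .seq Router.entrySets
        (.loop 8 (.put 2 8 8 (.cell 3 8 8)))).run n inp τ).m ∧
      EntryState d G B (jammed d F' \ B) ∅ I I' := by
  have h1 := run_closure hin hF hU
  set τ₁ := Router.closure.run n inp τ with hτ₁
  have h10 : τ₁.m 0 = τ.m 0 := run_m (by decide) _
  have h11 : τ₁.m 1 = τ.m 1 := run_m (by decide) _
  have h12 : τ₁.m 2 = τ.m 2 := run_m (by decide) _
  obtain ⟨I', hI', hE⟩ := run_entrySets hin (τ := τ₁) (B := B) (J := jammed d F') (I := I)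
    (fun v => by rw [h12]; exact hB v) h1 (fun v w => by rw [h11]; exact hI v w) hlow
  set τ₂ := Router.entrySets.run n inp τ₁ with hτ₂
  have h20 : τ₂.m 0 = τ₁.m 0 := run_m (by decide) _
  have h23 : τ₂.m 3 = τ₁.m 3 := run_m (by decide) _
  have hrun : (LoopProg.seq Router.closure <| .seq Router.entrySets
      (.loop 8 (.put 2 8 8 (.cell 3 8 8)))).run n inp τ =
      (LoopProg.loop 8 (.put 2 8 8 (.cell 3 8 8))).run n inp τ₂ := rfl
  rw [hrun]
  refine ⟨I', ⟨fun v w => ?_, fun v w => ?_, ?_⟩, hE⟩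
  · rw [run_m (by decide), h20, h10]
    exact hU v w
  · rw [run_m (by decide)]
    exact hI' v w
  · refine run_loop_put_diag _ fun τ' v hm hv => ?_
    rw [eval, hv, hm 3 (by norm_num), h23]
    exact h1 v

end Requests

/-! ### Correctness of the answer to a request -/

section Step

open LoopExpr LoopProg

variable {n d : ℕ} {G : SimpleGraph (Fin n)} [DecidableRel G.Adj] {inp : List ℕ}
  {F : Multiset (RoutedPath G)} {I : Fin n → Finset (Fin n)}

/-- Marking the edges of the path `P`, and then updating, turns the description of `F` into the one
of `F'`. -/
lemma run_mark_update (hin : InputDescribes d G inp) {τ : LoopState}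
    (h : DescribesFamily d F I τ.m) {P : RoutedPath G} {f : ℕ → Fin n}
    (hM : τ.v 4 = P.length + 1) (hlen : P.length < n) (hbit : τ.v 5 ≤ 1)
    (hf : ∀ j < P.length + 1, τ.m 9 j j = f j)
    (hedges : P.edges = (List.range P.length).map fun j => s(f j, f (j + 1)))
    {F' : Multiset (RoutedPath G)} (hF' : (usedEdges F').Nodup)
    (hiff : ∀ e, e ∈ usedEdges F' ↔ (e ∈ P.edges ∧ τ.v 5 = 1) ∨ (e ∉ P.edges ∧ e ∈ usedEdges F))
    (hlow : ∀ X ⊆ jammed d F' \ jammed d F, X.Nonempty → ∃ v ∈ X, 50 * degIn G X v ≤ d) :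
    ∃ I', DescribesFamily d F' I' ((LoopProg.seq Router.mark <| .seq Router.closure <|
        .seq Router.entrySets (.loop 8 (.put 2 8 8 (.cell 3 8 8)))).run n inp τ).m ∧
      EntryState d G (jammed d F) (jammed d F' \ jammed d F) ∅ I I' := by
  have hmark := run_mark (inp := inp) hM hlen (hbit.trans (by omega)) hf
  simp only [Nat.add_sub_cancel] at hmark
  rw [← hedges] at hmark
  set τ₁ := Router.mark.run n inp τ with hτ₁
  have h11 : τ₁.m 1 = τ.m 1 := run_m (by decide) _
  have h12 : τ₁.m 2 = τ.m 2 := run_m (by decide) _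
  refine run_update hin hF' (τ := τ₁) (fun v w => ?_)
    (fun v w => by rw [h11]; exact h.entry v w) (fun v => by rw [h12]; exact h.jammed v) hlow
  change (s(v, w) ∈ usedEdges F' → _) ∧ (¬ s(v, w) ∈ usedEdges F' → _)
  rw [hmark v w, hiff]
  have h0 := h.used v w
  by_cases he : s(v, w) ∈ P.edges
  · rw [if_pos he]
    simp only [he, true_and, not_true_eq_false, false_and, or_false]
    omega
  · rw [if_neg he]
    simpa only [he, false_and, not_false_eq_true, true_and, false_or] using h0

/-- The assumptions on the graph and on the parameters of the game: `r` paths of length at most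
`ρ` fit into the graph, and more than half of the vertices can be reached by paths of length
`i ≤ ρ / 2`. -/
structure RoutingParameters (d r i : ℕ) (lam ρ : ℝ) (G : SimpleGraph (Fin n))
    [DecidableRel G.Adj] : Prop where
  regular : G.IsRegularOfDegree d
  mixing : MixingBound d lam G
  lt_degree : 200 < d
  le_card : 200 ≤ n
  lam_pos : 0 < lam
  lam_le : 200 * lam ≤ d
  radius_lt : i < n
  le_pow : (n : ℝ) ≤ (d / lam) ^ i
  radius_le : 2 * i ≤ ρ
  capacity : 16000 * (r * ρ) ≤ n * d

variable {r i : ℕ} {lam ρ : ℝ}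

/-- A request for a path is answered, and the invariants are kept. -/
lemma run_main_findPath (hG : RoutingParameters d r i lam ρ G) (hin : InputDescribes d G inp)
    {τ : LoopState} (h : DescribesFamily d F I τ.m) (hinv : RoutingInvariant d r ρ F I)
    {a b : Fin n} (h0 : inp.getD (2 + 0 + n * n) 0 = 0) (ha : inp.getD (2 + 1 + n * n) 0 = a)
    (hb : inp.getD (2 + 2 + n * n) 0 = b)
    (hq : (Request.findPath a b : Request G).IsAllowed d r F) :
    ∃ (p : G.Path a b) (I' : Fin n → Finset (Fin n)),
      (Router.main.run n inp τ).o = τ.o ++ encodePath ⟨a, b, p⟩ ∧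
      (∀ e ∈ p.1.edges, e ∉ usedEdges F) ∧
      DescribesFamily d (⟨a, b, p⟩ ::ₘ F) I' (Router.main.run n inp τ).m ∧
      RoutingInvariant d r ρ (⟨a, b, p⟩ ::ₘ F) I' := by
  classical
  have hd : 200 < d := hG.lt_degree
  set τ₀ := (LoopProg.set 6 (request 0)).run n inp τ with hτ₀
  have h6 : τ₀.v 6 = 0 := by
    simp [hτ₀, run_set, request, eval] at h0 ⊢
    simp [h0]
  have hball := fun v => hG.mixing.lt_two_mul_card_stepBall (by have := hG.le_card; omega)
    hG.lam_pos hG.lam_le (R := AllowedStep d F I) (fun v w h => h.1)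
    (fun v => by convert hinv.card_allowedStep hd hG.regular v) v hG.le_pow
  obtain ⟨p, f, ho, hm, hM, hlen, hf, hbit, hedges, hlen', hdisj, hentry⟩ :=
    run_findPath hin (τ := τ₀) h ha hb hG.radius_lt hball
  set P : RoutedPath G := ⟨a, b, p⟩ with hP
  set τ₁ := Router.findPath.run n inp τ₀ with hτ₁
  have hrun : Router.main.run n inp τ = (LoopProg.seq Router.mark <| .seq Router.closure <|
      .seq Router.entrySets (.loop 8 (.put 2 8 8 (.cell 3 8 8)))).run n inp τ₁ := by
    have : Router.main.run n inp τ = (LoopProg.seq Router.mark <| .seq Router.closure <|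
      .seq Router.entrySets (.loop 8 (.put 2 8 8 (.cell 3 8 8)))).run n inp
        ((LoopProg.ite (.var 6) Router.readPath Router.findPath).run n inp τ₀) := rfl
    rw [this, run_ite, eval, h6, if_neg (lt_irrefl 0)]
  have hρ : (P.length : ℝ) ≤ ρ := by
    refine le_trans ?_ hG.radius_le
    exact_mod_cast hlen'
  have hF' : (usedEdges (P ::ₘ F)).Nodup := by
    rw [usedEdges_cons, Multiset.nodup_add]
    exact ⟨Multiset.coe_nodup.mpr p.2.isTrail.edges_nodup, hinv.nodup,
      Multiset.disjoint_left.mpr fun {e} he => hdisj e he⟩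
  have hρ0 : 0 ≤ ρ := le_trans (by positivity) hρ
  have hcard := card_jammed_le (d := d) (r := r) hG.mixing (by omega) hG.lam_le hG.le_card hρ0
    (F := P ::ₘ F)
    (by rw [Multiset.card_cons]; exact hq.2.2)
    (fun Q hQ => (Multiset.mem_cons.mp hQ).elim (fun h => h ▸ hρ) (hinv.length_le Q)) hG.capacity
  obtain ⟨I', hI', hE⟩ := run_mark_update hin (τ := τ₁) (F := F) (I := I) (F' := P ::ₘ F)
    ⟨fun v w => by rw [hm 0 (by norm_num)]; exact h.used v w,
      fun v w => by rw [hm 1 (by norm_num)]; exact h.entry v w,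
      fun v => by rw [hm 2 (by norm_num)]; exact h.jammed v⟩ (P := P) hM hlen hbit.le hf hedges
    hF' (fun e => by
      rw [usedEdges_cons, Multiset.mem_add, Multiset.mem_coe, hbit]
      tauto)
    (fun X hX hne => hG.mixing.exists_degIn_le (by omega) hG.lam_le hne
      ((Nat.mul_le_mul_left 200 (Finset.card_le_card (hX.trans Finset.sdiff_subset))).trans hcard))
  refine ⟨p, I', ?_, hdisj, by rw [hrun]; exact hI', ?_⟩
  · rw [hrun, run_o, ho]
    · rfl
    · simp [Router.mark, Router.closure, Router.closureStep, Router.entrySets, Router.entryStep,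
        LoopProg.when, LoopProg.sum, Silent]
  · refine hinv.cons hdisj hρ hq.2.2 hq.1 hq.2.1 hentry
      (fun v hv => hE.old v fun h => (Finset.mem_sdiff.mp h).2 hv) (fun v hv hv' => ?_)
      fun v hv hv' w hw hvw => ?_
    · obtain ⟨Y, hY, hIY⟩ := hE.few v (Finset.mem_sdiff.mpr ⟨hv, hv'⟩) (Finset.notMem_empty v)
      have h1 := degIn_le_of_notMem_jammed hv'
      have h2 : (I' v).card ≤ degIn G (jammed d F) v + degIn G Y v := by
        rw [hIY, Finset.filter_union]
        exact Finset.card_union_le _ _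
      omega
    · have hvT := Finset.mem_sdiff.mpr ⟨hv, hv'⟩
      by_cases hwB : w ∈ jammed d F
      · exact Or.inr (hE.adj v hvT (Finset.notMem_empty v) w (Finset.mem_union_left _ hwB) hvw)
      · exact hE.adj' v hvT (Finset.notMem_empty v) w (Finset.mem_sdiff.mpr ⟨hw, hwB⟩)
          (Finset.notMem_empty w) hvw

/-- A request for the removal of a path keeps the invariants. -/
lemma run_main_removePath (hin : InputDescribes d G inp)
    {τ : LoopState} {P : RoutedPath G} (h : DescribesFamily d (P ::ₘ F) I τ.m)
    (hinv : RoutingInvariant d r ρ (P ::ₘ F) I)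
    (h0 : inp.getD (2 + 0 + n * n) 0 = 1) (h1 : inp.getD (2 + 1 + n * n) 0 = P.length + 1)
    (h2 : ∀ j < P.length + 1, inp.getD (4 + n * n + j) 0 = P.path.1.getVert j) :
    ∃ I' : Fin n → Finset (Fin n), (Router.main.run n inp τ).o = τ.o ∧
      DescribesFamily d F I' (Router.main.run n inp τ).m ∧ RoutingInvariant d r ρ F I' := by
  classical
  have hn : 1 ≤ n := P.src.pos
  have hlen : P.length < n := P.path.2.length_lt.trans_eq (Fintype.card_fin n)
  set τ₀ := (LoopProg.set 6 (request 0)).run n inp τ with hτ₀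
  have h6 : τ₀.v 6 = 1 := by
    simp [hτ₀, run_set, request, eval] at h0 ⊢
    rw [h0]
    exact min_eq_left hn
  obtain ⟨hM, hbit, hf⟩ := run_readPath (τ := τ₀) hlen h1 h2
  set τ₁ := Router.readPath.run n inp τ₀ with hτ₁
  have hm : ∀ c < 3, τ₁.m c = τ.m c := fun c hc => by
    rw [hτ₁, run_m]
    · rfl
    · interval_cases c <;> decide
  have hrun : Router.main.run n inp τ = (LoopProg.seq Router.mark <| .seq Router.closure <|
      .seq Router.entrySets (.loop 8 (.put 2 8 8 (.cell 3 8 8)))).run n inp τ₁ := by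
    have : Router.main.run n inp τ = (LoopProg.seq Router.mark <| .seq Router.closure <|
      .seq Router.entrySets (.loop 8 (.put 2 8 8 (.cell 3 8 8)))).run n inp
        ((LoopProg.ite (.var 6) Router.readPath Router.findPath).run n inp τ₀) := rfl
    rw [this, run_ite, eval, h6, if_pos one_pos]
  have hnodup := hinv.nodup
  rw [usedEdges_cons, Multiset.nodup_add] at hnodup
  have hsub := jammed_mono (d := d) P F
  -- No vertex becomes jammed, so that no entry set changes.
  have hempty : jammed d F \ jammed d (P ::ₘ F) = ∅ := Finset.sdiff_eq_empty_iff_subset.mpr hsub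
  obtain ⟨I', hI', hE⟩ := run_mark_update hin (τ := τ₁) (F := P ::ₘ F) (I := I) (F' := F)
    ⟨fun v w => by rw [hm 0 (by norm_num)]; exact h.used v w,
      fun v w => by rw [hm 1 (by norm_num)]; exact h.entry v w,
      fun v => by rw [hm 2 (by norm_num)]; exact h.jammed v⟩ (P := P)
      (f := P.path.1.getVert) hM hlen (by omega) hf
      (SimpleGraph.Walk.edges_eq_map_range P.path.1) hnodup.2.1 (fun e => by
        rw [usedEdges_cons, Multiset.mem_add, Multiset.mem_coe, hbit]
        have : e ∈ P.edges → e ∉ usedEdges F := fun he => Multiset.disjoint_left.mp hnodup.2.2 he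
        simp only [zero_ne_one, and_false, false_or]
        tauto)
      (fun X hX hne => by
        rw [hempty, Finset.subset_empty] at hX
        exact absurd hX hne.ne_empty)
  refine ⟨I', ?_, by rw [hrun]; exact hI', hinv.of_cons fun v hv => hE.old v ?_⟩
  · rw [hrun, run_o, hτ₁, run_o (by simp [Router.readPath, Silent])]
    · rfl
    · simp [Router.mark, Router.closure, Router.closureStep, Router.entrySets, Router.entryStep,
        LoopProg.when, LoopProg.sum, Silent]
  · rw [hempty]
    exact Finset.notMem_empty v

end Step

/-! ### The input words -/

section Input

variable {n : ℕ} {G : SimpleGraph (Fin n)}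

lemma length_encodePath (P : RoutedPath G) : (encodePath P).length = P.length + 1 := by
  rw [encodePath, List.length_map, RoutedPath.vertices, SimpleGraph.Walk.length_support]
  rfl

lemma getD_encodePath (P : RoutedPath G) {j : ℕ} (hj : j < P.length + 1) :
    (encodePath P).getD j 0 = P.path.1.getVert j := by
  rw [List.getD_eq_getElem _ _ (by rwa [length_encodePath])]
  simp only [encodePath, List.getElem_map, RoutedPath.vertices,
    SimpleGraph.Walk.support_getElem_eq_getVert]

variable [DecidableRel G.Adj]

lemma getD_encodeInput_request (d : ℕ) (q : Request G) (j : ℕ) :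
    (encodeInput d G q).getD (2 + n * n + j) 0 = (encodeRequest q).getD j 0 := by
  rw [encodeInput, List.getD_append_right _ _ _ _ (by simp; omega)]
  congr 1
  simp; omega

lemma inputDescribes_encodeInput (d : ℕ) (q : Request G) :
    InputDescribes d G (encodeInput d G q) := by
  refine ⟨rfl, rfl, fun v w => ?_⟩
  have hlt : (v : ℕ) * n + w < n * n := by
    have h1 : ((v : ℕ) + 1) * n ≤ n * n := Nat.mul_le_mul_right n v.2
    have h2 := w.2
    nlinarith
  have hdiv : (⟨v * n + w, hlt⟩ : Fin (n * n)).divNat = v := by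
    ext
    change ((v : ℕ) * n + w) / n = v
    rw [mul_comm, Nat.mul_add_div w.pos, Nat.div_eq_of_lt w.2, add_zero]
  have hmod : (⟨v * n + w, hlt⟩ : Fin (n * n)).modNat = w := by
    ext
    change ((v : ℕ) * n + w) % n = w
    rw [mul_comm, Nat.mul_add_mod, Nat.mod_eq_of_lt w.2]
  rw [encodeInput, List.getD_append _ _ _ _ (by simp; omega),
    List.getD_append_right _ _ _ _ (by simp)]
  simp only [List.length_cons, List.length_nil, Nat.zero_add, Nat.reduceAdd,
    Nat.add_sub_cancel_left]
  rw [List.getD_eq_getElem _ _ (by simpa using hlt), List.getElem_ofFn, hdiv, hmod]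

lemma le_of_mem_encodeInput {d : ℕ} (hn : 1 ≤ n) (hd : d ≤ n) (q : Request G) :
    ∀ w ∈ encodeInput d G q, w ≤ n := by
  intro w hw
  have hpath : ∀ P : RoutedPath G, w ∈ encodePath P → w ≤ n := by
    intro P hP
    obtain ⟨v, -, rfl⟩ := List.mem_map.mp hP
    exact v.2.le
  simp only [encodeInput, List.mem_append, List.mem_cons, List.not_mem_nil, or_false,
    List.mem_ofFn] at hw
  rcases hw with ((rfl | rfl) | ⟨k, rfl⟩) | hw
  · exact le_rfl
  · exact hd
  · split_ifs <;> omega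
  · cases q with
    | findPath a b =>
      simp only [encodeRequest, List.mem_cons, List.not_mem_nil, or_false] at hw
      rcases hw with rfl | rfl | rfl
      exacts [Nat.zero_le _, a.2.le, b.2.le]
    | removePath P =>
      simp only [encodeRequest, List.mem_cons] at hw
      rcases hw with rfl | rfl | hw
      · exact hn
      · rw [length_encodePath]
        exact P.path.2.length_lt.trans_eq (Fintype.card_fin n)
      · exact hpath P hw

end Input

/-! ### The choice of the parameters -/

section Parameters

variable {n d : ℕ} {lam : ℝ} {G : SimpleGraph (Fin n)} [DecidableRel G.Adj]

/-- The radius of the searches is the least `i` with `n ≤ (d / lam) ^ i`; the bound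
`d ≤ n ^ 2 * lam` shows that rounding up changes it by a constant factor only. -/
lemma IsNDLambdaGraph.routingParameters (h : IsNDLambdaGraph n d lam G) (hd : 200 < d)
    (hdn : d < n) (hlam : lam < 1 / 200 * d) :
    RoutingParameters d ⌊(1 / 96000 : ℝ) * (n * d) * (Real.log (d / lam) / Real.log n)⌋₊
      ⌈Real.log n / Real.log (d / lam)⌉₊ lam (6 * (Real.log n / Real.log (d / lam))) G := by
  have hd' : (200 : ℝ) < d := by exact_mod_cast hd
  have hdn' : (d : ℝ) < n := by exact_mod_cast hdn
  have hmix := h.mixingBound (by omega) (by linarith)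
  obtain ⟨hlam0, hsq⟩ := hmix.le_sq_mul (by omega) (by omega) h.1
  have hq : 200 < d / lam := by rw [lt_div_iff₀ hlam0]; linarith
  have hlog1 : 1 < Real.log (d / lam) := by
    rw [Real.lt_log_iff_exp_lt (by linarith)]
    linarith [Real.exp_one_lt_d9]
  have hlogn : 1 < Real.log n := by
    rw [Real.lt_log_iff_exp_lt (by linarith)]
    linarith [Real.exp_one_lt_d9]
  set x := Real.log (d / lam) with hx
  set y := Real.log n with hy
  -- The ratio `y / x` is bounded below, whence `2 * ⌈y / x⌉ ≤ 2 * (y / x) + 2 ≤ 6 * (y / x)`.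
  have hratio : 1 / 2 ≤ y / x := by
    rw [le_div_iff₀ (by linarith)]
    have : x ≤ Real.log ((n : ℝ) ^ 2) :=
      Real.log_le_log (by linarith) ((div_le_iff₀ hlam0).mpr hsq)
    rw [Real.log_pow] at this
    push_cast at this
    linarith
  have hceil := (Nat.ceil_lt_add_one (show 0 ≤ y / x by linarith)).le
  refine ⟨h.1, hmix, hd, by omega, hlam0, by linarith, ?_, ?_, by linarith, ?_⟩
  · have h1 : y ≤ n - 1 := Real.log_le_sub_one_of_pos (by linarith)
    have h2 : y / x ≤ y := div_le_self (by linarith) hlog1.le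
    have h3 : ⌈y / x⌉₊ ≤ n - 1 := by
      rw [Nat.ceil_le, Nat.cast_sub (by omega)]
      push_cast
      linarith
    omega
  · rw [← Real.log_le_log_iff (by linarith) (by positivity), Real.log_pow, ← hx, ← hy]
    exact (div_le_iff₀ (by linarith)).mp (Nat.le_ceil _)
  · have h1 := Nat.floor_le (show 0 ≤ (1 / 96000 : ℝ) * (n * d) * (x / y) by positivity)
    have h2 := mul_le_mul_of_nonneg_right h1 (show 0 ≤ 6 * (y / x) by linarith)
    have h3 : (1 / 96000 : ℝ) * (n * d) * (x / y) * (6 * (y / x)) = n * d / 16000 := by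
      field_simp
      ring
    linarith

end Parameters

/-! ### From the program to the strategy -/

section Play

/-- A program that keeps a relation `Good` between the family of paths and its store plays a
winning strategy. -/
lemma RamProgram.exists_strategy {n : ℕ} {G : SimpleGraph (Fin n)} [DecidableRel G.Adj]
    {prog : RamProgram} {d r W T : ℕ} (Good : Multiset (RoutedPath G) → RamStore → Prop)
    (hzero : Good 0 RamStore.zero)
    (hfind : ∀ F s a b, Good F s → (Request.findPath a b : Request G).IsAllowed d r F →
      ∃ (p : G.Path a b) (s' : RamStore) (t : ℕ), t ≤ T ∧
        prog.Exec W (encodeInput d G (.findPath a b)) s [] t s' (encodePath ⟨a, b, p⟩) ∧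
        (∀ Q ∈ F, List.Disjoint p.1.edges Q.edges) ∧ Good (⟨a, b, p⟩ ::ₘ F) s')
    (hremove : ∀ P F s, Good (P ::ₘ F) s → ∃ (s' : RamStore) (t : ℕ), t ≤ T ∧
        prog.Exec W (encodeInput d G (.removePath P)) s [] t s' [] ∧ Good F s') :
    ∃ S : RouterStrategy G, S.Wins d r ∧ prog.Plays S d r W T ∧
      ∀ h, S.Legal d r h → ∃ s, Good (S.family h) s := by
  classical
  -- The choices are extended arbitrarily to situations that do not occur in a game.
  have hfind' : ∀ F s a b, ∃ (o : Option (G.Path a b)) (s' : RamStore), Good F s →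
      (Request.findPath a b : Request G).IsAllowed d r F → ∃ p, o = some p ∧ (∃ t ≤ T,
        prog.Exec W (encodeInput d G (.findPath a b)) s [] t s' (encodePath ⟨a, b, p⟩)) ∧
        (∀ Q ∈ F, List.Disjoint p.1.edges Q.edges) ∧ Good (⟨a, b, p⟩ ::ₘ F) s' := by
    intro F s a b
    by_cases h : Good F s ∧ (Request.findPath a b : Request G).IsAllowed d r F
    · obtain ⟨p, s', t, ht, hx, hdis, hgood⟩ := hfind F s a b h.1 h.2
      exact ⟨some p, s', fun _ _ => ⟨p, rfl, ⟨t, ht, hx⟩, hdis, hgood⟩⟩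
    · exact ⟨none, s, fun h1 h2 => absurd ⟨h1, h2⟩ h⟩
  have hremove' : ∀ F s P, ∃ s' : RamStore, Good F s → P ∈ F →
      (∃ t ≤ T, prog.Exec W (encodeInput d G (.removePath P)) s [] t s' []) ∧
        Good (F.erase P) s' := by
    intro F s P
    by_cases h : Good F s ∧ P ∈ F
    · obtain ⟨s', t, ht, hx, hgood⟩ := hremove P (F.erase P) s (by
        rw [Multiset.cons_erase h.2]; exact h.1)
      exact ⟨s', fun _ _ => ⟨⟨t, ht, hx⟩, hgood⟩⟩
    · exact ⟨s, fun h1 h2 => absurd ⟨h1, h2⟩ h⟩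
  choose answer next hnext using hfind'
  choose next' hnext' using hremove'
  let state : List (Request G) → Multiset (RoutedPath G) × RamStore :=
    List.foldr (fun q x => match q with
      | .findPath a b => (match answer x.1 x.2 a b with
          | some p => ⟨a, b, p⟩ ::ₘ x.1
          | none => x.1, next x.1 x.2 a b)
      | .removePath P => (x.1.erase P, next' x.1 x.2 P)) (0, RamStore.zero)
  let S : RouterStrategy G := fun h a b => answer (state h).1 (state h).2 a b
  have hfam : ∀ h, S.family h = (state h).1 := by
    intro h
    induction h with
    | nil => rfl
    | cons q h ih =>
      cases q with
      | findPath a b =>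
        rw [RouterStrategy.family, ih]
        change _ = (match S h a b with
          | some p => (⟨a, b, p⟩ : RoutedPath G) ::ₘ (state h).1
          | none => (state h).1)
        cases S h a b <;> rfl
      | removePath P =>
        change (S.family h).erase P = _
        rw [ih]
        rfl
  have hgood : ∀ h, S.Legal d r h → Good (S.family h) (state h).2 := by
    intro h hh
    induction hh with
    | nil => exact hzero
    | @cons h q hl hq ih =>
      rw [hfam] at ih hq ⊢
      cases q with
      | findPath a b =>
        obtain ⟨p, hp, -, -, hg⟩ := hnext _ _ a b ih hq
        simp only [state, List.foldr_cons] at hp ⊢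
        rw [hp]
        exact hg
      | removePath P => exact (hnext' _ _ P ih hq).2
  refine ⟨S, fun h a b hl hq => ?_, ⟨fun h => (state h).2, rfl, fun h q hl hq => ?_⟩,
    fun h hl => ⟨_, hgood h hl⟩⟩
  · have hg := hgood h hl
    rw [hfam] at hg hq ⊢
    obtain ⟨p, hp, -, hdis, -⟩ := hnext _ _ a b hg hq
    exact ⟨p, hp, hdis⟩
  · have hg := hgood h hl
    rw [hfam] at hg hq
    cases q with
    | findPath a b =>
      obtain ⟨p, hp, ⟨t, ht, hx⟩, -⟩ := hnext _ _ a b hg hq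
      refine ⟨t, ht, ?_⟩
      have hS : S h a b = some p := hp
      simp only [RouterStrategy.answer, hS]
      exact hx
    | removePath P => exact (hnext' _ _ P hg hq).1

/-- The store `s` of the machine describes the family `F`: it represents a state of the routing
program in which the arrays describe `F`, together with entry sets that satisfy the invariant. -/
def DescribedBy {n : ℕ} {G : SimpleGraph (Fin n)} [DecidableRel G.Adj] (d r : ℕ) (ρ : ℝ)
    (F : Multiset (RoutedPath G)) (s : RamStore) : Prop :=
  ∃ (σ : LoopState) (I : Fin n → Finset (Fin n)), WeaklyRepresents n s σ ∧ σ.Bounded n ∧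
    σ.o = [] ∧ DescribesFamily d F I σ.m ∧ RoutingInvariant d r ρ F I

variable {n d r i : ℕ} {lam ρ : ℝ} {G : SimpleGraph (Fin n)} [DecidableRel G.Adj]

lemma describedBy_zero (hd : 0 < d) :
    DescribedBy d r ρ (0 : Multiset (RoutedPath G)) RamStore.zero := by
  refine ⟨⟨fun _ => 0, fun _ _ _ => 0, []⟩, fun _ => ∅, ⟨fun _ => rfl, fun _ _ _ _ _ => rfl⟩,
    ⟨fun _ => Nat.zero_le _, fun _ _ _ => Nat.zero_le _⟩, rfl, ⟨fun v w => ?_, fun v w => ?_,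
      fun v => ?_⟩, RoutingInvariant.zero r hd _⟩
  · simp
  · simp
  · simp [jammed_zero hd]

/-- What the machine does on a request follows from what the routing program does. -/
lemma exec_main {F' : Multiset (RoutedPath G)} (hn : 2 ≤ n) (hd : 0 < d) (hdn : d ≤ n)
    {s : RamStore} {q : Request G} {σ : LoopState} (hs : WeaklyRepresents n s σ)
    (hσ : σ.Bounded n) (ho : σ.o = []) {I' : Fin n → Finset (Fin n)}
    (hF : DescribesFamily d F' I' (Router.main.run n (encodeInput d G q) σ).m)
    (hinv : RoutingInvariant d r ρ F' I') :
    ∃ (s' : RamStore) (t : ℕ), t ≤ (Router.main.cost + 4) * n ^ 3 * d ^ 3 ∧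
      Router.main.compile.Exec (n ^ (Router.main.width + 2)) (encodeInput d G q) s [] t s'
        (Router.main.run n (encodeInput d G q) σ).o ∧ DescribedBy d r ρ F' s' := by
  obtain ⟨t, s', ht, hx, hs'⟩ := Router.main.exec_compile hn
    (le_of_mem_encodeInput (by omega) hdn q) rfl hσ hs
    (K := Router.main.width + 2) (by omega) (by omega)
  rw [ho] at hx
  refine ⟨s', t, ht.trans ?_, hx, ⟨_, _, []⟩, I', ⟨hs'.v, hs'.m⟩,
    LoopProg.bounded_run hσ, rfl, hF, hinv⟩
  have hdepth : Router.main.depth = 3 := rfl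
  have h1 : 1 ≤ n ^ 3 := Nat.one_le_pow _ _ (by omega)
  have h2 : 1 ≤ d ^ 3 := Nat.one_le_pow _ _ hd
  rw [hdepth]
  calc Router.main.cost * n ^ 3 + 4 ≤ (Router.main.cost + 4) * n ^ 3 := by nlinarith
    _ ≤ (Router.main.cost + 4) * n ^ 3 * d ^ 3 := Nat.le_mul_of_pos_right _ h2

/-- The routing program plays a winning strategy with short paths. -/
lemma RoutingParameters.exists_strategy (hG : RoutingParameters d r i lam ρ G) (hdn : d ≤ n) :
    ∃ S : RouterStrategy G, S.Wins d r ∧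
      Router.main.compile.Plays S d r (n ^ (Router.main.width + 2))
        ((Router.main.cost + 4) * n ^ 3 * d ^ 3) ∧
      ∀ h, S.Legal d r h → ∀ P ∈ S.family h, (P.length : ℝ) ≤ ρ := by
  have hd := hG.lt_degree
  have hreq := fun (q : Request G) (j : ℕ) => getD_encodeInput_request d q j
  have hn := hG.le_card
  refine Exists.imp (fun S hS => ⟨hS.1, hS.2.1, fun h hh => ?_⟩)
    (RamProgram.exists_strategy (DescribedBy (G := G) d r ρ) (describedBy_zero (by omega)) ?_ ?_)
  · obtain ⟨s, σ, I, -, -, -, -, hinv⟩ := hS.2.2 h hh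
    exact hinv.length_le
  · rintro F s a b ⟨σ, I, hs, hσ, ho, hF, hinv⟩ hq
    have hreq := hreq (.findPath a b)
    obtain ⟨p, I', ho', hdis, hF', hinv'⟩ := run_main_findPath hG
      (inputDescribes_encodeInput d (.findPath a b)) hF hinv
      (by rw [add_right_comm, hreq]; rfl) (by rw [add_right_comm, hreq]; rfl)
      (by rw [add_right_comm, hreq]; rfl) hq
    obtain ⟨s', t, ht, hx, hs'⟩ := exec_main (by omega) (by omega) hdn hs hσ ho hF' hinv'
    rw [ho', ho, List.nil_append] at hx
    refine ⟨p, s', t, ht, hx, fun Q hQ e he he' => hdis e he ?_, hs'⟩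
    exact Multiset.mem_bind.mpr ⟨Q, hQ, Multiset.mem_coe.mpr he'⟩
  · rintro P F s ⟨σ, I, hs, hσ, ho, hF, hinv⟩
    have hreq := hreq (.removePath P)
    obtain ⟨I', ho', hF', hinv'⟩ := run_main_removePath
      (inputDescribes_encodeInput d (.removePath P)) hF hinv
      (by rw [add_right_comm, hreq]; rfl)
      (by rw [add_right_comm, hreq]; exact length_encodePath P)
      (fun j hj => by
        rw [show 4 + n * n + j = 2 + n * n + (j + 2) by ring, hreq]
        exact getD_encodePath P hj)
    obtain ⟨s', t, ht, hx, hs'⟩ := exec_main (by omega) (by omega) hdn hs hσ ho hF' hinv'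
    rw [ho', ho] at hx
    exact ⟨s', t, ht, hx, hs'⟩

end Play

theorem theorem2 :
    ∃ (ε α L : ℝ) (C K : ℕ) (prog : RamProgram), 0 < ε ∧ 0 < α ∧
      ∀ (n d : ℕ) (lam : ℝ) (G : SimpleGraph (Fin n)) [DecidableRel G.Adj],
        200 < d → d < n → IsNDLambdaGraph n d lam G → lam < ε * d →
          ∃ S : RouterStrategy G,
            S.Wins d ⌊α * (n * d) * (Real.log (d / lam) / Real.log n)⌋₊ ∧
            prog.Plays S d ⌊α * (n * d) * (Real.log (d / lam) / Real.log n)⌋₊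
              (n ^ K) (C * n ^ 3 * d ^ 3) ∧
            ∀ h : List (Request G),
              S.Legal d ⌊α * (n * d) * (Real.log (d / lam) / Real.log n)⌋₊ h →
                ∀ P ∈ S.family h, (P.length : ℝ) ≤ L * (Real.log n / Real.log (d / lam)) :=
  ⟨1 / 200, 1 / 96000, 6, Router.main.cost + 4, Router.main.width + 2, Router.main.compile,
    by norm_num, by norm_num, fun _ _ _ _ _ hd hdn h hlam =>
      (h.routingParameters hd hdn hlam).exists_strategy hdn.le⟩
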